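/- Let $\triangle$ be the triangular grid of the plane: the projection of the cubic grid of $\mathbb{Z}^3$ along $(1,1,1)$. A calisson is the union of two triangles of $\triangle$ that share an edge; the calisson overlaps this edge, and the direction of this edge is its color (three colors). A finite region $R$ is a finite set of triangles of $\triangle$, possibly cut open along some edges between two of its triangles (the boundary $\partial R$ then passes through these edges twice). An inner edge of $R$ is an edge between two triangles of $R$ along which $R$ is not cut open. $R$ is simply connected if it is nonempty, its triangles are connected by adjacency across inner edges, and every closed path of triangles adjacent across inner edges can be contracted within the interior of $R$. $|\partial R|$ is the length of $\partial R$, i.e. the number of sides of triangles of $R$ that are not inner edges. For a set $X$ of edges of $\triangle$, the puzzle $\mathrm{Calissons}(X,R)$ asks for a tiling of $R$ by calissons, each overlapping an inner edge of $R$, such that (i) no edge of $X$ is overlapped by the interior of a calisson, and (ii) for every inner edge of $R$ that belongs to $X$, the two calissons adjacent to it have different colors. Theorem. There is an algorithm that, given any finite simply connected region $R$ and any set $X$ of edges, as a list of the triangles of $R$ in any order, with their coordinates and with marks on those of their sides that belong to $X$ or along which $R$ is cut open, outputs the list of the calissons of a solution of $\mathrm{Calissons}(X,R)$, or reports that no solution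 exists, in time $O(|\partial R|^3)$. More precisely, there are a program for a unit-cost random access machine (integer variables and arrays, with addition and subtraction as the only arithmetic) and a constant $C$ such that on every such input the program halts with a correct answer after at most $C\,|\partial R|^3$ steps. -/

import Mathlib

namespace Calissons

/-! ### The triangular grid -/

/-- Vertices of the triangular grid, in the coordinates `φ(x,y,z) = (x - z, y - z)`:
the quotient of `ℤ³` by the direction `(1,1,1)`. -/
abbrev Vertex : Type := ℤ × ℤ

/-- The projection along `(1,1,1)`. -/
def phi (x y z : ℤ) : Vertex := (x - z, y - z)

/-- The three positive directions `φ(1,0,0)`, `φ(0,1,0)`, `φ(0,0,1)`; their sum is `0`. -/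
def dir (i : Fin 3) : Vertex := ![phi 1 0 0, phi 0 1 0, phi 0 0 1] i

/-- The edge of the grid from `base` to `base + dir axis`. -/
structure Edge where
  base : Vertex
  axis : Fin 3
deriving DecidableEq

/-- The triangles of the grid. With `v = base`, the left triangle (`right = false`) has vertices
`v`, `v + dir 0`, `v + dir 0 + dir 1`, and the right triangle (`right = true`) has vertices
`v`, `v + dir 1`, `v + dir 0 + dir 1`. -/
structure Tri where
  base : Vertex
  right : Bool
deriving DecidableEq

/-- The three vertices of a triangle. -/
def Tri.verts (t : Tri) : Finset Vertex :=
  {t.base, t.base + dir (if t.right then 1 else 0), t.base + dir 0 + dir 1}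

/-- The side of a triangle that is parallel to `dir i`. -/
def Tri.side (t : Tri) (i : Fin 3) : Edge :=
  match i with
  | 0 => ⟨if t.right then t.base + dir 1 else t.base, 0⟩
  | 1 => ⟨if t.right then t.base else t.base + dir 0, 1⟩
  | 2 => ⟨t.base + dir 0 + dir 1, 2⟩

/-- The left (`b = false`) and the right (`b = true`) triangle that have `e` as a side. -/
def Edge.tri (e : Edge) (b : Bool) : Tri :=
  match e.axis with
  | 0 => ⟨if b then e.base - dir 1 else e.base, b⟩
  | 1 => ⟨if b then e.base else e.base - dir 0, b⟩
  | 2 => ⟨e.base - dir 0 - dir 1, b⟩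

/-- A calisson: the projection of the unit square of the cubic grid with lowest corner over `base`
and normal direction `color` (`0` blue, `1` red, `2` yellow). Its vertices are
`base`, `base + dir j`, `base + dir k`, `base + dir j + dir k`, where `{color, j, k} = {0, 1, 2}`. -/
structure Calisson where
  base : Vertex
  color : Fin 3
deriving DecidableEq

/-- The only edge that is overlapped by the interior of a calisson: its short diagonal, which joins
`base + dir j + dir k = base - dir color` to `base`. -/
def Calisson.diagonal (c : Calisson) : Edge := ⟨c.base - dir c.color, c.color⟩

/-- The calisson `c` contains the triangle `t`, i.e. `t` is one of the two triangles on the two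
sides of the diagonal of `c`. -/
def Calisson.Covers (c : Calisson) (t : Tri) : Prop := ∃ b, t = c.diagonal.tri b

/-! ### Regions -/

/-- A finite region: a finite set of triangles of the grid, which may be cut open along some edges
between two of its triangles (the boundary then passes twice through these edges). -/
structure Region where
  tris : Finset Tri
  slits : Finset Edge
  slits_between : ∀ e ∈ slits, ∀ b, e.tri b ∈ tris

namespace Region

/-- `e` is an inner edge of the region: both its triangles belong to the region, and the region is
not cut open along `e`. -/
def Inner (R : Region) (e : Edge) : Prop := e ∉ R.slits ∧ ∀ b, e.tri b ∈ R.tris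

/-- Two triangles of the region are adjacent when they share an inner edge. -/
def dual (R : Region) : SimpleGraph Tri where
  Adj s t := ∃ e, R.Inner e ∧ ∃ b, s = e.tri b ∧ t = e.tri (!b)
  symm := ⟨fun s t h => by
    obtain ⟨e, he, b, hs, ht⟩ := h
    exact ⟨e, he, !b, ht, by simpa using hs⟩⟩
  loopless := ⟨fun s h => by
    obtain ⟨e, he, b, hs, ht⟩ := h
    have h1 : ∀ b, (e.tri b).right = b := by
      intro b
      unfold Edge.tri
      split <;> rfl
    have h2 := congrArg Tri.right (hs.symm.trans ht)
    rw [h1, h1] at h2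
    cases b <;> simp at h2⟩

/-- Homotopy (with fixed end points) of paths of adjacent triangles in the region. It is generated
by two moves: removing a step that is immediately retraced, and removing a turn around a vertex.
(A cycle of adjacent triangles that all contain the vertex `v` consists of the six triangles
around `v`, consecutive ones being separated by an inner edge, so that `v` is in the interior of
the region.) -/
inductive Homotopic (R : Region) : {s t : Tri} → R.dual.Walk s t → R.dual.Walk s t → Prop
  | refl {s t : Tri} (p : R.dual.Walk s t) : Homotopic R p p
  | symm {s t : Tri} {p q : R.dual.Walk s t} : Homotopic R p q → Homotopic R q p
  | trans {s t : Tri} {p q r : R.dual.Walk s t} :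
      Homotopic R p q → Homotopic R q r → Homotopic R p r
  | retrace {r s t u : Tri} (p : R.dual.Walk r s) (h : R.dual.Adj s t) (q : R.dual.Walk s u) :
      Homotopic R (p.append (.cons h (.cons h.symm q))) (p.append q)
  | turn {r s u : Tri} (v : Vertex) (p : R.dual.Walk r s) (c : R.dual.Walk s s)
      (q : R.dual.Walk s u) (hc : c.IsCycle) (hv : ∀ t ∈ c.support, v ∈ t.verts) :
      Homotopic R (p.append (c.append q)) (p.append q)

/-- The region is simply connected: it is nonempty, its triangles are connected by edge adjacency
across inner edges, and every closed path of adjacent triangles can be contracted. -/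
structure SimplyConnected (R : Region) : Prop where
  nonempty : R.tris.Nonempty
  connected : ∀ s ∈ R.tris, ∀ t ∈ R.tris, R.dual.Reachable s t
  contractible : ∀ t ∈ R.tris, ∀ p : R.dual.Walk t t, R.Homotopic p .nil

open Classical in
/-- The length `|∂R|` of the boundary: the number of sides of triangles of the region that are not
inner edges. An edge along which the region is cut open counts twice. -/
noncomputable def boundarySize (R : Region) : ℕ :=
  ((R.tris ×ˢ (Finset.univ : Finset (Fin 3))).filter fun p => ¬ R.Inner (p.1.side p.2)).card

/-! ### The puzzle -/

/-- `T` is a calisson tiling of the region: every calisson of `T` lies in the region and does not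
overlap its boundary, and every triangle of the region is in exactly one calisson of `T`. -/
def IsTiling (R : Region) (T : Finset Calisson) : Prop :=
  (∀ c ∈ T, R.Inner c.diagonal) ∧ ∀ t ∈ R.tris, ∃! c, c ∈ T ∧ c.Covers t

/-- `T` is a solution of the puzzle on the region with the set `X` of imposed edges:
a tiling such that (i) no edge of `X` is overlapped by the interior of a calisson, and (ii) the two
calissons adjacent to an edge of `X` have different colors. Condition (ii) is about the edges of
`X` in the interior of the region and not about those on its boundary. -/
structure IsSolution (R : Region) (X : Set Edge) (T : Finset Calisson) : Prop where
  tiling : R.IsTiling T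
  nonoverlap : ∀ c ∈ T, c.diagonal ∉ X
  salient : ∀ e ∈ X, R.Inner e → ∀ c ∈ T, ∀ c' ∈ T,
    c.Covers (e.tri false) → c'.Covers (e.tri true) → c.color ≠ c'.color

end Region

/-! ### A random access machine with unit cost -/

/-- Programs of a random access machine with integer variables and one-dimensional integer arrays
(indexed by all integers). Variables and arrays are named by natural numbers; every program uses
finitely many of them. The only arithmetic is addition and subtraction. -/
inductive Prog : Type
  | skip : Prog
  /-- `x := n` for a fixed integer `n` -/
  | const (x : ℕ) (n : ℤ) : Prog
  /-- `x := y + z` -/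
  | add (x y z : ℕ) : Prog
  /-- `x := y - z` -/
  | sub (x y z : ℕ) : Prog
  /-- `x := A[y]` -/
  | load (x A y : ℕ) : Prog
  /-- `A[y] := x` -/
  | store (A y x : ℕ) : Prog
  | seq (P Q : Prog) : Prog
  /-- `if 0 < x then P else Q` -/
  | ite (x : ℕ) (P Q : Prog) : Prog
  /-- `while 0 < x do P` -/
  | loop (x : ℕ) (P : Prog) : Prog

/-- The contents of the variables and of the arrays. -/
structure Store where
  var : ℕ → ℤ
  arr : ℕ → ℤ → ℤ

/-- The store `s` after `x := n`. -/
def Store.set (s : Store) (x : ℕ) (n : ℤ) : Store :=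
  { s with var := Function.update s.var x n }

/-- The store `s` after `A[i] := n`. -/
def Store.write (s : Store) (A : ℕ) (i n : ℤ) : Store :=
  { s with arr := Function.update s.arr A (Function.update (s.arr A) i n) }

/-- `Exec P s k s'`: started in the store `s`, the program `P` halts after exactly `k` steps in the
store `s'`. Every elementary instruction and every evaluation of a test is one step. -/
inductive Exec : Prog → Store → ℕ → Store → Prop
  | skip (s : Store) : Exec .skip s 1 s
  | const (s : Store) (x : ℕ) (n : ℤ) : Exec (.const x n) s 1 (s.set x n)
  | add (s : Store) (x y z : ℕ) : Exec (.add x y z) s 1 (s.set x (s.var y + s.var z))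
  | sub (s : Store) (x y z : ℕ) : Exec (.sub x y z) s 1 (s.set x (s.var y - s.var z))
  | load (s : Store) (x A y : ℕ) : Exec (.load x A y) s 1 (s.set x (s.arr A (s.var y)))
  | store (s : Store) (A y x : ℕ) : Exec (.store A y x) s 1 (s.write A (s.var y) (s.var x))
  | seq {P Q : Prog} {s s' s'' : Store} {k l : ℕ} :
      Exec P s k s' → Exec Q s' l s'' → Exec (.seq P Q) s (k + l) s''
  | ite_pos {x : ℕ} {P Q : Prog} {s s' : Store} {k : ℕ} :
      0 < s.var x → Exec P s k s' → Exec (.ite x P Q) s (k + 1) s'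
  | ite_neg {x : ℕ} {P Q : Prog} {s s' : Store} {k : ℕ} :
      ¬ 0 < s.var x → Exec Q s k s' → Exec (.ite x P Q) s (k + 1) s'
  | loop_exit {x : ℕ} {P : Prog} {s : Store} :
      ¬ 0 < s.var x → Exec (.loop x P) s 1 s
  | loop_step {x : ℕ} {P : Prog} {s s' s'' : Store} {k l : ℕ} :
      0 < s.var x → Exec P s k s' → Exec (.loop x P) s' l s'' →
        Exec (.loop x P) s (k + l + 1) s''

/-- The initial store on a finite sequence of integers: variable `0` holds its length, array `0`
holds its entries (from index `0` on), and everything else is `0`. -/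
def Store.init (input : List ℤ) : Store where
  var x := if x = 0 then (input.length : ℤ) else 0
  arr A i := if A = 0 ∧ 0 ≤ i then input.getD i.toNat 0 else 0

/-- The sequence of integers that is read off from a final store: variable `1` holds its length and
array `1` its entries. -/
def Store.output (s : Store) : List ℤ :=
  (List.range (s.var 1).toNat).map fun j => s.arr 1 (j : ℤ)

/-- On the given input, `P` halts after exactly `k` steps with the given output. -/
def Prog.Computes (P : Prog) (input : List ℤ) (k : ℕ) (output : List ℤ) : Prop :=
  ∃ s : Store, Exec P (Store.init input) k s ∧ s.output = output

/-! ### Input and output format -/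

open Classical in
/-- The truth value of a proposition as an integer. -/
noncomputable def bit (p : Prop) : ℤ := if p then 1 else 0

/-- The description of one triangle of a puzzle: its coordinates, whether it is a right triangle,
which of its three sides are in `X`, and along which of them the region is cut open. -/
noncomputable def triCode (R : Region) (X : Set Edge) (t : Tri) : List ℤ :=
  [t.base.1, t.base.2, bit (t.right = true),
    bit (t.side 0 ∈ X), bit (t.side 1 ∈ X), bit (t.side 2 ∈ X),
    bit (t.side 0 ∈ R.slits), bit (t.side 1 ∈ R.slits), bit (t.side 2 ∈ R.slits)]

/-- The description of a puzzle whose triangles are listed in the order `l`. -/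
noncomputable def puzzleCode (R : Region) (X : Set Edge) (l : List Tri) : List ℤ :=
  l.flatMap (triCode R X)

/-- The description of a calisson: the coordinates of its base point, and its color. -/
def calissonCode (c : Calisson) : List ℤ :=
  [c.base.1, c.base.2, (c.color.val : ℤ)]

/-- The output `out` is a correct answer to the puzzle: either it is `1` followed by a list of the
calissons of a solution, or it is `0` and there is no solution. -/
def CorrectAnswer (R : Region) (X : Set Edge) (out : List ℤ) : Prop :=
  (∃ L : List Calisson, L.Nodup ∧ R.IsSolution X L.toFinset ∧ out = 1 :: L.flatMap calissonCode) ∨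
    (out = [0] ∧ ¬ ∃ T : Finset Calisson, R.IsSolution X T)

end Calissons

namespace Calissons

/-! ### Triangles, their corners and their neighbours -/

/-! A calisson tiling is the picture of a stepped surface and is encoded by heights. Along an edge
in a positive direction the height rises by 1 if the edge is not overlapped and drops by 2 if it is.
After subtracting the coordinates and dividing by 3, the increment in direction `dir i` is `eps i`
or `eps i - 1`; the increments around a triangle sum to 0, so exactly one side is overlapped.
Boundary and imposed edges are not overlapped, and then the calissons on the two sides of an imposed
edge have different colors exactly when the two vertices opposite to it have equal unreduced
heights. So a solution amounts to an integer solution of a system of difference constraints,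
`IsHeight` (see `exists_height`, `isSolution`). Heights live on corners of triangles rather than on
vertices, because a vertex on a slit may carry several heights. Simple connectedness lets local
heights integrate (`exists_global`).

The system is solved by relaxation. All values start at 0, and a violated constraint raises its
target to the required value. The values never exceed any nonnegative solution, so a value forced
above an a priori bound `D` proves that there is no solution (`RelaxInv.step`).

The bound `D = 8 * |∂R|` comes from `range_le`. The boundary of a simply connected region is
connected (`exists_const`), and its heights change by at most 1 along a side, so every intermediate
level is met at a boundary side and boundary heights spread over at most `|∂R|`. Any triangle
reaches the boundary along its row in fewer than `2 * |∂R|` steps, each changing heights by at most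
1.

Connectedness of the boundary is a discrete duality. The increments of a function that is locally
constant on the boundary form a closed flow on the inner edges. Summing it along rays gives a
potential on the whole grid. The potential vanishes at boundary vertices, since a ray from such a
vertex is the jump set of a function on triangles (`exists_jump_on_ray`) and a closed flow is
orthogonal to jumps (`sum_flow`).

For the running time, there are `n ≤ 2 * |∂R|^2` triangles (`card_tris_le`), each with boundedly
many values. Each value is raised at most `D` times, and each raise costs bounded work, for a total
of `O(n * |∂R|) = O(|∂R|^3)`. Neighbours are found in constant time through an index addressed by
coordinates; a table of multiples replaces multiplication. -/

/-- The triangle on the other side of the side parallel to `dir i`. -/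
def Tri.nb (t : Tri) (i : Fin 3) : Tri := (t.side i).tri (!t.right)

/-- The vertex of a triangle opposite to the side parallel to `dir j`. -/
def Tri.corner (t : Tri) (j : Fin 3) : Vertex :=
  if t.right then
    ![t.base, (t.base.1 + 1, t.base.2 + 1), (t.base.1, t.base.2 + 1)] j
  else
    ![(t.base.1 + 1, t.base.2 + 1), t.base, (t.base.1 + 1, t.base.2)] j

/-- The corner at which the side parallel to `dir i` starts. -/
def Tri.bot (t : Tri) (i : Fin 3) : Fin 3 := if t.right then i + 2 else i + 1

/-- The corner at which the side parallel to `dir i` ends. -/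
def Tri.top (t : Tri) (i : Fin 3) : Fin 3 := if t.right then i + 1 else i + 2

theorem Edge.tri_right (e : Edge) (b : Bool) : (e.tri b).right = b := by
  unfold Edge.tri; split <;> rfl

theorem Tri.side_axis (t : Tri) (i : Fin 3) : (t.side i).axis = i := by
  fin_cases i <;> rfl

theorem Tri.tri_side (t : Tri) (i : Fin 3) : (t.side i).tri t.right = t := by
  obtain ⟨⟨x, y⟩, r⟩ := t
  fin_cases i <;> cases r <;> simp [Tri.side, Edge.tri, dir, phi]

theorem Edge.side_tri (e : Edge) (b : Bool) : (e.tri b).side e.axis = e := by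
  obtain ⟨⟨x, y⟩, i⟩ := e
  fin_cases i <;> cases b <;> simp [Tri.side, Edge.tri, dir, phi]

theorem Edge.exists_side (e : Edge) (b : Bool) :
    ∃ t : Tri, ∃ i, t.right = b ∧ e = t.side i :=
  ⟨e.tri b, e.axis, e.tri_right b, (e.side_tri b).symm⟩

theorem Tri.nb_right (t : Tri) (i : Fin 3) : (t.nb i).right = !t.right := Edge.tri_right _ _

theorem Tri.nb_side (t : Tri) (i : Fin 3) : (t.nb i).side i = t.side i := by
  have := (t.side i).side_tri (!t.right)
  rwa [t.side_axis] at this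

theorem Tri.nb_nb (t : Tri) (i : Fin 3) : (t.nb i).nb i = t := by
  rw [Tri.nb, Tri.nb_side, Tri.nb_right, Bool.not_not, Tri.tri_side]

theorem Edge.nb_tri (e : Edge) (b : Bool) : (e.tri b).nb e.axis = e.tri (!b) := by
  rw [Tri.nb, Edge.side_tri, Edge.tri_right]

theorem Tri.nb_eq (t : Tri) (i : Fin 3) :
    t.nb i = if t.right then ⟨![(t.base.1, t.base.2 + 1), (t.base.1 - 1, t.base.2), t.base] i, false⟩
      else ⟨![(t.base.1, t.base.2 - 1), (t.base.1 + 1, t.base.2), t.base] i, true⟩ := by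
  obtain ⟨⟨x, y⟩, r⟩ := t
  fin_cases i <;> cases r <;> simp [Tri.nb, Tri.side, Edge.tri, dir, phi]

theorem Tri.corner_nb₁ (t : Tri) (i : Fin 3) : (t.nb i).corner (i + 1) = t.corner (i + 2) := by
  obtain ⟨⟨x, y⟩, r⟩ := t
  fin_cases i <;> cases r <;> simp [Tri.nb_eq, Tri.corner]

theorem Tri.corner_nb₂ (t : Tri) (i : Fin 3) : (t.nb i).corner (i + 2) = t.corner (i + 1) := by
  obtain ⟨⟨x, y⟩, r⟩ := t
  fin_cases i <;> cases r <;> simp [Tri.nb_eq, Tri.corner]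

theorem Tri.mem_verts (t : Tri) (v : Vertex) : v ∈ t.verts ↔ ∃ j, v = t.corner j := by
  obtain ⟨⟨x, y⟩, r⟩ := t
  cases r <;> simp [Tri.verts, Tri.corner, Fin.exists_fin_succ, dir, phi] <;> tauto

theorem Tri.corner_injective (t : Tri) : Function.Injective t.corner := by
  obtain ⟨⟨x, y⟩, r⟩ := t
  intro i j
  cases r <;> fin_cases i <;> fin_cases j <;> simp [Tri.corner]

theorem Tri.corner_not_mem_nb (t : Tri) (i : Fin 3) : t.corner i ∉ (t.nb i).verts := by
  obtain ⟨⟨x, y⟩, r⟩ := t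
  fin_cases i <;> cases r <;>
    simp [Tri.nb_eq, Tri.corner, Tri.verts, dir, phi]

theorem Tri.nb_injective (t : Tri) : Function.Injective t.nb := by
  obtain ⟨⟨x, y⟩, r⟩ := t
  intro i j
  cases r <;> fin_cases i <;> fin_cases j <;> simp [Tri.nb_eq] <;> omega

theorem Fin.three_cases (i j : Fin 3) : j = i ∨ j = i + 1 ∨ j = i + 2 := by
  revert i j; decide

namespace Region

variable {R : Region}

theorem inner_side (t : Tri) (i : Fin 3) :
    R.Inner (t.side i) ↔ t.side i ∉ R.slits ∧ t ∈ R.tris ∧ t.nb i ∈ R.tris := by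
  have h1 := t.tri_side i
  unfold Inner Tri.nb
  constructor
  · rintro ⟨h, h'⟩
    exact ⟨h, h1 ▸ h' t.right, h' _⟩
  · rintro ⟨h, h2, h3⟩
    refine ⟨h, fun b => ?_⟩
    rcases Bool.eq_or_eq_not b t.right with rfl | rfl
    · rwa [h1]
    · exact h3

theorem adj_iff (s t : Tri) : R.dual.Adj s t ↔ ∃ i, R.Inner (s.side i) ∧ t = s.nb i := by
  constructor
  · rintro ⟨e, he, b, rfl, rfl⟩
    exact ⟨e.axis, by rwa [Edge.side_tri], (e.nb_tri b).symm⟩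
  · rintro ⟨i, hi, rfl⟩
    exact ⟨s.side i, hi, s.right, (s.tri_side i).symm, rfl⟩

theorem adj_nb {t : Tri} {i : Fin 3} (h : R.Inner (t.side i)) : R.dual.Adj t (t.nb i) :=
  (adj_iff _ _).2 ⟨i, h, rfl⟩

/-! ### Local heights on a simply connected region integrate -/

/-- The jump of the reference height between two adjacent triangles with local heights `a`. -/
def jump (a : Tri → Fin 3 → ℤ) (s t : Tri) : ℤ :=
  ∑ i : Fin 3, if t = s.nb i then a s (i + 1) - a t (i + 2) else 0

theorem jump_nb (a : Tri → Fin 3 → ℤ) (s : Tri) (i : Fin 3) :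
    jump a s (s.nb i) = a s (i + 1) - a (s.nb i) (i + 2) := by
  unfold jump
  rw [Finset.sum_eq_single i]
  · simp
  · intro j _ hj
    rw [if_neg]
    exact fun h => hj (s.nb_injective h).symm
  · simp

/-- The total jump along a walk. -/
def walkJump (a : Tri → Fin 3 → ℤ) : {s t : Tri} → R.dual.Walk s t → ℤ
  | _, _, .nil => 0
  | s, _, .cons (v := u) _ p => jump a s u + walkJump a p

theorem walkJump_append (a : Tri → Fin 3 → ℤ) {s t u : Tri} (p : R.dual.Walk s t)
    (q : R.dual.Walk t u) : walkJump a (p.append q) = walkJump a p + walkJump a q := by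
  induction p with
  | nil => simp [walkJump]
  | cons h p ih => simp [walkJump, ih, add_assoc]

/-- Local heights `a` agree up to a constant along every inner edge. -/
def Compatible (R : Region) (a : Tri → Fin 3 → ℤ) : Prop :=
  ∀ t i, R.Inner (t.side i) →
    a t (i + 1) - a (t.nb i) (i + 2) = a t (i + 2) - a (t.nb i) (i + 1)

theorem jump_symm {a : Tri → Fin 3 → ℤ} (ha : R.Compatible a) {s t : Tri}
    (h : R.dual.Adj s t) : jump a t s = - jump a s t := by
  obtain ⟨i, hi, rfl⟩ := (adj_iff _ _).1 h
  have h1 := jump_nb a (s.nb i) i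
  rw [Tri.nb_nb] at h1
  rw [h1, jump_nb, ha s i hi]
  ring

/-- Compatibility says that the two ends of the common side give the same jump, so it may be read
off at either shared vertex. -/
theorem jump_of_common {a : Tri → Fin 3 → ℤ} (ha : R.Compatible a) {s t : Tri}
    (h : R.dual.Adj s t) {j k : Fin 3} (hv : s.corner j = t.corner k) :
    jump a s t = a s j - a t k := by
  obtain ⟨i, hi, rfl⟩ := (adj_iff _ _).1 h
  rw [jump_nb]
  rcases Fin.three_cases i j with rfl | rfl | rfl
  · exact absurd ((Tri.mem_verts _ _).2 ⟨k, hv⟩) (s.corner_not_mem_nb _)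
  · rw [← Tri.corner_nb₂] at hv
    rw [Tri.corner_injective _ hv]
  · rw [← Tri.corner_nb₁] at hv
    rw [← Tri.corner_injective _ hv]
    exact ha s i hi

/-- All triangles of the walk contain `v`, so each jump is a difference of local heights at `v` and
the sum telescopes. -/
theorem walkJump_around {a : Tri → Fin 3 → ℤ} (ha : R.Compatible a) (v : Vertex) {s t : Tri}
    (p : R.dual.Walk s t) (hv : ∀ t ∈ p.support, v ∈ t.verts) {j k : Fin 3}
    (hj : v = s.corner j) (hk : v = t.corner k) : walkJump a p = a s j - a t k := by
  induction p generalizing j with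
  | nil =>
    rw [hj] at hk
    rw [Tri.corner_injective _ hk]
    simp [walkJump]
  | @cons s u t h p ih =>
    obtain ⟨l, hl⟩ := (Tri.mem_verts _ _).1 (hv u (by simp))
    have h1 := ih (fun t ht => hv t (by simp [ht])) hl hk
    rw [walkJump, h1, jump_of_common ha h (hj.symm.trans hl)]
    ring

/-- A retraced step cancels, and a turn around a vertex telescopes to 0 because it returns to the
same corner. -/
theorem walkJump_homotopic {a : Tri → Fin 3 → ℤ} (ha : R.Compatible a) {s t : Tri}
    {p q : R.dual.Walk s t} (h : R.Homotopic p q) : walkJump a p = walkJump a q := by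
  induction h with
  | refl => rfl
  | symm _ ih => exact ih.symm
  | trans _ _ ih₁ ih₂ => exact ih₁.trans ih₂
  | retrace p h q =>
    simp [walkJump_append, walkJump, jump_symm ha h]
  | turn v p c q hc hv =>
    obtain ⟨j, hj⟩ := (Tri.mem_verts _ _).1 (hv _ c.start_mem_support)
    simp [walkJump_append, walkJump_around ha v c hv hj hj]

theorem walkJump_reverse {a : Tri → Fin 3 → ℤ} (ha : R.Compatible a) {s t : Tri}
    (p : R.dual.Walk s t) : walkJump a p.reverse = - walkJump a p := by
  induction p with
  | nil => simp [walkJump]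
  | cons h p ih => simp [walkJump, walkJump_append, ih, jump_symm ha h]

/-- On a simply connected region, compatible local heights differ from global ones by a constant
on each triangle. -/
theorem SimplyConnected.exists_global (hR : R.SimplyConnected) {a : Tri → Fin 3 → ℤ}
    (ha : R.Compatible a) : ∃ F : Tri → ℤ, ∀ t i, R.Inner (t.side i) →
      F t + a t (i + 1) = F (t.nb i) + a (t.nb i) (i + 2) ∧
      F t + a t (i + 2) = F (t.nb i) + a (t.nb i) (i + 1) := by
  classical
  obtain ⟨t₀, h₀⟩ := hR.nonempty
  -- Path independence: `p` followed by the reverse of `q` is a closed walk, hence contractible.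
  have key : ∀ t (p q : R.dual.Walk t₀ t), walkJump a p = walkJump a q := fun t p q => by
    have h := walkJump_homotopic ha (hR.contractible t₀ h₀ (p.append q.reverse))
    rw [walkJump_append, walkJump_reverse ha, walkJump] at h
    linarith
  let F : Tri → ℤ := fun t =>
    if h : R.dual.Reachable t₀ t then walkJump a h.some else 0
  have hF : ∀ t (p : R.dual.Walk t₀ t), F t = walkJump a p := fun t p => by
    simp only [F]
    rw [dif_pos ⟨p⟩]
    exact key _ _ _
  refine ⟨F, fun t i hi => ?_⟩
  obtain ⟨p⟩ := hR.connected t₀ h₀ t ((inner_side t i).1 hi).2.1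
  have h1 := hF (t.nb i) (p.append (.cons (adj_nb hi) .nil))
  rw [walkJump_append, ← hF t p, walkJump, walkJump, jump_nb] at h1
  have h2 := ha t i hi
  constructor <;> linarith

end Region
/-! ### Calissons and their diagonals -/

/-- The calisson whose short diagonal is `e`. -/
def Edge.calisson (e : Edge) : Calisson := ⟨e.base + dir e.axis, e.axis⟩

theorem Edge.calisson_diagonal (e : Edge) : e.calisson.diagonal = e := by
  simp [Edge.calisson, Calisson.diagonal]

theorem Calisson.diagonal_calisson (c : Calisson) : c.diagonal.calisson = c := by
  simp [Edge.calisson, Calisson.diagonal]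

theorem Calisson.diagonal_axis (c : Calisson) : c.diagonal.axis = c.color := rfl

theorem Calisson.covers_iff (c : Calisson) (t : Tri) :
    c.Covers t ↔ c = (t.side c.color).calisson := by
  constructor
  · rintro ⟨b, rfl⟩
    rw [← c.diagonal_axis, Edge.side_tri, c.diagonal_calisson]
  · intro h
    refine ⟨t.right, ?_⟩
    conv_rhs => rw [h, Edge.calisson_diagonal, Tri.tri_side]

theorem Tri.calisson_side_color (t : Tri) (i : Fin 3) : (t.side i).calisson.color = i :=
  t.side_axis i

theorem Tri.calisson_side_covers (t : Tri) (i : Fin 3) : (t.side i).calisson.Covers t := by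
  rw [Calisson.covers_iff, Tri.calisson_side_color]

/-! ### Height functions -/

/-- The difference of the reduced heights along an edge in direction `dir i` that is not
overlapped. The reduced height of a vertex `(x, y)` of height `h` is `(h - x - y) / 3`. -/
def eps (i : Fin 3) : ℤ := if i = 2 then 1 else 0

/-- The reduced heights `g t j` of the corners `j` of the triangles `t` are those of a solution. -/
structure IsHeight (R : Region) (X : Set Edge) (g : Tri → Fin 3 → ℤ) : Prop where
  lower : ∀ t ∈ R.tris, ∀ i, eps i - 1 ≤ g t (t.top i) - g t (t.bot i)
  upper : ∀ t ∈ R.tris, ∀ i, g t (t.top i) - g t (t.bot i) ≤ eps i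
  tight : ∀ t ∈ R.tris, ∀ i, ¬ R.Inner (t.side i) ∨ t.side i ∈ X →
    eps i ≤ g t (t.top i) - g t (t.bot i)
  glue : ∀ t i, R.Inner (t.side i) → g (t.nb i) (i + 2) = g t (i + 1)
  salient : ∀ t i, t.right = false → R.Inner (t.side i) → t.side i ∈ X →
    g (t.nb i) i = g t i + (eps (i + 2) - eps (i + 1))

theorem IsHeight.glue' {R : Region} {X : Set Edge} {g : Tri → Fin 3 → ℤ} (h : IsHeight R X g)
    (t : Tri) (i : Fin 3) (hi : R.Inner (t.side i)) : g (t.nb i) (i + 1) = g t (i + 2) := by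
  have := h.glue (t.nb i) i (by rwa [Tri.nb_side])
  rw [Tri.nb_nb] at this
  exact this.symm

/-- The increment along the side `i` of a triangle in which the side `o` is overlapped. -/
def incr (o i : Fin 3) : ℤ := eps i - if o = i then 1 else 0

/-- Local heights in a triangle in which the side `o` is overlapped. -/
def localHeight (right : Bool) (o j : Fin 3) : ℤ :=
  if right then ![0, incr o 1 + incr o 0, incr o 1] j
  else ![incr o 0 + incr o 1, 0, incr o 0] j

theorem localHeight_side (t : Tri) (o i : Fin 3) :
    localHeight t.right o (t.top i) - localHeight t.right o (t.bot i) = incr o i := by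
  unfold Tri.top Tri.bot
  generalize t.right = r
  revert r o i; decide

/-- The increment along side `i` depends only on whether that side is overlapped, which both of its
triangles agree on. -/
theorem localHeight_compatible : ∀ (r : Bool) (o o' i : Fin 3), (o = i ↔ o' = i) →
    localHeight r o (i + 1) - localHeight (!r) o' (i + 2) =
      localHeight r o (i + 2) - localHeight (!r) o' (i + 1) := by
  decide

/-- Each side of the identity is normalized at the same end of the edge: corner `i + 2` of the right
triangle is corner `i + 1` of the left one. -/
theorem localHeight_salient : ∀ (o o' i : Fin 3), o ≠ i → o' ≠ i → o ≠ o' →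
    localHeight true o' i - localHeight true o' (i + 2) =
      localHeight false o i - localHeight false o (i + 1) + (eps (i + 2) - eps (i + 1)) := by
  decide

namespace Region

variable {R : Region} {X : Set Edge}

/-- The color of the calisson on each triangle. -/
theorem IsTiling.exists_color {T : Finset Calisson} (h : R.IsTiling T) :
    ∃ o : Tri → Fin 3, ∀ t ∈ R.tris, ∀ i, (t.side i).calisson ∈ T ↔ o t = i := by
  classical
  have key : ∀ t, ∃ o : Fin 3, t ∈ R.tris → ∀ i, (t.side i).calisson ∈ T ↔ o = i := by
    intro t
    by_cases ht : t ∈ R.tris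
    · obtain ⟨c, ⟨hc, hct⟩, hu⟩ := h.2 t ht
      refine ⟨c.color, fun _ i => ⟨fun hi => ?_, ?_⟩⟩
      · rw [← hu _ ⟨hi, t.calisson_side_covers i⟩, t.calisson_side_color]
      · rintro rfl
        rwa [← (c.covers_iff t).1 hct]
    · exact ⟨0, fun h => absurd h ht⟩
  choose o ho using key
  exact ⟨o, ho⟩

/-- The overlapped side determines local heights in each triangle; they are compatible across inner
edges and therefore integrate. -/
theorem SimplyConnected.exists_height (hR : R.SimplyConnected) {T : Finset Calisson}
    (hT : R.IsSolution X T) : ∃ g, IsHeight R X g := by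
  obtain ⟨o, ho⟩ := hT.tiling.exists_color
  have hnb : ∀ t i, R.Inner (t.side i) → (o t = i ↔ o (t.nb i) = i) := by
    intro t i hi
    have h := (inner_side t i).1 hi
    rw [← ho t h.2.1, ← ho _ h.2.2, Tri.nb_side]
  have hin : ∀ t ∈ R.tris, ∀ i, o t = i → R.Inner (t.side i) ∧ t.side i ∉ X := by
    intro t ht i hi
    have h := (ho t ht i).2 hi
    have h1 := hT.tiling.1 _ h
    have h2 := hT.nonoverlap _ h
    rw [Edge.calisson_diagonal] at h1 h2
    exact ⟨h1, h2⟩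
  obtain ⟨F, hF⟩ := hR.exists_global (a := fun t => localHeight t.right (o t)) (by
    intro t i hi
    have := localHeight_compatible t.right (o t) (o (t.nb i)) i (hnb t i hi)
    simpa [Tri.nb_right] using this)
  have hd : ∀ t i, F t + localHeight t.right (o t) (t.top i) -
      (F t + localHeight t.right (o t) (t.bot i)) = incr (o t) i := fun t i => by
    rw [add_sub_add_left_eq_sub]; exact localHeight_side t _ i
  refine ⟨fun t j => F t + localHeight t.right (o t) j, ?_, ?_, ?_, ?_, ?_⟩
  · intro t _ i
    simp only [hd, incr]
    split <;> linarith
  · intro t _ i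
    simp only [hd, incr]
    split <;> linarith
  · intro t ht i hi
    simp only [hd, incr]
    rw [if_neg]
    · linarith
    · intro h
      obtain ⟨h1, h2⟩ := hin t ht i h
      tauto
  · intro t i hi
    exact (hF t i hi).1.symm
  · intro t i ht hi hX
    have h := (inner_side t i).1 hi
    have h1 : o t ≠ i := fun h' => (hin t h.2.1 i h').2 hX
    have h2 : o (t.nb i) ≠ i := fun h' => (hin _ h.2.2 i h').2 (by rwa [Tri.nb_side])
    have h3 : o t ≠ o (t.nb i) := by
      have hs := hT.salient _ hX hi _ ((ho t h.2.1 (o t)).2 rfl) _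
        ((ho _ h.2.2 (o (t.nb i))).2 rfl)
      simp only [Tri.calisson_side_color] at hs
      apply hs
      · have := t.tri_side i
        rw [ht] at this
        rw [this]
        exact Tri.calisson_side_covers _ _
      · have : (t.side i).tri true = t.nb i := by simp [Tri.nb, ht]
        rw [this]
        exact Tri.calisson_side_covers _ _
    have h4 := localHeight_salient (o t) (o (t.nb i)) i h1 h2 h3
    have h5 := (hF t i hi).1
    simp only [Tri.nb_right, ht, Bool.not_false] at h5 ⊢
    linarith

end Region

/-! ### From heights to calissons -/

/-- The side of a triangle that is overlapped according to the heights `g`. -/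
def overlap (g : Tri → Fin 3 → ℤ) (t : Tri) : Fin 3 :=
  if g t (t.top 0) - g t (t.bot 0) < eps 0 then 0
  else if g t (t.top 1) - g t (t.bot 1) < eps 1 then 1 else 2

/-- The calissons of the heights `g` on the left triangles of a list. -/
def calissonList (g : Tri → Fin 3 → ℤ) (l : List Tri) : List Calisson :=
  (l.filter fun t => !t.right).map fun t => (t.side (overlap g t)).calisson

namespace IsHeight

variable {R : Region} {X : Set Edge} {g : Tri → Fin 3 → ℤ}

/-- The increments around a triangle sum to 0 and the three `eps i` sum to 1, so exactly one side
falls short of its `eps i`. -/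
theorem overlap_iff (h : IsHeight R X g) {t : Tri} (ht : t ∈ R.tris) (i : Fin 3) :
    overlap g t = i ↔ g t (t.top i) - g t (t.bot i) < eps i := by
  have h0 := h.lower t ht 0
  have h1 := h.lower t ht 1
  have h2 := h.lower t ht 2
  have k0 := h.upper t ht 0
  have k1 := h.upper t ht 1
  have k2 := h.upper t ht 2
  unfold overlap
  cases hr : t.right <;> fin_cases i <;>
    simp [Tri.top, Tri.bot, eps, hr] at h0 h1 h2 k0 k1 k2 ⊢ <;> split_ifs <;> simp <;> omega

theorem overlap_nb (h : IsHeight R X g) {t : Tri} {i : Fin 3} (hi : R.Inner (t.side i)) :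
    overlap g (t.nb i) = i ↔ overlap g t = i := by
  have hm := (Region.inner_side t i).1 hi
  rw [h.overlap_iff hm.2.1, h.overlap_iff hm.2.2]
  have h1 := h.glue t i hi
  have h2 := h.glue' t i hi
  cases hr : t.right <;> simp [Tri.top, Tri.bot, Tri.nb_right, hr, h1, h2]

theorem overlap_inner (h : IsHeight R X g) {t : Tri} (ht : t ∈ R.tris) :
    R.Inner (t.side (overlap g t)) ∧ t.side (overlap g t) ∉ X := by
  have h1 := (h.overlap_iff ht _).1 rfl
  have h2 := h.tight t ht (overlap g t)
  constructor
  · by_contra h3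
    linarith [h2 (Or.inl h3)]
  · intro h3
    linarith [h2 (Or.inr h3)]

/-- Only left triangles are listed. The calisson on a right triangle is found from its left
neighbour, in which the same edge is overlapped. -/
theorem mem_calissonList (h : IsHeight R X g) {l : List Tri} (hl : l.toFinset = R.tris)
    {t : Tri} (ht : t ∈ R.tris) (i : Fin 3) :
    (t.side i).calisson ∈ calissonList g l ↔ overlap g t = i := by
  have hml : ∀ s : Tri, s ∈ l ↔ s ∈ R.tris := fun s => by rw [← hl, List.mem_toFinset]
  have hinj : ∀ (s : Tri) (j : Fin 3), (s.side j).calisson = (t.side i).calisson → j = i ∧ s.side i = t.side i := by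
    intro s j hs
    have h1 := congrArg Calisson.color hs
    rw [Tri.calisson_side_color, Tri.calisson_side_color] at h1
    have h2 := congrArg Calisson.diagonal hs
    rw [Edge.calisson_diagonal, Edge.calisson_diagonal] at h2
    exact ⟨h1, h1 ▸ h2⟩
  simp only [calissonList, List.mem_map, List.mem_filter, hml]
  constructor
  · rintro ⟨s, ⟨hs, hsr⟩, hst⟩
    obtain ⟨h1, h2⟩ := hinj _ _ hst
    have h3 := s.tri_side i
    have h4 := (h.overlap_inner hs).1
    rw [h1] at h4
    rcases Bool.eq_or_eq_not s.right t.right with hr | hr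
    · rw [h2, hr, Tri.tri_side] at h3
      rw [h3]; exact h1
    · rw [h2, hr] at h3
      change t.nb i = s at h3
      rw [← h3] at h1
      rw [h2] at h4
      exact (h.overlap_nb h4).1 h1
  · intro hi
    have h4 := (h.overlap_inner ht).1
    rw [hi] at h4
    cases hr : t.right
    · exact ⟨t, ⟨ht, by simp [hr]⟩, by rw [hi]⟩
    · exact ⟨t.nb i, ⟨((Region.inner_side _ _).1 h4).2.2, by simp [Tri.nb_right, hr]⟩,
        by rw [(h.overlap_nb h4).2 hi, Tri.nb_side]⟩

theorem exists_calissonList {l : List Tri} (hl : l.toFinset = R.tris)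
    {c : Calisson} (hc : c ∈ calissonList g l) :
    ∃ t ∈ R.tris, c = (t.side (overlap g t)).calisson := by
  simp only [calissonList, List.mem_map, List.mem_filter] at hc
  obtain ⟨t, ⟨ht, _⟩, rfl⟩ := hc
  exact ⟨t, by rwa [← hl, List.mem_toFinset], rfl⟩

theorem nodup_calissonList {l : List Tri} (hl : l.Nodup) : (calissonList g l).Nodup := by
  refine List.Nodup.map_on ?_ (hl.filter _)
  intro s hs t ht hst
  simp only [List.mem_filter, Bool.not_eq_true'] at hs ht
  have h1 := congrArg Calisson.diagonal hst
  rw [Edge.calisson_diagonal, Edge.calisson_diagonal] at h1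
  have h2 := s.tri_side (overlap g s)
  have h3 := t.tri_side (overlap g t)
  rw [hs.2, h1] at h2
  rw [ht.2] at h3
  exact h2.symm.trans h3

theorem isSolution (h : IsHeight R X g) {l : List Tri} (hl : l.toFinset = R.tris) :
    R.IsSolution X (calissonList g l).toFinset := by
  have hcov : ∀ t ∈ R.tris, ∀ c ∈ calissonList g l, c.Covers t → c.color = overlap g t := by
    intro t ht c hc hct
    rw [Calisson.covers_iff] at hct
    rw [hct] at hc
    exact ((h.mem_calissonList hl ht _).1 hc).symm
  refine ⟨⟨?_, ?_⟩, ?_, ?_⟩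
  · intro c hc
    obtain ⟨t, ht, rfl⟩ := exists_calissonList hl (List.mem_toFinset.1 hc)
    rw [Edge.calisson_diagonal]
    exact (h.overlap_inner ht).1
  · intro t ht
    refine ⟨(t.side (overlap g t)).calisson,
      ⟨List.mem_toFinset.2 ((h.mem_calissonList hl ht _).2 rfl), t.calisson_side_covers _⟩, ?_⟩
    rintro c ⟨hc, hct⟩
    rw [← hcov t ht c (List.mem_toFinset.1 hc) hct]
    exact (c.covers_iff t).1 hct
  · intro c hc
    obtain ⟨t, ht, rfl⟩ := exists_calissonList hl (List.mem_toFinset.1 hc)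
    rw [Edge.calisson_diagonal]
    exact (h.overlap_inner ht).2
  · intro e heX he c hc c' hc' hct hct'
    rw [List.mem_toFinset] at hc hc'
    rw [hcov _ (he.2 _) c hc hct, hcov _ (he.2 _) c' hc' hct']
    obtain ⟨t, i, hr, rfl⟩ := e.exists_side false
    have h1 : (t.side i).tri false = t := hr ▸ t.tri_side i
    have h2 : (t.side i).tri true = t.nb i := by simp [Tri.nb, hr]
    have hm := (Region.inner_side t i).1 he
    rw [h1, h2]
    -- If both triangles overlapped the same direction `o ≠ i`, the vertices opposite to the edge
    -- would have different unreduced heights, against `salient`.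
    intro ho
    have hi : overlap g t ≠ i := fun hi => (h.overlap_inner hm.2.1).2 (by rwa [hi])
    have s1 := h.salient t i hr he heX
    have s2 := h.glue t i he
    have s3 := h.glue' t i he
    have a := fun j => h.overlap_iff hm.2.1 j
    have b := fun j => h.overlap_iff hm.2.2 j
    rw [← ho] at b
    have l1 := h.lower t hm.2.1
    have u1 := h.upper t hm.2.1
    have l2 := h.lower _ hm.2.2
    have u2 := h.upper _ hm.2.2
    generalize overlap g t = o at *
    simp only [Tri.top, Tri.bot, hr, Tri.nb_right] at *
    generalize t.nb i = s at *
    have a0 := a 0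
    have a1 := a 1
    have a2 := a 2
    have b0 := b 0
    have b1 := b 1
    have b2 := b 2
    simp only [Fin.forall_fin_succ, Fin.forall_fin_zero] at l1 u1 l2 u2
    fin_cases i <;> fin_cases o <;>
      simp [eps] at hi s1 s2 s3 a0 a1 a2 b0 b1 b2 l1 u1 l2 u2 <;> omega

end IsHeight
-- End points of the sides.
theorem Tri.side_eq (t : Tri) (i : Fin 3) : t.side i = ⟨t.corner (t.bot i), i⟩ := by
  obtain ⟨⟨x, y⟩, r⟩ := t
  fin_cases i <;> cases r <;> simp [Tri.side, Tri.corner, Tri.bot, dir, phi]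

theorem Tri.corner_top (t : Tri) (i : Fin 3) :
    t.corner (t.top i) = t.corner (t.bot i) + dir i := by
  obtain ⟨⟨x, y⟩, r⟩ := t
  fin_cases i <;> cases r <;> simp [Tri.corner, Tri.bot, Tri.top, dir, phi]

namespace Region

variable {R : Region}

/-! ### The boundary of a simply connected region is connected -/

/-- A ray in direction `dir 0` that starts at the boundary does not disconnect a simply connected
region up to multiplicities: there is a function on the triangles that jumps only along it. -/
theorem SimplyConnected.exists_jump_on_ray (hR : R.SimplyConnected) (v : Vertex)
    (hv : ¬ R.Inner ⟨v, 0⟩ ∨ ¬ R.Inner ⟨v, 1⟩ ∨ ¬ R.Inner ⟨(v.1 + 1, v.2 + 1), 2⟩) :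
    ∃ F : Tri → ℤ, ∀ t i, t.right = false → R.Inner (t.side i) →
      F t - F (t.nb i) = if i = 0 ∧ t.base.2 = v.2 ∧ v.1 ≤ t.base.1 then 1 else 0 := by
  classical
  obtain ⟨a, b⟩ := v
  -- Prescribed jumps with a branch cut along the ray: at corners strictly beyond `v` on the ray the
  -- value is 1 for triangles above it and 0 for those below. The values `s` at `v` itself are still
  -- to be chosen.
  let f (s : Tri → ℤ) (t : Tri) (j : Fin 3) : ℤ :=
    if (t.corner j).1 = a ∧ (t.corner j).2 = b then s t
    else if (t.corner j).2 = b ∧ a < (t.corner j).1 then (if b ≤ t.base.2 then 1 else 0) else 0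
  suffices h : ∃ s, R.Compatible (fun t j => - f s t j) ∧
      ∀ t, t.right = false → R.Inner (t.side 0) → t.base = (a, b) →
        f s t 1 - f s (t.nb 0) 2 = 1 by
    obtain ⟨s, hs, hs'⟩ := h
    obtain ⟨F, hF⟩ := hR.exists_global hs
    refine ⟨F, fun t i ht hi => ?_⟩
    have h0 := hF t i hi
    have h1 := hs' t ht
    obtain ⟨⟨x, y⟩, r⟩ := t
    obtain rfl : r = false := ht
    fin_cases i
    · have h2 := h1 hi
      simp [f, Tri.nb_eq, Tri.corner] at h0 h2 ⊢
      split_ifs at h0 h2 ⊢ <;> omega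
    · simp [f, Tri.nb_eq, Tri.corner] at h0 ⊢
      split_ifs at h0 ⊢ <;> omega
    · simp [f, Tri.nb_eq, Tri.corner] at h0 ⊢
      split_ifs at h0 ⊢ <;> omega
  have hne : ∀ {e e' : Edge}, ¬ R.Inner e → R.Inner e' → e' ≠ e := fun h h' h'' => h (h'' ▸ h')
  rcases hv with hv | hv | hv
  -- Around `v` the total jump would be 1, an obstruction if all six edges at `v` were inner. In
  -- each case `s` is 1 exactly on the sector at `v` between the ray and the edge that is not inner;
  -- here that sector is empty.
  · refine ⟨fun _ => 0, ?_, ?_⟩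
    · intro t i hi
      have h := hne hv hi
      obtain ⟨⟨x, y⟩, r⟩ := t
      cases r <;> fin_cases i <;>
        simp [f, Tri.nb_eq, Tri.corner, Tri.side, dir, phi] at h ⊢ <;> split_ifs <;> omega
    · intro t ht hi h
      have h' := hne hv hi
      simp [Tri.side, ht, h] at h'
  · refine ⟨fun t => if t.base.1 = a ∧ t.base.2 = b then 1 else 0, ?_, ?_⟩
    · intro t i hi
      have h := hne hv hi
      obtain ⟨⟨x, y⟩, r⟩ := t
      cases r <;> fin_cases i <;>
        simp [f, Tri.nb_eq, Tri.corner, Tri.side, dir, phi] at h ⊢ <;> split_ifs <;> omega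
    · intro t ht hi h
      simp [f, Tri.nb_eq, Tri.corner, ht, h]
  · refine ⟨fun t => if (t.base.1 = a ∧ t.base.2 = b) ∧ t.right = false then 1 else 0, ?_, ?_⟩
    · intro t i hi
      have h := hne hv hi
      obtain ⟨⟨x, y⟩, r⟩ := t
      cases r <;> fin_cases i <;>
        simp [f, Tri.nb_eq, Tri.corner, Tri.side, dir, phi] at h ⊢ <;> split_ifs <;> omega
    · intro t ht hi h
      simp [f, Tri.nb_eq, Tri.corner, ht, h]

/-! ### Closed flows and their potentials. -/

open Classical in
/-- The increments along the inner edges of a function on the corners. -/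
noncomputable def flow (R : Region) (β : Tri → Fin 3 → ℤ) (e : Edge) : ℤ :=
  if R.Inner e then β (e.tri false) (e.axis + 2) - β (e.tri false) (e.axis + 1) else 0

open Classical in
/-- The inner edges, given as sides of left triangles. -/
noncomputable def innerSides (R : Region) (b : Bool) : Finset (Tri × Fin 3) :=
  (R.tris ×ˢ (Finset.univ : Finset (Fin 3))).filter fun p => p.1.right = b ∧ R.Inner (p.1.side p.2)

theorem mem_innerSides {b : Bool} {p : Tri × Fin 3} :
    p ∈ R.innerSides b ↔ p.1.right = b ∧ R.Inner (p.1.side p.2) := by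
  simp only [innerSides, Finset.mem_filter, Finset.mem_product, Finset.mem_univ, and_true,
    and_iff_right_iff_imp]
  exact fun h => ((inner_side _ _).1 h.2).2.1

/-- A function on the corners of the triangles of the region that agrees along inner edges and is
constant along the boundary sides. -/
structure BoundaryLocallyConst (R : Region) (β : Tri → Fin 3 → ℤ) : Prop where
  glue : ∀ t i, R.Inner (t.side i) → β (t.nb i) (i + 2) = β t (i + 1)
  const : ∀ t ∈ R.tris, ∀ i, ¬ R.Inner (t.side i) → β t (i + 1) = β t (i + 2)

namespace BoundaryLocallyConst

variable {β : Tri → Fin 3 → ℤ}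

theorem glue' (h : R.BoundaryLocallyConst β) (t : Tri) (i : Fin 3) (hi : R.Inner (t.side i)) :
    β (t.nb i) (i + 1) = β t (i + 2) := by
  have := h.glue (t.nb i) i (by rwa [Tri.nb_side])
  rw [Tri.nb_nb] at this
  exact this.symm

theorem flow_side (h : R.BoundaryLocallyConst β) {t : Tri} (ht : t ∈ R.tris) (i : Fin 3) :
    R.flow β (t.side i) = β t (t.top i) - β t (t.bot i) := by
  unfold flow
  rw [Tri.side_axis]
  split_ifs with hi
  · cases hr : t.right
    · have := t.tri_side i
      rw [hr] at this
      simp [this, Tri.top, Tri.bot, hr]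
    · have : (t.side i).tri false = t.nb i := by simp [Tri.nb, hr]
      rw [this, h.glue t i hi, h.glue' t i hi]
      simp [Tri.top, Tri.bot, hr]
  · have := h.const t ht i hi
    unfold Tri.top Tri.bot
    split_ifs <;> linarith

/-- The three sides form an oriented cycle, so increments of `β` cancel. A triangle outside the
region has no inner side. -/
theorem flow_closed (h : R.BoundaryLocallyConst β) (t : Tri) :
    ∑ i, R.flow β (t.side i) = 0 := by
  by_cases ht : t ∈ R.tris
  · simp only [h.flow_side ht, Fin.sum_univ_three]
    cases hr : t.right <;> simp [Tri.top, Tri.bot, hr]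
  · refine Finset.sum_eq_zero fun i _ => ?_
    unfold flow
    rw [if_neg]
    rw [inner_side]
    tauto

/-- Summation by parts: collecting the terms with `F t` leaves the total flow around `t`, which is
0. The left and the right triangles contribute separately. -/
theorem sum_flow (h : R.BoundaryLocallyConst β) (F : Tri → ℤ) :
    ∑ p ∈ R.innerSides false, (F p.1 - F (p.1.nb p.2)) * R.flow β (p.1.side p.2) = 0 := by
  classical
  have h1 : ∀ b, ∑ p ∈ R.innerSides b, F p.1 * R.flow β (p.1.side p.2) = 0 := by
    intro b
    have h2 : ∑ p ∈ R.innerSides b, F p.1 * R.flow β (p.1.side p.2) =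
        ∑ t ∈ R.tris, if t.right = b then F t * ∑ i, R.flow β (t.side i) else 0 := by
      rw [innerSides, Finset.sum_filter, Finset.sum_product]
      refine Finset.sum_congr rfl fun t _ => ?_
      by_cases hb : t.right = b
      · simp only [hb, true_and, if_true, Finset.mul_sum]
        refine Finset.sum_congr rfl fun i _ => ?_
        unfold flow
        split_ifs <;> simp
      · simp [hb]
    rw [h2]
    refine Finset.sum_eq_zero fun t _ => ?_
    rw [h.flow_closed t]
    simp
  have h2 : ∑ p ∈ R.innerSides false, F (p.1.nb p.2) * R.flow β (p.1.side p.2) =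
      ∑ p ∈ R.innerSides true, F p.1 * R.flow β (p.1.side p.2) := by
    refine Finset.sum_nbij' (fun p => (p.1.nb p.2, p.2)) (fun p => (p.1.nb p.2, p.2)) ?_ ?_ ?_ ?_ ?_
    · intro p hp
      simp only [mem_innerSides, Tri.nb_side, Tri.nb_right] at hp ⊢
      simp [hp]
    · intro p hp
      simp only [mem_innerSides, Tri.nb_side, Tri.nb_right] at hp ⊢
      simp [hp]
    · intro p _
      simp [Tri.nb_nb]
    · intro p _
      simp [Tri.nb_nb]
    · intro p _
      simp [Tri.nb_side]
  simp only [sub_mul, Finset.sum_sub_distrib]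
  rw [h1, h2, h1, sub_zero]

/-- The potential of the flow, obtained by summing along rays in direction `dir 0`. -/
noncomputable def potential (R : Region) (β : Tri → Fin 3 → ℤ) (v : Vertex) : ℤ :=
  - ∑ p ∈ R.innerSides false,
      if p.2 = 0 ∧ p.1.base.2 = v.2 ∧ v.1 ≤ p.1.base.1 then R.flow β (p.1.side p.2) else 0

/-- The ray that defines the potential is the jump set of some `F`, so the sum over it is the one in
`sum_flow`. -/
theorem potential_boundary (h : R.BoundaryLocallyConst β) (hR : R.SimplyConnected) (v : Vertex)
    (hv : ¬ R.Inner ⟨v, 0⟩ ∨ ¬ R.Inner ⟨v, 1⟩ ∨ ¬ R.Inner ⟨(v.1 + 1, v.2 + 1), 2⟩) :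
    potential R β v = 0 := by
  obtain ⟨F, hF⟩ := hR.exists_jump_on_ray v hv
  rw [potential, neg_eq_zero]
  refine Eq.trans (Finset.sum_congr rfl fun p hp => ?_) (h.sum_flow F)
  rw [mem_innerSides] at hp
  rw [hF _ _ hp.1 hp.2]
  split_ifs <;> simp

/-- The two rays differ in a single edge. -/
theorem potential_dir_zero (β : Tri → Fin 3 → ℤ) (x y : ℤ) :
    potential R β (x + 1, y) - potential R β (x, y) = R.flow β ⟨(x, y), 0⟩ := by
  classical
  simp only [potential, sub_neg_eq_add]
  rw [neg_add_eq_sub, ← Finset.sum_sub_distrib]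
  have hs : (⟨(x, y), false⟩ : Tri).side 0 = ⟨(x, y), 0⟩ := by simp [Tri.side]
  rw [Finset.sum_eq_single ((⟨(x, y), false⟩ : Tri), (0 : Fin 3))]
  · simp [hs]
  · rintro ⟨⟨⟨x', y'⟩, r⟩, i⟩ hp hne
    rw [mem_innerSides] at hp
    obtain ⟨rfl, -⟩ := hp
    simp at hne ⊢
    by_cases hi : i = 0
    · simp only [hi, not_true_eq_false, imp_false, true_and] at hne ⊢
      split_ifs <;> omega
    · simp [hi]
  · intro hn
    simp only [mem_innerSides, true_and] at hn
    simp [flow, hn]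

/-- To the right of the region both sides vanish. The identity moves one column to the left by
closedness of the flow around the two triangles based at `(x, y)`, whose common diagonal cancels. -/
theorem potential_dir_one (h : R.BoundaryLocallyConst β) (x y : ℤ) :
    potential R β (x, y + 1) - potential R β (x, y) = R.flow β ⟨(x, y), 1⟩ := by
  classical
  obtain ⟨N, hN⟩ : ∃ N : ℤ, ∀ t ∈ R.tris, t.base.1 ≤ N := by
    obtain ⟨N, hN⟩ := (R.tris.image fun t => t.base.1).bddAbove
    exact ⟨N, fun t ht => hN (Finset.mem_coe.2 (Finset.mem_image_of_mem _ ht))⟩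
  have far : ∀ x, N < x → ∀ y, potential R β (x, y) = 0 := by
    intro x hx y
    rw [potential, neg_eq_zero]
    refine Finset.sum_eq_zero fun p hp => ?_
    rw [mem_innerSides, inner_side] at hp
    have := hN _ hp.2.2.1
    rw [if_neg]
    rintro ⟨-, -, h⟩
    simp at h
    omega
  have main : ∀ n : ℕ, ∀ x, N < x + n →
      potential R β (x, y + 1) - potential R β (x, y) = R.flow β ⟨(x, y), 1⟩ := by
    intro n
    induction n with
    | zero =>
      intro x hx
      simp at hx
      rw [far x hx, far x hx, flow, if_neg]
      · simp
      · intro hi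
        have := hN _ (hi.2 true)
        simp [Edge.tri] at this
        omega
    | succ n ih =>
      intro x hx
      have h1 := ih (x + 1) (by push_cast at hx; omega)
      have h2 := potential_dir_zero (R := R) β x y
      have h3 := potential_dir_zero (R := R) β x (y + 1)
      have h4 := h.flow_closed ⟨(x, y), false⟩
      have h5 := h.flow_closed ⟨(x, y), true⟩
      simp [Fin.sum_univ_three, Tri.side, dir, phi] at h4 h5
      linarith
  exact main (N - x + 1).toNat x (by omega)

theorem potential_dir (h : R.BoundaryLocallyConst β) (v : Vertex) (i : Fin 3) :
    potential R β (v + dir i) - potential R β v = R.flow β ⟨v, i⟩ := by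
  obtain ⟨x, y⟩ := v
  fin_cases i
  · simpa [dir, phi] using potential_dir_zero (R := R) β x y
  · simpa [dir, phi] using h.potential_dir_one x y
  · have h1 := h.potential_dir_one (x - 1) (y - 1)
    have h2 := potential_dir_zero (R := R) β (x - 1) y
    have h3 := h.flow_closed ⟨(x - 1, y - 1), true⟩
    simp [Fin.sum_univ_three, Tri.side, dir, phi] at h1 h2 h3 ⊢
    simp only [← sub_eq_add_neg]
    linarith

/-- Along the sides of a triangle of the region, `β` and the potential have the same increments. -/
theorem sub_potential (h : R.BoundaryLocallyConst β) {t : Tri} (ht : t ∈ R.tris) (j k : Fin 3) :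
    β t j - potential R β (t.corner j) = β t k - potential R β (t.corner k) := by
  have key : ∀ i, β t (t.top i) - potential R β (t.corner (t.top i)) =
      β t (t.bot i) - potential R β (t.corner (t.bot i)) := by
    intro i
    have h1 := h.potential_dir (t.corner (t.bot i)) i
    rw [← Tri.corner_top, ← Tri.side_eq, h.flow_side ht] at h1
    linarith
  have k0 := key 0
  have k1 := key 1
  have k2 := key 2
  cases hr : t.right <;> simp [Tri.top, Tri.bot, hr] at k0 k1 k2 <;>
    fin_cases j <;> fin_cases k <;> simp <;> linarith

/-- A function that is locally constant on the boundary of a simply connected region is constant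
on it. -/
theorem exists_const (h : R.BoundaryLocallyConst β) (hR : R.SimplyConnected) :
    ∃ c, ∀ t ∈ R.tris, ∀ i, ¬ R.Inner (t.side i) → β t (i + 1) = c ∧ β t (i + 2) = c := by
  obtain ⟨t₀, h₀⟩ := hR.nonempty
  -- Adjacent triangles share a corner where `β` and the potential agree, so their difference is one
  -- constant on the connected region.
  have key : ∀ s t, R.dual.Reachable s t → s ∈ R.tris → t ∈ R.tris →
      β s 0 - potential R β (s.corner 0) = β t 0 - potential R β (t.corner 0) := by
    rintro s t ⟨p⟩
    induction p with
    | nil => intros; rfl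
    | cons hst p ih =>
      intro hs ht
      obtain ⟨i, hi, rfl⟩ := (adj_iff _ _).1 hst
      have hm := (inner_side _ _).1 hi
      rw [← ih hm.2.2 ht, h.sub_potential hs 0 (i + 1), h.sub_potential hm.2.2 0 (i + 2),
        h.glue _ i hi, Tri.corner_nb₂]
  refine ⟨β t₀ 0 - potential R β (t₀.corner 0), fun t ht i hi => ?_⟩
  rw [key t₀ t (hR.connected _ h₀ _ ht) h₀ ht]
  suffices hp : potential R β (t.corner (i + 1)) = 0 by
    have h1 := h.sub_potential ht (i + 1) 0
    have h2 := h.const t ht i hi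
    constructor <;> linarith
  have h0 : R.flow β (t.side i) = 0 := by rw [flow, if_neg hi]
  have h1 := h.potential_dir (t.corner (t.bot i)) i
  rw [← Tri.corner_top, ← Tri.side_eq, h0] at h1
  have h2 : potential R β (t.corner (t.bot i)) = 0 := by
    rw [Tri.side_eq] at hi
    -- In direction 2 the vanishing criterion applies to the end of the side instead of its start;
    -- both have the same potential because the flow is 0 there.
    by_cases h2 : i = 2
    · rw [show potential R β (t.corner (t.bot i)) = potential R β (t.corner (t.top i)) by linarith]
      refine h.potential_boundary hR _ (Or.inr (Or.inr ?_))
      rw [Tri.corner_top]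
      subst h2
      simpa [dir, phi] using hi
    · refine h.potential_boundary hR _ ?_
      fin_cases i
      · exact Or.inl hi
      · exact Or.inr (Or.inl hi)
      · exact absurd rfl h2
  have h3 : potential R β (t.corner (t.top i)) = 0 := by linarith
  cases hr : t.right
  · simpa [Tri.bot, hr] using h2
  · simpa [Tri.top, hr] using h3

end BoundaryLocallyConst
end Region
namespace Region

variable {R : Region}

/-! ### Isoperimetry -/

open Classical in
/-- The boundary sides, as sides of triangles of the region. -/
noncomputable def boundarySides (R : Region) : Finset (Tri × Fin 3) :=
  (R.tris ×ˢ (Finset.univ : Finset (Fin 3))).filter fun p => ¬ R.Inner (p.1.side p.2)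

theorem card_boundarySides (R : Region) : R.boundarySides.card = R.boundarySize := rfl

theorem mem_boundarySides {p : Tri × Fin 3} :
    p ∈ R.boundarySides ↔ p.1 ∈ R.tris ∧ ¬ R.Inner (p.1.side p.2) := by
  simp [boundarySides]

/-- Every strip of triangles ends at a boundary side. -/
theorem card_image_le (R : Region) (f pot : Tri → ℤ)
    (h : ∀ t, ∃ i, f (t.nb i) = f t ∧ pot t < pot (t.nb i)) :
    (R.tris.image f).card ≤ R.boundarySize := by
  classical
  rw [← card_boundarySides]
  refine le_trans (Finset.card_le_card ?_) (Finset.card_image_le (f := fun p => f p.1))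
  intro x hx
  obtain ⟨t, ht, rfl⟩ := Finset.mem_image.1 hx
  -- The last triangle of the strip: the next triangle in the strip cannot lie across an inner edge.
  obtain ⟨s, hs, hmax⟩ := (R.tris.filter fun s => f s = f t).exists_max_image pot
    ⟨t, by simp [ht]⟩
  rw [Finset.mem_filter] at hs
  obtain ⟨i, hi, hi'⟩ := h s
  refine Finset.mem_image.2 ⟨(s, i), mem_boundarySides.2 ⟨hs.1, fun hin => ?_⟩, hs.2⟩
  have := hmax _ (Finset.mem_filter.2 ⟨((inner_side _ _).1 hin).2.2, hi.trans hs.2⟩)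
  linarith

/-- Within a column, left and right triangles alternate; the potential function orders them from
bottom to top. -/
theorem card_columns (R : Region) : (R.tris.image fun t => t.base.1).card ≤ R.boundarySize := by
  refine R.card_image_le _ (fun t => 2 * t.base.2 + if t.right then 1 else 0) fun t => ?_
  cases hr : t.right
  · exact ⟨2, by simp [Tri.nb_eq, hr]⟩
  · exact ⟨0, by simp [Tri.nb_eq, hr]; omega⟩

theorem card_rows (R : Region) : (R.tris.image fun t => t.base.2).card ≤ R.boundarySize := by
  refine R.card_image_le _ (fun t => 2 * t.base.1 + if t.right then 0 else 1) fun t => ?_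
  cases hr : t.right
  · exact ⟨1, by simp [Tri.nb_eq, hr]; omega⟩
  · exact ⟨2, by simp [Tri.nb_eq, hr]⟩

/-- A triangle is determined by its column, its row and its orientation. -/
theorem card_tris_le (R : Region) : R.tris.card ≤ 2 * R.boundarySize ^ 2 := by
  classical
  have h1 : R.tris.card ≤ (((R.tris.image fun t => t.base.1) ×ˢ (R.tris.image fun t => t.base.2))
      ×ˢ (Finset.univ : Finset Bool)).card := by
    refine Finset.card_le_card_of_injOn (fun t => (t.base, t.right)) ?_ ?_
    · intro t ht
      simp only [Finset.coe_product, Set.mem_prod, Finset.mem_coe, Finset.mem_univ, and_true,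
        Finset.mem_image]
      exact ⟨⟨t, ht, rfl⟩, ⟨t, ht, rfl⟩⟩
    · intro s _ t _ h
      cases s; cases t
      simpa using h
  rw [Finset.card_product, Finset.card_product, Finset.card_univ, Fintype.card_bool] at h1
  nlinarith [Nat.mul_le_mul R.card_columns R.card_rows]

theorem one_le_boundarySize (h : R.tris.Nonempty) : 1 ≤ R.boundarySize :=
  le_trans (Finset.card_pos.2 (h.image _)) R.card_columns

end Region

/-! ### The range of the heights -/

namespace IsHeight

variable {R : Region} {X : Set Edge} {g : Tri → Fin 3 → ℤ}

theorem sub_le_one (h : IsHeight R X g) {t : Tri} (ht : t ∈ R.tris) (j k : Fin 3) :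
    g t j - g t k ≤ 1 := by
  have h0 := h.lower t ht 0
  have h1 := h.lower t ht 1
  have h2 := h.lower t ht 2
  have k0 := h.upper t ht 0
  have k1 := h.upper t ht 1
  have k2 := h.upper t ht 2
  cases hr : t.right <;> simp [Tri.top, Tri.bot, eps, hr] at h0 h1 h2 k0 k1 k2 <;>
    fin_cases j <;> fin_cases k <;> simp <;> omega

theorem abs_sub_le_one (h : IsHeight R X g) {t : Tri} (ht : t ∈ R.tris) (j k : Fin 3) :
    |g t j - g t k| ≤ 1 := by
  rw [abs_le]
  exact ⟨by linarith [h.sub_le_one ht k j], h.sub_le_one ht j k⟩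

open Classical in
/-- From every triangle one reaches a boundary side along its row. -/
theorem exists_near_boundary (h : IsHeight R X g) :
    ∀ n : ℕ, ∀ t ∈ R.tris, 2 * ((R.tris.image fun t => t.base.1).filter
      fun x => t.base.1 < x).card + (if t.right then 1 else 0) ≤ n →
      ∃ s ∈ R.tris, ∃ i, ¬ R.Inner (s.side i) ∧ ∀ j k, |g t j - g s k| ≤ n + 1 := by
  intro n
  induction n with
  | zero =>
    intro t ht hn
    have hr : t.right = false := by
      by_contra hr
      simp [hr] at hn
    -- Side 1 of a left triangle leads to the next column. With no column left on that side, it is a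
    -- boundary side.
    refine ⟨t, ht, 1, fun hi => ?_, fun j k => by simpa using h.abs_sub_le_one ht j k⟩
    have hm := ((Region.inner_side _ _).1 hi).2.2
    have h1 : (t.nb 1).base.1 ∈ (R.tris.image fun t => t.base.1).filter fun x => t.base.1 < x := by
      rw [Finset.mem_filter]
      exact ⟨Finset.mem_image_of_mem _ hm, by simp [Tri.nb_eq, hr]⟩
    have := Finset.card_pos.2 ⟨_, h1⟩
    omega
  | succ n ih =>
    intro t ht hn
    -- Either the walk along the row stops at side `i`, or it crosses it and the heights change by
    -- at most 1 more.
    have step : ∀ i, (R.Inner (t.side i) → 2 * ((R.tris.image fun t => t.base.1).filter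
        fun x => (t.nb i).base.1 < x).card + (if (t.nb i).right then 1 else 0) ≤ n) →
        ∃ s ∈ R.tris, ∃ i, ¬ R.Inner (s.side i) ∧ ∀ j k, |g t j - g s k| ≤ (n + 1 : ℕ) + 1 := by
      intro i hi
      by_cases hin : R.Inner (t.side i)
      · obtain ⟨s, hs, i', hi', hb⟩ := ih _ ((Region.inner_side _ _).1 hin).2.2 (hi hin)
        refine ⟨s, hs, i', hi', fun j k => ?_⟩
        have h1 := h.abs_sub_le_one ht j (i + 1)
        have h2 := hb (i + 2) k
        rw [h.glue t i hin] at h2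
        have h3 := abs_sub_le (g t j) (g t (i + 1)) (g s k)
        push_cast
        linarith
      · refine ⟨t, ht, i, hin, fun j k => ?_⟩
        have h1 := h.abs_sub_le_one ht j k
        push_cast
        linarith
    cases hr : t.right
    · refine step 1 fun hin => ?_
      have hm := ((Region.inner_side _ _).1 hin).2.2
      have hb : (t.nb 1).base.1 = t.base.1 + 1 := by simp [Tri.nb_eq, hr]
      have h1 : ((R.tris.image fun t => t.base.1).filter fun x => (t.nb 1).base.1 < x).card <
          ((R.tris.image fun t => t.base.1).filter fun x => t.base.1 < x).card := by
        refine Finset.card_lt_card ⟨?_, ?_⟩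
        · intro x hx
          rw [Finset.mem_filter] at hx ⊢
          exact ⟨hx.1, by omega⟩
        · intro hsub
          have := hsub (Finset.mem_filter.2 ⟨Finset.mem_image_of_mem (fun t : Tri => t.base.1) hm,
            by omega⟩)
          rw [Finset.mem_filter] at this
          omega
      rw [Tri.nb_right, hr]
      simp [hr] at hn ⊢
      omega
    · refine step 2 fun _ => ?_
      have hb : (t.nb 2).base.1 = t.base.1 := by simp [Tri.nb_eq, hr]
      rw [Tri.nb_right, hr, hb]
      simp [hr] at hn ⊢
      omega

/-- At most `|∂R| - 1` columns lie beyond that of `t`, and each column costs two steps of the walk.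
-/
theorem exists_near_boundary' (h : IsHeight R X g) {t : Tri} (ht : t ∈ R.tris) :
    ∃ s ∈ R.tris, ∃ i, ¬ R.Inner (s.side i) ∧ ∀ j k, |g t j - g s k| ≤ 2 * R.boundarySize := by
  classical
  have h1 : ((R.tris.image fun t => t.base.1).filter fun x => t.base.1 < x).card <
      (R.tris.image fun t => t.base.1).card := by
    refine Finset.card_lt_card ⟨Finset.filter_subset _ _, fun hsub => ?_⟩
    have := hsub (Finset.mem_image_of_mem (fun t : Tri => t.base.1) ht)
    simp at this
  have h2 := R.card_columns
  obtain ⟨s, hs, i, hi, hb⟩ := h.exists_near_boundary (2 * R.boundarySize - 1) t ht (by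
    split_ifs <;> omega)
  refine ⟨s, hs, i, hi, fun j k => (hb j k).trans ?_⟩
  have : 1 ≤ R.boundarySize := by omega
  omega

/-- A level of the heights that is not crossed by the boundary does not separate it. -/
theorem level (h : IsHeight R X g) (hR : R.SimplyConnected) {s t : Tri} {i j : Fin 3}
    (hs : s ∈ R.tris) (ht : t ∈ R.tris) (hi : ¬ R.Inner (s.side i)) (hj : ¬ R.Inner (t.side j))
    {k : ℤ} (hk : g s (i + 1) < k) (hk' : k ≤ g t (j + 1)) :
    ∃ p ∈ R.boundarySides, g p.1 (p.1.top p.2) = k := by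
  by_contra! hno
  -- On a boundary side the increment is exactly `eps i`, which is 0 or 1, so this indicator can
  -- change along it only if its top has height `k`.
  have hB : R.BoundaryLocallyConst (fun t j => if k ≤ g t j then 1 else 0) := by
    refine ⟨fun t i hi => by simp only [h.glue t i hi], fun t ht i hi => ?_⟩
    have h1 := hno (t, i) (Region.mem_boundarySides.2 ⟨ht, hi⟩)
    have h2 := h.upper t ht i
    have h3 := h.tight t ht i (Or.inl hi)
    have h4 : eps i = 0 ∨ eps i = 1 := by unfold eps; split_ifs <;> simp
    cases hr : t.right <;> simp [Tri.top, Tri.bot, hr] at h1 h2 h3 <;> split_ifs <;> omega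
  obtain ⟨c, hc⟩ := hB.exists_const hR
  have h1 := (hc s hs i hi).1
  have h2 := (hc t ht j hj).1
  rw [if_neg (by omega)] at h1
  rw [if_pos hk'] at h2
  omega

/-- Every level between the two heights is the top height of some boundary side, and distinct levels
need distinct sides. -/
theorem boundary_range (h : IsHeight R X g) (hR : R.SimplyConnected) {s t : Tri} {i j : Fin 3}
    (hs : s ∈ R.tris) (ht : t ∈ R.tris) (hi : ¬ R.Inner (s.side i)) (hj : ¬ R.Inner (t.side j)) :
    g t (j + 1) - g s (i + 1) ≤ R.boundarySize := by
  classical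
  have h1 : Finset.Ioc (g s (i + 1)) (g t (j + 1)) ⊆
      R.boundarySides.image fun p => g p.1 (p.1.top p.2) := by
    intro k hk
    rw [Finset.mem_Ioc] at hk
    obtain ⟨p, hp, rfl⟩ := h.level hR hs ht hi hj hk.1 hk.2
    exact Finset.mem_image_of_mem _ hp
  have h2 := (Finset.card_le_card h1).trans Finset.card_image_le
  rw [Int.card_Ioc, Region.card_boundarySides] at h2
  omega

/-- The heights of a solution on a simply connected region differ by `O(|∂R|)`. -/
theorem range_le (h : IsHeight R X g) (hR : R.SimplyConnected) {s t : Tri} (hs : s ∈ R.tris)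
    (ht : t ∈ R.tris) (j k : Fin 3) : g t j - g s k ≤ 8 * R.boundarySize := by
  obtain ⟨s', hs', i, hi, hb⟩ := h.exists_near_boundary' hs
  obtain ⟨t', ht', i', hi', hb'⟩ := h.exists_near_boundary' ht
  -- The three estimates add up to 5 times `|∂R|`; the constant 8 is what the program obtains by
  -- three doublings.
  have h1 := h.boundary_range hR hs' ht' hi hi'
  have h2 := abs_le.1 (hb k (i + 1))
  have h3 := abs_le.1 (hb' j (i' + 1))
  omega

end IsHeight

/-! ### The extent of a connected region -/

namespace Region

variable {R : Region}

theorem walk_extent {s t : Tri} (p : R.dual.Walk s t) :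
    |t.base.1 - s.base.1| ≤ p.length ∧ |t.base.2 - s.base.2| ≤ p.length := by
  induction p with
  | nil => simp
  | @cons s u t h p ih =>
    obtain ⟨i, -, rfl⟩ := (adj_iff _ _).1 h
    have : |(s.nb i).base.1 - s.base.1| ≤ 1 ∧ |(s.nb i).base.2 - s.base.2| ≤ 1 := by
      rw [Tri.nb_eq]
      cases s.right <;> fin_cases i <;> simp
    rw [SimpleGraph.Walk.length_cons]
    push_cast
    simp only [abs_le] at *
    omega

/-- A walk without repetitions is shorter than the number of triangles, and each step moves the base
by at most 1 in each coordinate. -/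
theorem SimplyConnected.extent (hR : R.SimplyConnected) {s t : Tri} (hs : s ∈ R.tris)
    (ht : t ∈ R.tris) : |t.base.1 - s.base.1| ≤ R.tris.card ∧
      |t.base.2 - s.base.2| ≤ R.tris.card := by
  classical
  obtain ⟨p⟩ := hR.connected s hs t ht
  have hsup : ∀ {s t : Tri} (q : R.dual.Walk s t), s ∈ R.tris → ∀ u ∈ q.support, u ∈ R.tris := by
    intro s t q
    induction q with
    | nil => intro hs u hu; simp at hu; exact hu ▸ hs
    | cons h q ih =>
      intro hs u hu
      obtain ⟨i, hi, rfl⟩ := (adj_iff _ _).1 h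
      rw [SimpleGraph.Walk.support_cons, List.mem_cons] at hu
      rcases hu with rfl | hu
      · exact hs
      · exact ih ((inner_side _ _).1 hi).2.2 u hu
  have h1 := walk_extent p.bypass
  have h2 : p.bypass.support.toFinset ⊆ R.tris := fun u hu =>
    hsup _ hs u (List.mem_toFinset.1 hu)
  have h3 := Finset.card_le_card h2
  rw [List.toFinset_card_of_nodup p.bypass_isPath.support_nodup,
    SimpleGraph.Walk.length_support] at h3
  constructor
  · exact h1.1.trans (by exact_mod_cast (by omega : p.bypass.length ≤ R.tris.card))
  · exact h1.2.trans (by exact_mod_cast (by omega : p.bypass.length ≤ R.tris.card))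

end Region
/-! ### Reasoning about programs -/

namespace Prog

/-- The variables that a program may change. -/
def writes : Prog → List ℕ
  | skip => []
  | const x _ => [x]
  | add x _ _ => [x]
  | sub x _ _ => [x]
  | load x _ _ => [x]
  | store _ _ _ => []
  | seq P Q => P.writes ++ Q.writes
  | ite _ P Q => P.writes ++ Q.writes
  | loop _ P => P.writes

/-- The arrays that a program may change. -/
def stores : Prog → List ℕ
  | store A _ _ => [A]
  | seq P Q => P.stores ++ Q.stores
  | ite _ P Q => P.stores ++ Q.stores
  | loop _ P => P.stores
  | _ => []

/-- A program without loops. -/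
def loopFree : Prog → Bool
  | seq P Q => P.loopFree && Q.loopFree
  | ite _ P Q => P.loopFree && Q.loopFree
  | loop _ _ => false
  | _ => true

/-- The effect of a program without loops. -/
def eval : Prog → Store → Store
  | skip, s => s
  | const x n, s => s.set x n
  | add x y z, s => s.set x (s.var y + s.var z)
  | sub x y z, s => s.set x (s.var y - s.var z)
  | load x A y, s => s.set x (s.arr A (s.var y))
  | store A y x, s => s.write A (s.var y) (s.var x)
  | seq P Q, s => Q.eval (P.eval s)
  | ite x P Q, s => if 0 < s.var x then P.eval s else Q.eval s
  | loop _ _, s => s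

/-- A bound for the number of steps of a program without loops. -/
def size : Prog → ℕ
  | seq P Q => P.size + Q.size
  | ite _ P Q => P.size + Q.size + 1
  | _ => 1

/-- The sequential composition of a list of programs. -/
def block : List Prog → Prog
  | [] => skip
  | P :: L => seq P (block L)

/-- Started in `s`, the program `P` halts in `s'` after at most `k` steps. -/
def Reaches (P : Prog) (s : Store) (k : ℕ) (s' : Store) : Prop := ∃ j ≤ k, Exec P s j s'

end Prog

/-- Frame rule: the preservation of a variable is reduced to a decidable check of the program text.
-/
theorem Exec.var_eq {P : Prog} {s s' : Store} {k : ℕ} (h : Exec P s k s') {x : ℕ}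
    (hx : x ∉ P.writes) : s'.var x = s.var x := by
  induction h with
  | skip => rfl
  | const | add | sub | load =>
    simp only [Prog.writes, List.mem_singleton] at hx
    simp [Store.set, Function.update_of_ne hx]
  | store => rfl
  | seq _ _ ih₁ ih₂ =>
    simp only [Prog.writes, List.mem_append, not_or] at hx
    rw [ih₂ hx.2, ih₁ hx.1]
  | ite_pos _ _ ih =>
    simp only [Prog.writes, List.mem_append, not_or] at hx
    exact ih hx.1
  | ite_neg _ _ ih =>
    simp only [Prog.writes, List.mem_append, not_or] at hx
    exact ih hx.2
  | loop_exit => rfl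
  | loop_step _ _ _ ih₁ ih₂ => rw [ih₂ hx, ih₁ hx]

theorem Exec.arr_eq {P : Prog} {s s' : Store} {k : ℕ} (h : Exec P s k s') {A : ℕ}
    (hA : A ∉ P.stores) : s'.arr A = s.arr A := by
  induction h with
  | skip | const | add | sub | load => rfl
  | store =>
    simp only [Prog.stores, List.mem_singleton] at hA
    simp [Store.write, Function.update_of_ne hA]
  | seq _ _ ih₁ ih₂ =>
    simp only [Prog.stores, List.mem_append, not_or] at hA
    rw [ih₂ hA.2, ih₁ hA.1]
  | ite_pos _ _ ih =>
    simp only [Prog.stores, List.mem_append, not_or] at hA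
    exact ih hA.1
  | ite_neg _ _ ih =>
    simp only [Prog.stores, List.mem_append, not_or] at hA
    exact ih hA.2
  | loop_exit => rfl
  | loop_step _ _ _ ih₁ ih₂ => rw [ih₂ hA, ih₁ hA]

namespace Prog

/-- Loop-free programs are run symbolically by `eval`, so that only loops need invariants. -/
theorem reaches_eval (P : Prog) (hP : P.loopFree = true) (s : Store) :
    P.Reaches s P.size (P.eval s) := by
  induction P generalizing s with
  | skip => exact ⟨1, le_rfl, .skip s⟩
  | const x n => exact ⟨1, le_rfl, .const s x n⟩
  | add x y z => exact ⟨1, le_rfl, .add s x y z⟩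
  | sub x y z => exact ⟨1, le_rfl, .sub s x y z⟩
  | load x A y => exact ⟨1, le_rfl, .load s x A y⟩
  | store A y x => exact ⟨1, le_rfl, .store s A y x⟩
  | seq P Q ihP ihQ =>
    simp only [loopFree, Bool.and_eq_true] at hP
    obtain ⟨j, hj, h⟩ := ihP hP.1 s
    obtain ⟨j', hj', h'⟩ := ihQ hP.2 (P.eval s)
    exact ⟨j + j', Nat.add_le_add hj hj', h.seq h'⟩
  | ite x P Q ihP ihQ =>
    simp only [loopFree, Bool.and_eq_true] at hP
    by_cases hx : 0 < s.var x
    · obtain ⟨j, hj, h⟩ := ihP hP.1 s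
      refine ⟨j + 1, by simp only [size]; omega, ?_⟩
      simp only [eval, if_pos hx]
      exact .ite_pos hx h
    · obtain ⟨j, hj, h⟩ := ihQ hP.2 s
      refine ⟨j + 1, by simp only [size]; omega, ?_⟩
      simp only [eval, if_neg hx]
      exact .ite_neg hx h
  | loop x P => simp [loopFree] at hP

theorem eval_var {P : Prog} (hP : P.loopFree = true) (s : Store) {x : ℕ} (hx : x ∉ P.writes) :
    (P.eval s).var x = s.var x := by
  obtain ⟨_, _, h⟩ := P.reaches_eval hP s
  exact h.var_eq hx

theorem eval_arr {P : Prog} (hP : P.loopFree = true) (s : Store) {A : ℕ} (hA : A ∉ P.stores) :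
    (P.eval s).arr A = s.arr A := by
  obtain ⟨_, _, h⟩ := P.reaches_eval hP s
  exact h.arr_eq hA

theorem Reaches.var_eq {P : Prog} {s s' : Store} {k : ℕ} (h : P.Reaches s k s') {x : ℕ}
    (hx : x ∉ P.writes) : s'.var x = s.var x := by
  obtain ⟨_, _, h⟩ := h
  exact h.var_eq hx

theorem Reaches.arr_eq {P : Prog} {s s' : Store} {k : ℕ} (h : P.Reaches s k s') {A : ℕ}
    (hA : A ∉ P.stores) : s'.arr A = s.arr A := by
  obtain ⟨_, _, h⟩ := h
  exact h.arr_eq hA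

theorem Reaches.seq {P Q : Prog} {s s' s'' : Store} {k l : ℕ} (h : P.Reaches s k s')
    (h' : Q.Reaches s' l s'') : (Prog.seq P Q).Reaches s (k + l) s'' := by
  obtain ⟨j, hj, h⟩ := h
  obtain ⟨j', hj', h'⟩ := h'
  exact ⟨j + j', Nat.add_le_add hj hj', h.seq h'⟩

theorem Reaches.mono {P : Prog} {s s' : Store} {k l : ℕ} (h : P.Reaches s k s') (hkl : k ≤ l) :
    P.Reaches s l s' := by
  obtain ⟨j, hj, h⟩ := h
  exact ⟨j, hj.trans hkl, h⟩

/-- Total correctness and running time of a loop with invariant `I` and variant `μ`. -/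
theorem reaches_loop {x : ℕ} {P : Prog} {c : ℕ} (I : Store → Prop) (μ : Store → ℕ)
    (h : ∀ s, I s → 0 < s.var x → ∃ s', P.Reaches s c s' ∧ I s' ∧ μ s' < μ s) (s : Store)
    (hs : I s) :
    ∃ s', (loop x P).Reaches s ((c + 1) * μ s + 1) s' ∧ I s' ∧ ¬ 0 < s'.var x := by
  induction hm : μ s using Nat.strong_induction_on generalizing s with
  | _ m ih =>
    by_cases hx : 0 < s.var x
    · obtain ⟨s', ⟨j, hj, h1⟩, h2, h3⟩ := h s hs hx
      obtain ⟨s'', ⟨j', hj', h4⟩, h5, h6⟩ := ih _ (hm ▸ h3) s' h2 rfl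
      refine ⟨s'', ⟨j + j' + 1, ?_, .loop_step hx h1 h4⟩, h5, h6⟩
      have : (c + 1) * (μ s' + 1) ≤ (c + 1) * m := Nat.mul_le_mul_left _ (by omega)
      rw [Nat.mul_add] at this
      omega
    · exact ⟨s, ⟨1, by omega, .loop_exit hx⟩, hs, hx⟩

/-- `forEach P` runs `P` on the consecutive blocks of length `9` of the input, variable `7`
being the start of the block. It assumes that variable `3` is `0`. -/
def forEach (P : Prog) : Prog :=
  block [const 7 0, add 9 0 3,
    loop 9 (seq P (block [const 15 9, add 7 7 15, sub 9 9 15]))]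

/-- The hypothesis `hI` makes the invariant insensitive to variables 7, 9 and 15, which the loop
control overwrites. -/
theorem reaches_forEach {P : Prog} {c n : ℕ} (I : ℕ → Store → Prop)
    (hI : ∀ j s a b d, I j s → I j (((s.set 15 a).set 7 b).set 9 d))
    (h : ∀ j < n, ∀ s, I j s → s.var 7 = 9 * j → s.var 9 = 9 * (n - j : ℤ) →
      ∃ s', P.Reaches s c s' ∧ I (j + 1) s' ∧ s'.var 7 = s.var 7 ∧ s'.var 9 = s.var 9)
    (s : Store) (h0 : s.var 0 = 9 * n) (h3 : s.var 3 = 0) (hs : ∀ a b, I 0 ((s.set 7 a).set 9 b)) :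
    ∃ s', (forEach P).Reaches s ((c + 5) * n + 4) s' ∧ I n s' := by
  let s₀ := (s.set 7 0).set 9 (9 * n)
  obtain ⟨s', h1, h2, h3'⟩ := reaches_loop (x := 9)
    (P := seq P (block [const 15 9, add 7 7 15, sub 9 9 15])) (c := c + 4)
    (fun s => ∃ j ≤ n, I j s ∧ s.var 7 = 9 * j ∧ s.var 9 = 9 * (n - j : ℤ))
    (fun s => (s.var 9).toNat / 9) (by
      rintro s ⟨j, hj, hIj, h7, h9⟩ hpos
      have hjn : j < n := by omega
      obtain ⟨s', hr, hI', h7', h9'⟩ := h j hjn s hIj h7 h9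
      refine ⟨_, hr.seq (reaches_eval _ rfl s'), ⟨j + 1, hjn, ?_, ?_, ?_⟩, ?_⟩
      · exact hI _ _ _ _ _ hI'
      · simp [block, eval, Store.set, h7', h7]
        ring
      · simp [block, eval, Store.set, h9', h9]
        ring
      · simp [block, eval, Store.set, h9', h9]
        omega) s₀ ⟨0, Nat.zero_le _, hs _ _, by simp [s₀, Store.set], by simp [s₀, Store.set]⟩
  obtain ⟨j, hj, hIj, h7, h9⟩ := h2
  obtain rfl : j = n := by omega
  refine ⟨s', ?_, hIj⟩
  have e1 : (const 7 0).Reaches s 1 (s.set 7 0) := ⟨1, le_rfl, .const _ _ _⟩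
  have e2 : (add 9 0 3).Reaches (s.set 7 0) 1 s₀ := by
    have := Exec.add (s.set 7 0) 9 0 3
    simp only [Store.set] at this
    simp [h0, h3] at this
    exact ⟨1, le_rfl, this⟩
  have e3 : (skip).Reaches s' 1 s' := ⟨1, le_rfl, .skip _⟩
  refine (e1.seq (e2.seq (h1.seq e3))).mono ?_
  have : (s₀.var 9).toNat / 9 = j := by simp [s₀, Store.set]; omega
  rw [this]
  ring_nf
  omega

end Prog
namespace Prog

/-! ### Solving a system of difference constraints -/

/-- Push `n` consecutive integers, starting with variable `44`, on the stack in array `10`, whose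
height is variable `21`. Variable `2` is assumed to be `1`. -/
def push : ℕ → Prog
  | 0 => skip
  | n + 1 => seq (push n) (block [store 10 21 44, add 21 21 2, add 44 44 2])

theorem push_loopFree (n : ℕ) : (push n).loopFree = true := by
  induction n with
  | zero => rfl
  | succ n ih => simp [push, loopFree, ih, block]

theorem push_writes (n : ℕ) {x : ℕ} (h : x ≠ 21) (h' : x ≠ 44) : x ∉ (push n).writes := by
  induction n with
  | zero => simp [push, writes]
  | succ n ih => simp [push, writes, ih, block, h, h']

theorem push_stores (n : ℕ) {A : ℕ} (h : A ≠ 10) : A ∉ (push n).stores := by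
  induction n with
  | zero => simp [push, stores]
  | succ n ih => simp [push, stores, ih, block, h]

theorem push_var (n : ℕ) (s : Store) {x : ℕ} (h : x ≠ 21) (h' : x ≠ 44) :
    ((push n).eval s).var x = s.var x :=
  eval_var (push_loopFree n) s (push_writes n h h')

theorem push_arr (n : ℕ) (s : Store) {A : ℕ} (h : A ≠ 10) :
    ((push n).eval s).arr A = s.arr A :=
  eval_arr (push_loopFree n) s (push_stores n h)

theorem push_eval (n : ℕ) (s : Store) (h2 : s.var 2 = 1) :
    ((push n).eval s).var 21 = s.var 21 + n ∧ ((push n).eval s).var 44 = s.var 44 + n ∧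
    ∀ i, ((push n).eval s).arr 10 i =
      if s.var 21 ≤ i ∧ i < s.var 21 + n then s.var 44 + (i - s.var 21) else s.arr 10 i := by
  induction n with
  | zero =>
    refine ⟨by simp [push, eval], by simp [push, eval], fun i => ?_⟩
    rw [if_neg (by push_cast; omega)]
    rfl
  | succ n ih =>
    obtain ⟨h21, h44, h10⟩ := ih
    have h2' : ((push n).eval s).var 2 = 1 := by rw [push_var n s (by decide) (by decide), h2]
    refine ⟨?_, ?_, fun i => ?_⟩
    · simp [push, eval, block, Store.set, Store.write, h21, h2']
      ring
    · simp [push, eval, block, Store.set, Store.write, h44, h2']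
      ring
    · simp [push, eval, block, Store.set, Store.write, h21, h44, Function.update_apply, h10]
      split_ifs <;> omega

/-- Test the constraint on the top of the stack, and repair it if it is violated. -/
def relaxStep : Prog :=
  seq (block [sub 21 21 2, load 40 10 21, load 41 5 40, load 42 6 40, load 43 7 40, load 44 8 40,
    load 45 9 41, add 45 45 43, load 46 9 42, sub 46 45 46])
    (ite 46 (seq (sub 47 45 22) (ite 47 (const 23 1) (seq (store 9 42 45) (push 18)))) skip)

theorem relaxStep_loopFree : relaxStep.loopFree = true := by
  simp [relaxStep, loopFree, push_loopFree, block]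

/-- The relaxation of all constraints. The `k`-th constraint says that the value at `dst k` is at
least the value at `src k` plus `wt k`. -/
def relax : Prog := loop 21 relaxStep

/-- The three outcomes: the popped constraint holds; its repair would exceed the cap; its target is
raised and 18 constraints are pushed. -/
theorem relaxStep_eval (s : Store) (h2 : s.var 2 = 1) {sp k cand : ℤ} (hsp : sp = s.var 21 - 1)
    (hk : k = s.arr 10 sp) (hc : cand = s.arr 9 (s.arr 5 k) + s.arr 7 k) :
    ((relaxStep.eval s).var 21 = sp ∧ (relaxStep.eval s).var 23 = s.var 23 ∧
      (relaxStep.eval s).arr 9 = s.arr 9 ∧ (relaxStep.eval s).arr 10 = s.arr 10 ∧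
      cand ≤ s.arr 9 (s.arr 6 k)) ∨
    ((relaxStep.eval s).var 21 = sp ∧ (relaxStep.eval s).var 23 = 1 ∧
      (relaxStep.eval s).arr 9 = s.arr 9 ∧ (relaxStep.eval s).arr 10 = s.arr 10 ∧
      s.var 22 < cand) ∨
    ((relaxStep.eval s).var 21 = sp + 18 ∧ (relaxStep.eval s).var 23 = s.var 23 ∧
      (relaxStep.eval s).arr 9 = Function.update (s.arr 9) (s.arr 6 k) cand ∧
      (∀ i, (relaxStep.eval s).arr 10 i =
        if sp ≤ i ∧ i < sp + 18 then s.arr 8 k + (i - sp) else s.arr 10 i) ∧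
      s.arr 9 (s.arr 6 k) < cand ∧ cand ≤ s.var 22) := by
  obtain ⟨s₁, hs₁⟩ : ∃ s₁, s₁ = eval (block [sub 21 21 2, load 40 10 21, load 41 5 40,
    load 42 6 40, load 43 7 40, load 44 8 40, load 45 9 41, add 45 45 43, load 46 9 42,
    sub 46 45 46]) s := ⟨_, rfl⟩
  have e21 : s₁.var 21 = sp := by simp [hs₁, block, eval, Store.set, h2, hsp]
  have e45 : s₁.var 45 = cand := by simp [hs₁, block, eval, Store.set, h2, hsp, hc, hk]
  have e46 : s₁.var 46 = cand - s.arr 9 (s.arr 6 k) := by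
    simp [hs₁, block, eval, Store.set, h2, hsp, hc, hk]
  have e42 : s₁.var 42 = s.arr 6 k := by simp [hs₁, block, eval, Store.set, h2, hsp, hk]
  have e44 : s₁.var 44 = s.arr 8 k := by simp [hs₁, block, eval, Store.set, h2, hsp, hk]
  have e2 : s₁.var 2 = 1 := by simp [hs₁, block, eval, Store.set, h2]
  have e22 : s₁.var 22 = s.var 22 := by simp [hs₁, block, eval, Store.set]
  have e23 : s₁.var 23 = s.var 23 := by simp [hs₁, block, eval, Store.set]
  have ea : s₁.arr = s.arr := by simp [hs₁, block, eval, Store.set]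
  have he : relaxStep.eval s = eval (ite 46 (seq (sub 47 45 22)
    (ite 47 (const 23 1) (seq (store 9 42 45) (push 18)))) skip) s₁ := by rw [hs₁]; rfl
  rw [he]
  clear he hs₁
  by_cases c1 : 0 < s₁.var 46
  · by_cases c2 : 0 < s₁.var 45 - s₁.var 22
    · right; left
      have c3 : s₁.var 22 < s₁.var 45 := by omega
      simp [eval, c1, c3, Store.set, e21, ea]
      omega
    · right; right
      obtain ⟨s₂, hs₂⟩ : ∃ s₂, s₂ = eval (seq (sub 47 45 22) (store 9 42 45)) s₁ := ⟨_, rfl⟩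
      have he : eval (ite 46 (seq (sub 47 45 22)
          (ite 47 (const 23 1) (seq (store 9 42 45) (push 18)))) skip) s₁ = (push 18).eval s₂ := by
        simp only [eval, if_pos c1, Store.set, Function.update_self, if_neg c2, hs₂]
      have f2 : s₂.var 2 = 1 := by simp [hs₂, eval, Store.set, Store.write, e2]
      have f21 : s₂.var 21 = sp := by simp [hs₂, eval, Store.set, Store.write, e21]
      have f23 : s₂.var 23 = s.var 23 := by simp [hs₂, eval, Store.set, Store.write, e23]
      have f44 : s₂.var 44 = s.arr 8 k := by simp [hs₂, eval, Store.set, Store.write, e44]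
      have f9 : s₂.arr 9 = Function.update (s.arr 9) (s.arr 6 k) cand := by
        simp [hs₂, eval, Store.set, Store.write, e42, e45, ea]
      have f10 : s₂.arr 10 = s.arr 10 := by simp [hs₂, eval, Store.set, Store.write, ea]
      obtain ⟨p1, -, p3⟩ := push_eval 18 s₂ f2
      rw [he]
      refine ⟨by rw [p1, f21]; rfl, by rw [push_var _ _ (by decide) (by decide), f23],
        by rw [push_arr _ _ (by decide), f9], fun i => ?_, by omega, by omega⟩
      rw [p3, f21, f44, f10]
      rfl
  · left
    simp [eval, c1, e21, e23, ea]
    omega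

/-- The constraints with source `dst k` are among those that are pushed when `dst k` is raised. -/
structure IsSystem (U M : ℕ) (src dst wt blk : ℤ → ℤ) : Prop where
  dst_mem : ∀ k : ℤ, 0 ≤ k → k < M → 0 ≤ dst k ∧ dst k < U
  src_mem : ∀ k : ℤ, 0 ≤ k → k < M → 0 ≤ src k ∧ src k < U
  blk_mem : ∀ k : ℤ, 0 ≤ k → k < M → 0 ≤ blk k ∧ blk k + 18 ≤ M
  closed : ∀ k : ℤ, 0 ≤ k → k < M → ∀ k' : ℤ, 0 ≤ k' → k' < M → src k' = dst k →
    (blk k ≤ k' ∧ k' < blk k + 18) ∨ (src k' = dst k' ∧ wt k' = 0)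

/-- The values `g` satisfy the constraints. -/
def Satisfies (M : ℕ) (src dst wt : ℤ → ℤ) (g : ℤ → ℤ) : Prop :=
  ∀ k : ℤ, 0 ≤ k → k < M → g (src k) + wt k ≤ g (dst k)

/-- The values `g` satisfy the constraints and lie between `0` and `D`. -/
def BoundedSolution (U M : ℕ) (src dst wt : ℤ → ℤ) (D : ℤ) (g : ℤ → ℤ) : Prop :=
  Satisfies M src dst wt g ∧ ∀ u : ℤ, 0 ≤ u → u < U → 0 ≤ g u ∧ g u ≤ D

/-- The invariant of the relaxation loop. -/
structure RelaxInv (U M : ℕ) (src dst wt blk : ℤ → ℤ) (D : ℤ) (s : Store) : Prop where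
  one : s.var 2 = 1
  cap : s.var 22 = D
  src_eq : s.arr 5 = src
  dst_eq : s.arr 6 = dst
  wt_eq : s.arr 7 = wt
  blk_eq : s.arr 8 = blk
  sp_nonneg : 0 ≤ s.var 21
  stack_mem : ∀ i : ℤ, 0 ≤ i → i < s.var 21 → 0 ≤ s.arr 10 i ∧ s.arr 10 i < M
  val_mem : ∀ u : ℤ, 0 ≤ u → u < U → 0 ≤ s.arr 9 u ∧ s.arr 9 u ≤ D
  le_solution : ∀ g, BoundedSolution U M src dst wt D g → ∀ u : ℤ, 0 ≤ u → u < U → s.arr 9 u ≤ g u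
  fail : 0 < s.var 23 → ¬ ∃ g, BoundedSolution U M src dst wt D g
  pending : 0 < s.var 23 ∨ ∀ k : ℤ, 0 ≤ k → k < M → s.arr 9 (src k) + wt k ≤ s.arr 9 (dst k) ∨
    ∃ i : ℤ, 0 ≤ i ∧ i < s.var 21 ∧ s.arr 10 i = k

/-- The variant of the relaxation loop. -/
def relaxMeasure (U : ℕ) (D : ℤ) (s : Store) : ℕ :=
  19 * ∑ u ∈ Finset.range U, (D - s.arr 9 u).toNat + (s.var 21).toNat

/-- A raise pops one constraint and pushes 18, but uses up at least one unit of room below `D`,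
which weighs 19 in the measure. The raised value is forced by the constraint, so it stays below
every bounded solution. -/
theorem RelaxInv.step {U M : ℕ} {src dst wt blk : ℤ → ℤ} {D : ℤ}
    (hsys : IsSystem U M src dst wt blk) {s : Store} (h : RelaxInv U M src dst wt blk D s)
    (hpos : 0 < s.var 21) :
    RelaxInv U M src dst wt blk D (relaxStep.eval s) ∧
      relaxMeasure U D (relaxStep.eval s) < relaxMeasure U D s := by
  obtain ⟨sp, hsp⟩ : ∃ sp, sp = s.var 21 - 1 := ⟨_, rfl⟩
  obtain ⟨k, hk⟩ : ∃ k, k = s.arr 10 sp := ⟨_, rfl⟩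
  obtain ⟨cand, hc⟩ : ∃ cand, cand = s.arr 9 (s.arr 5 k) + s.arr 7 k := ⟨_, rfl⟩
  have hkM := h.stack_mem sp (by omega) (by omega)
  rw [← hk] at hkM
  have hcase := relaxStep_eval s h.one hsp hk hc
  rw [h.src_eq, h.wt_eq] at hc
  rw [h.dst_eq, h.blk_eq, h.cap] at hcase
  have hdst := hsys.dst_mem k hkM.1 hkM.2
  have hsrc := hsys.src_mem k hkM.1 hkM.2
  have hblk := hsys.blk_mem k hkM.1 hkM.2
  have hv : ∀ x, x ≠ 21 → x ≠ 23 → x ∉ [40, 41, 42, 43, 44, 45, 46, 47] →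
      (relaxStep.eval s).var x = s.var x := fun x h1 h2 h3 => by
    simp only [List.mem_cons, List.not_mem_nil, or_false, not_or] at h3
    refine eval_var relaxStep_loopFree s ?_
    simp [relaxStep, writes, block, h1, h2, h3, push_writes]
  have ha : ∀ A, A ≠ 9 → A ≠ 10 → (relaxStep.eval s).arr A = s.arr A := fun A h1 h2 => by
    refine eval_arr relaxStep_loopFree s ?_
    simp [relaxStep, stores, block, h1, h2, push_stores]
  have i2 : (relaxStep.eval s).var 2 = 1 := by
    rw [hv 2 (by decide) (by decide) (by decide), h.one]
  have i22 : (relaxStep.eval s).var 22 = D := by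
    rw [hv 22 (by decide) (by decide) (by decide), h.cap]
  have i5 : (relaxStep.eval s).arr 5 = src := by rw [ha 5 (by decide) (by decide), h.src_eq]
  have i6 : (relaxStep.eval s).arr 6 = dst := by rw [ha 6 (by decide) (by decide), h.dst_eq]
  have i7 : (relaxStep.eval s).arr 7 = wt := by rw [ha 7 (by decide) (by decide), h.wt_eq]
  have i8 : (relaxStep.eval s).arr 8 = blk := by rw [ha 8 (by decide) (by decide), h.blk_eq]
  generalize relaxStep.eval s = s' at *
  clear hv ha
  rcases hcase with ⟨h21, h23, h9, h10, hle⟩ | ⟨h21, h23, h9, h10, hlt⟩ |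
    ⟨h21, h23, h9, h10, hlt, hle⟩
  · refine ⟨⟨i2, i22, i5, i6, i7, i8, by omega, ?_, ?_, ?_, ?_, ?_⟩, ?_⟩
    · intro i h0 h1
      rw [h10]
      exact h.stack_mem i h0 (by omega)
    · rw [h9]; exact h.val_mem
    · rw [h9]; exact h.le_solution
    · rw [h23]; exact h.fail
    · rw [h23, h9, h10, h21]
      refine h.pending.imp id fun hp k' h0 h1 => ?_
      rcases hp k' h0 h1 with h2 | ⟨i, hi0, hi1, hi2⟩
      · exact Or.inl h2
      · by_cases hi : i = sp
        · left
          rw [← hi2, hi, ← hk, ← hc]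
          exact hle
        · exact Or.inr ⟨i, hi0, by omega, hi2⟩
    · simp only [relaxMeasure, h9, h21]
      omega
  · refine ⟨⟨i2, i22, i5, i6, i7, i8, by omega, ?_, ?_, ?_, ?_, ?_⟩, ?_⟩
    · intro i h0 h1
      rw [h10]
      exact h.stack_mem i h0 (by omega)
    · rw [h9]; exact h.val_mem
    · rw [h9]; exact h.le_solution
    -- The required value is at most `g` at the target, hence at most `D`, but it was found to
    -- exceed `D`.
    · rintro - ⟨g, hg⟩
      have h1 := h.le_solution g hg _ hsrc.1 hsrc.2
      have h2 := hg.1 k hkM.1 hkM.2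
      have h3 := hg.2 _ hdst.1 hdst.2
      omega
    · left; omega
    · simp only [relaxMeasure, h9, h21]
      omega
  · refine ⟨⟨i2, i22, i5, i6, i7, i8, by omega, ?_, ?_, ?_, ?_, ?_⟩, ?_⟩
    · intro i h0 h1
      rw [h10]
      split_ifs with hi
      · omega
      · exact h.stack_mem i h0 (by omega)
    · intro u h0 h1
      have h2 := h.val_mem u h0 h1
      have h3 := h.val_mem _ hdst.1 hdst.2
      rw [h9, Function.update_apply]
      split_ifs
      · omega
      · exact h2
    · intro g hg u h0 h1
      rw [h9, Function.update_apply]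
      split_ifs with hu
      · have h2 := h.le_solution g hg _ hsrc.1 hsrc.2
        have h3 := hg.1 k hkM.1 hkM.2
        rw [hu]
        omega
      · exact h.le_solution g hg u h0 h1
    · rw [h23]; exact h.fail
    · rw [h23]
      refine h.pending.imp id fun hp k' h0 h1 => ?_
      -- Raising a value can only violate constraints that have it as source. By `closed`, these
      -- have just been pushed or are trivial.
      by_cases hs : src k' = dst k
      · rcases hsys.closed k hkM.1 hkM.2 k' h0 h1 hs with h2 | ⟨h2, h3⟩
        · right
          refine ⟨sp + (k' - blk k), by omega, by omega, ?_⟩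
          rw [h10, if_pos (by omega)]
          ring
        · left
          rw [h2, h3, add_zero]
      · have hge : s.arr 9 (dst k') ≤ s'.arr 9 (dst k') := by
          rw [h9, Function.update_apply]
          split_ifs with hd
          · rw [hd]; omega
          · exact le_rfl
        have heq : s'.arr 9 (src k') = s.arr 9 (src k') := by
          rw [h9, Function.update_of_ne hs]
        rcases hp k' h0 h1 with h2 | ⟨i, hi0, hi1, hi2⟩
        · left; omega
        · by_cases hi : i = sp
          · left
            have hkk : k' = k := by rw [← hi2, hi, hk]
            rw [heq, h9, hkk, Function.update_self, hc]
          · refine Or.inr ⟨i, hi0, by omega, ?_⟩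
            rw [h10, if_neg (by omega), hi2]
    · have hsum : ∑ u ∈ Finset.range U, (D - s'.arr 9 u).toNat <
          ∑ u ∈ Finset.range U, (D - s.arr 9 u).toNat := by
        refine Finset.sum_lt_sum (fun u _ => ?_) ⟨(dst k).toNat, ?_, ?_⟩
        · rw [h9, Function.update_apply]
          split_ifs with hu
          · rw [hu]; omega
          · exact le_rfl
        · rw [Finset.mem_range]; omega
        · rw [Int.toNat_of_nonneg hdst.1, h9, Function.update_self]
          omega
      simp only [relaxMeasure, h21]
      omega

/-- The relaxation loop finds a solution of the constraints with values between `0` and `D`, or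
finds out that there is none. -/
theorem reaches_relax {U M : ℕ} {src dst wt blk : ℤ → ℤ} {D : ℕ}
    (hsys : IsSystem U M src dst wt blk) {s : Store} (h2 : s.var 2 = 1) (h22 : s.var 22 = D)
    (h5 : s.arr 5 = src) (h6 : s.arr 6 = dst) (h7 : s.arr 7 = wt) (h8 : s.arr 8 = blk)
    (h9 : ∀ u, s.arr 9 u = 0) (h21 : s.var 21 = M) (h10 : ∀ i : ℤ, 0 ≤ i → i < M → s.arr 10 i = i)
    (h23 : s.var 23 = 0) :
    ∃ s', relax.Reaches s ((relaxStep.size + 1) * (19 * (U * D) + M) + 1) s' ∧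
      (¬ 0 < s'.var 23 → Satisfies M src dst wt (s'.arr 9)) ∧
      (0 < s'.var 23 → ¬ ∃ g, BoundedSolution U M src dst wt D g) := by
  obtain ⟨s', hr, hI, hx⟩ := reaches_loop (x := 21) (P := relaxStep) (c := relaxStep.size)
    (RelaxInv U M src dst wt blk D) (relaxMeasure U D)
    (fun s hs hpos => ⟨_, reaches_eval _ relaxStep_loopFree s, hs.step hsys hpos⟩) s
    ⟨h2, h22, h5, h6, h7, h8, by omega,
      fun i h0 h1 => by rw [h10 i h0 (by omega)]; omega,
      fun u _ _ => by rw [h9]; omega,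
      fun g hg u h0 h1 => by rw [h9]; exact (hg.2 u h0 h1).1,
      fun h => by omega,
      Or.inr fun k h0 h1 => Or.inr ⟨k, h0, by omega, h10 k h0 h1⟩⟩
  refine ⟨s', ?_, fun hf k h0 h1 => ?_, hI.fail⟩
  · have : relaxMeasure U D s = 19 * (U * D) + M := by
      simp [relaxMeasure, h9, h21]
    rw [← this]
    exact hr
  · rcases hI.pending with hp | hp
    · exact absurd hp hf
    · rcases hp k h0 h1 with hp | ⟨i, hi0, hi1, -⟩
      · exact hp
      · omega

end Prog
-- The meaning of the input array.
/-- The array `a` describes a puzzle whose triangles are `T 0, …, T (n - 1)`. -/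
structure Input (R : Region) (X : Set Edge) (n : ℕ) (T : ℕ → Tri) (idx : Tri → ℕ) (a : ℤ → ℤ) :
    Prop where
  pos : 0 < n
  idx_T : ∀ j < n, idx (T j) = j
  T_mem : ∀ j < n, T j ∈ R.tris
  idx_lt : ∀ t ∈ R.tris, idx t < n
  T_idx : ∀ t ∈ R.tris, T (idx t) = t
  fst : ∀ j < n, a (9 * j) = (T j).base.1
  snd : ∀ j < n, a (9 * j + 1) = (T j).base.2
  right : ∀ j < n, a (9 * j + 2) = bit ((T j).right = true)
  imposed : ∀ j < n, ∀ i : Fin 3, a (9 * j + (3 + i)) = bit ((T j).side i ∈ X)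
  slit : ∀ j < n, ∀ i : Fin 3, a (9 * j + (6 + i)) = bit ((T j).side i ∈ R.slits)
  extent : ∀ t ∈ R.tris, |t.base.1 - (T 0).base.1| ≤ n ∧ |t.base.2 - (T 0).base.2| ≤ n

theorem bit_pos (p : Prop) : 0 < bit p ↔ p := by
  unfold bit; split_ifs with h <;> simp [h]

namespace Prog

/-! ### Multiples of the length of the input -/

/-- One step of the computation of the multiplication table. -/
def tableStep : Prog :=
  block [store 2 7 8, sub 10 3 7, sub 11 3 8, store 2 10 11, add 7 7 2, add 8 8 0, sub 9 9 2]

/-- Store the products of the length of the input with small integers in array `2`, and the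
coordinates of the first triangle in the variables `5` and `6`. -/
def table : Prog :=
  seq (block [const 2 1, const 3 0, load 5 0 3, load 6 0 2, const 7 0, const 8 0, add 9 0 2])
    (loop 9 tableStep)

/-- The variables and arrays that keep their values after the table has been computed. -/
structure Context (a : ℤ → ℤ) (n : ℕ) (x₀ y₀ : ℤ) (s : Store) : Prop where
  len : s.var 0 = 9 * n
  one : s.var 2 = 1
  zero : s.var 3 = 0
  fst : s.var 5 = x₀
  snd : s.var 6 = y₀
  input : s.arr 0 = a
  table : ∀ i : ℤ, |i| ≤ 9 * n → s.arr 2 i = 9 * n * i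

theorem Context.frame {a : ℤ → ℤ} {n : ℕ} {x₀ y₀ : ℤ} {s s' : Store} (h : Context a n x₀ y₀ s)
    (hv : ∀ x ∈ [0, 2, 3, 5, 6], s'.var x = s.var x) (ha : ∀ A ∈ [0, 2], s'.arr A = s.arr A) :
    Context a n x₀ y₀ s' := by
  constructor
  · rw [hv 0 (by decide), h.len]
  · rw [hv 2 (by decide), h.one]
  · rw [hv 3 (by decide), h.zero]
  · rw [hv 5 (by decide), h.fst]
  · rw [hv 6 (by decide), h.snd]
  · rw [ha 0 (by decide), h.input]
  · rw [ha 2 (by decide)]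
    exact h.table

theorem Context.reaches {a : ℤ → ℤ} {n : ℕ} {x₀ y₀ : ℤ} {s s' : Store} (h : Context a n x₀ y₀ s)
    {P : Prog} {k : ℕ} (hP : P.Reaches s k s') (hv : ∀ x ∈ [0, 2, 3, 5, 6], x ∉ P.writes)
    (ha : ∀ A ∈ [0, 2], A ∉ P.stores) : Context a n x₀ y₀ s' :=
  h.frame (fun x hx => hP.var_eq (hv x hx)) (fun A hA => hP.arr_eq (ha A hA))

/-- The products are built by repeated addition, the entries at `i` and `-i` together. -/
theorem reaches_table {a : ℤ → ℤ} {n : ℕ} {s : Store} (h0 : s.var 0 = 9 * n) (ha : s.arr 0 = a) :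
    ∃ s', table.Reaches s (9 * (9 * n + 1) + 9) s' ∧
      Context a n (a 0) (a 1) s' := by
  obtain ⟨s₁, hs₁⟩ : ∃ s₁, s₁ = eval (block [const 2 1, const 3 0, load 5 0 3, load 6 0 2,
    const 7 0, const 8 0, add 9 0 2]) s := ⟨_, rfl⟩
  have hr : (block [const 2 1, const 3 0, load 5 0 3, load 6 0 2, const 7 0, const 8 0,
      add 9 0 2]).Reaches s 8 s₁ := hs₁ ▸ reaches_eval _ rfl s
  have e0 : s₁.var 0 = 9 * n := by simp [hs₁, block, eval, Store.set, h0]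
  have e2 : s₁.var 2 = 1 := by simp [hs₁, block, eval, Store.set]
  have e3 : s₁.var 3 = 0 := by simp [hs₁, block, eval, Store.set]
  have e5 : s₁.var 5 = a 0 := by simp [hs₁, block, eval, Store.set, ha]
  have e6 : s₁.var 6 = a 1 := by simp [hs₁, block, eval, Store.set, ha]
  have e7 : s₁.var 7 = 0 := by simp [hs₁, block, eval, Store.set]
  have e8 : s₁.var 8 = 0 := by simp [hs₁, block, eval, Store.set]
  have e9 : s₁.var 9 = 9 * n + 1 := by simp [hs₁, block, eval, Store.set, h0]
  have ea : s₁.arr 0 = a := by rw [← ha, hs₁]; rfl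
  clear hs₁
  obtain ⟨s', hr', ⟨j, k0, k2, k3, k7, k8, k9, k9', kt⟩, hx⟩ := reaches_loop (x := 9)
    (P := tableStep) (c := 8)
    (fun s => ∃ j : ℕ, s.var 0 = 9 * n ∧ s.var 2 = 1 ∧ s.var 3 = 0 ∧ s.var 7 = j ∧
      s.var 8 = 9 * n * j ∧ s.var 9 = 9 * n + 1 - j ∧ 0 ≤ s.var 9 ∧
      ∀ i : ℤ, |i| < j → s.arr 2 i = 9 * n * i)
    (fun s => (s.var 9).toNat) (by
      rintro s ⟨j, k0, k2, k3, k7, k8, k9, k9', kt⟩ hpos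
      refine ⟨_, reaches_eval tableStep rfl s, ⟨j + 1, ?_, ?_, ?_, ?_, ?_, ?_, ?_, ?_⟩, ?_⟩
      · simp [tableStep, block, eval, Store.set, Store.write, k0]
      · simp [tableStep, block, eval, Store.set, Store.write, k2]
      · simp [tableStep, block, eval, Store.set, Store.write, k3]
      · simp [tableStep, block, eval, Store.set, Store.write, k2, k7]
      · simp [tableStep, block, eval, Store.set, Store.write, k8, k0]
        ring
      · simp [tableStep, block, eval, Store.set, Store.write, k9, k2]
        ring
      · simp [tableStep, block, eval, Store.set, Store.write, k2]
        omega
      · intro i hi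
        simp only [tableStep, block, eval, Store.set, Store.write, k3, k7, k8]
        simp [Function.update_apply, k8, k3]
        split_ifs with h1 h2
        · rw [h1]; ring
        · rw [h2]
        · refine kt i ?_
          rw [abs_lt] at hi ⊢
          push_cast at hi
          omega
      · simp [tableStep, block, eval, Store.set, Store.write, k2]
        omega) s₁ ⟨0, e0, e2, e3, by simp [e7], by simp [e8], by simp [e9], by omega, by
          intro i hi
          have := abs_nonneg i
          push_cast at hi
          omega⟩
  have hv : ∀ x ∈ [5, 6], s'.var x = s₁.var x := fun x hx => hr'.var_eq (by revert x; decide)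
  refine ⟨s', (hr.seq hr').mono ?_, k0, k2, k3, ?_, ?_, ?_, ?_⟩
  · rw [e9]
    have : ((9 * n + 1 : ℤ)).toNat = 9 * n + 1 := by omega
    rw [this]
    ring_nf
    omega
  · rw [hv 5 (by decide), e5]
  · rw [hv 6 (by decide), e6]
  · rw [hr'.arr_eq (by decide), ea]
  · intro i hi
    refine kt i (lt_of_le_of_lt hi ?_)
    linarith

/-! ### The index of the triangles -/

/-- The array with the positions of the left or of the right triangles. -/
def indexArray (r : Bool) : ℕ := if r then 4 else 3

/-- Store the position of one triangle. -/
def indexStep : Prog :=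
  block [load 10 0 7, add 11 7 2, load 12 0 11, add 11 11 2, load 13 0 11,
    sub 10 10 5, load 10 2 10, sub 12 12 6, add 10 10 12, add 14 7 2,
    ite 13 (store 4 10 14) (store 3 10 14)]

/-- The place of a triangle in the index. -/
def key (n : ℕ) (x₀ y₀ : ℤ) (v : Vertex) : ℤ := 9 * n * (v.1 - x₀) + (v.2 - y₀)

/-- The vertices that may be looked up. -/
def InBox (n : ℕ) (x₀ y₀ : ℤ) (v : Vertex) : Prop := |v.1 - x₀| ≤ n + 1 ∧ |v.2 - y₀| ≤ n + 1

/-- In the box the second coordinates differ by at most `2 * n + 2 < 9 * n`, so the key determines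
both coordinates. -/
theorem key_injOn {n : ℕ} (hn : 0 < n) {x₀ y₀ : ℤ} {v w : Vertex} (hv : InBox n x₀ y₀ v)
    (hw : InBox n x₀ y₀ w) (h : key n x₀ y₀ v = key n x₀ y₀ w) : v = w := by
  obtain ⟨x, y⟩ := v
  obtain ⟨x', y'⟩ := w
  simp only [InBox, key, abs_le] at *
  have hn' : (1 : ℤ) ≤ n := by exact_mod_cast hn
  have hx : x = x' := by
    rcases lt_trichotomy x x' with h1 | h1 | h1
    · have : (n : ℤ) * (x' - x) ≥ n * 1 := mul_le_mul_of_nonneg_left (by omega) (by omega)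
      nlinarith
    · exact h1
    · have : (n : ℤ) * (x - x') ≥ n * 1 := mul_le_mul_of_nonneg_left (by omega) (by omega)
      nlinarith
  subst hx
  have : y = y' := by linarith
  rw [this]

/-- The index holds the positions of the first `j` triangles. -/
structure IndexInv (n : ℕ) (T : ℕ → Tri) (j : ℕ) (s : Store) : Prop where
  found : ∀ i < j, s.arr (indexArray (T i).right)
    (key n (T 0).base.1 (T 0).base.2 (T i).base) = 9 * i + 1
  absent : ∀ t : Tri, InBox n (T 0).base.1 (T 0).base.2 t.base → (∀ i < j, T i ≠ t) →
    s.arr (indexArray t.right) (key n (T 0).base.1 (T 0).base.2 t.base) = 0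

theorem indexStep_arr {a : ℤ → ℤ} {n : ℕ} {x₀ y₀ : ℤ} {s : Store} (h : Context a n x₀ y₀ s)
    {t : Tri} (hx : a (s.var 7) = t.base.1) (hy : a (s.var 7 + 1) = t.base.2)
    (hr : a (s.var 7 + 2) = bit (t.right = true)) (ht : |t.base.1 - x₀| ≤ 9 * n) (r : Bool) :
    (indexStep.eval s).arr (indexArray r) = if r = t.right then
      Function.update (s.arr (indexArray r)) (key n x₀ y₀ t.base) (s.var 7 + 1)
      else s.arr (indexArray r) := by
  have h2 : s.var 7 + 1 + 1 = s.var 7 + 2 := by ring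
  simp only [indexStep, block, eval, Store.set, Store.write]
  simp [h.one, h.fst, h.snd, h.input, hx, hy, h2, hr, bit_pos, h.table _ ht]
  cases htr : t.right <;> cases r <;> simp [indexArray, key]

theorem _root_.Calissons.Input.inBox {R : Region} {X : Set Edge} {n : ℕ} {T : ℕ → Tri} {idx : Tri → ℕ} {a : ℤ → ℤ}
    (h : Input R X n T idx a) {t : Tri} (ht : t ∈ R.tris) :
    InBox n (T 0).base.1 (T 0).base.2 t.base := by
  have := h.extent t ht
  exact ⟨by omega, by omega⟩

/-- The index stores the position plus one, so that 0, the initial content of the memory, means that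
the triangle is absent. -/
theorem reaches_index {R : Region} {X : Set Edge} {n : ℕ} {T : ℕ → Tri} {idx : Tri → ℕ}
    {a : ℤ → ℤ} (h : Input R X n T idx a) {s : Store}
    (hs : Context a n (T 0).base.1 (T 0).base.2 s) (h3 : ∀ i, s.arr 3 i = 0)
    (h4 : ∀ i, s.arr 4 i = 0) :
    ∃ s', (forEach indexStep).Reaches s ((indexStep.size + 5) * n + 4) s' ∧
      Context a n (T 0).base.1 (T 0).base.2 s' ∧ IndexInv n T n s' := by
  obtain ⟨s', hr, hc, hi⟩ := reaches_forEach (P := indexStep) (c := indexStep.size) (n := n)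
    (fun j s => Context a n (T 0).base.1 (T 0).base.2 s ∧ IndexInv n T j s)
    (fun j s _ _ _ hI => ⟨⟨hI.1.len, hI.1.one, hI.1.zero, hI.1.fst, hI.1.snd, hI.1.input,
      hI.1.table⟩, ⟨hI.2.found, hI.2.absent⟩⟩)
    (by
      rintro j hj s ⟨hc, hI⟩ h7 h9
      have hmem := h.T_mem j hj
      have hr := reaches_eval indexStep rfl s
      have harr := indexStep_arr hc (t := T j) (by rw [h7]; exact h.fst j hj)
        (by rw [h7]; exact h.snd j hj) (by rw [h7]; exact h.right j hj)
        (by have := (h.extent _ hmem).1; omega)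
      refine ⟨_, hr, ⟨hc.reaches hr (by decide) (by decide), ?_, ?_⟩, hr.var_eq (by decide),
        hr.var_eq (by decide)⟩
      · intro i hi
        rw [harr]
        by_cases hij : i = j
        · rw [if_pos (by rw [hij]), hij, Function.update_self, h7]
        · have hij' : i < j := by omega
          split_ifs with hrr
          · rw [Function.update_of_ne, hI.found i hij']
            intro hk
            have hb := key_injOn h.pos (h.inBox (h.T_mem i (by omega))) (h.inBox hmem) hk
            have : T i = T j := by
              cases hT : T i
              cases hT' : T j
              simp_all
            have h1 := h.idx_T i (by omega)
            rw [this, h.idx_T j hj] at h1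
            exact hij h1.symm
          · exact hI.found i hij'
      · intro t ht hne
        have h0 := hI.absent t ht fun i hi => hne i (by omega)
        rw [harr]
        split_ifs with hrr
        · rw [Function.update_of_ne, h0]
          intro hk
          have hb := key_injOn h.pos ht (h.inBox hmem) hk
          refine hne j (by omega) ?_
          cases t
          cases hT' : T j
          simp_all
        · exact h0)
    s hs.len hs.zero (fun _ _ => ⟨⟨hs.len, hs.one, hs.zero, hs.fst, hs.snd, hs.input,
      hs.table⟩, ⟨fun i hi => absurd hi (Nat.not_lt_zero i), fun t _ _ => by
        cases htr : t.right
        · exact h3 _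
        · exact h4 _⟩⟩)
  exact ⟨s', hr, hc, hi⟩

end Prog
namespace Prog

/-! ### The constraints of a puzzle -/

/-- The position of the neighbour across the side `i`, relative to a left or right triangle. -/
def offset (r : Bool) (i : Fin 3) : ℤ × ℤ :=
  if r then ![(0, 1), (-1, 0), (0, 0)] i else ![(0, -1), (1, 0), (0, 0)] i

theorem nb_base (t : Tri) (i : Fin 3) :
    (t.nb i).base = (t.base.1 + (offset t.right i).1, t.base.2 + (offset t.right i).2) := by
  rw [Tri.nb_eq]
  cases t.right <;> fin_cases i <;> simp [offset] <;> rfl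

/-- The difference of the heights of the two vertices opposite to an imposed edge. -/
def salience (r : Bool) (i : Fin 3) : ℤ :=
  if r then eps (i + 1) - eps (i + 2) else eps (i + 2) - eps (i + 1)

/-- Look up the triangle across side `i`. -/
def lookupNeighbour (r : Bool) (i : Fin 3) : Prog :=
  block [const 30 (offset r i).1, const 31 (offset r i).2, add 30 16 30, add 31 17 31,
    load 30 2 30, add 30 30 31, load 32 (indexArray !r) 30]

/-- Read the marks of side `i`. -/
def lookupMarks (i : Fin 3) : Prog :=
  block [const 31 (6 + (i.val : ℤ)), add 31 7 31, load 33 0 31,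
    const 31 (3 + (i.val : ℤ)), add 31 7 31, load 34 0 31, ite 33 (const 32 0) skip]

/-- Look up the neighbour across side `i`: variable `32` becomes its position plus one if the side
is an inner edge and `0` otherwise, and variable `34` tells whether the side is imposed. -/
def lookup (r : Bool) (i : Fin 3) : Prog :=
  block [lookupNeighbour r i, lookupMarks i]

/-- Compute the minimal increment along the side, and count the side if it is on the boundary. -/
def weight (i : Fin 3) : Prog :=
  block [const 35 (eps i - 1),
    ite 32 (ite 34 (const 35 (eps i)) skip) (block [const 35 (eps i), add 20 20 2])]

/-- Write the constraint that the value at `a` plus variable `35` is at most the value at `d`. -/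
def emit (c : ℤ) (a d b : ℕ) : Prog :=
  block [const 39 c, add 39 39 21, store 5 39 a, store 6 39 d, store 7 39 35, store 8 39 b]

/-- Write the constraints with the neighbour. -/
def gluing (r : Bool) (i : Fin 3) : Prog :=
  block [sub 32 32 2, add 38 32 32, const 36 (i + 1).val, add 36 36 7, const 37 (i + 2).val,
    add 37 37 32, const 35 0, emit (6 * i.val + 2) 36 37 38,
    const 36 (i + 2).val, add 36 36 7, const 37 (i + 1).val, add 37 37 32,
    emit (6 * i.val + 3) 36 37 38,
    ite 34 (block [const 36 i.val, add 36 36 7, const 37 i.val, add 37 37 32,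
      const 35 (salience r i), emit (6 * i.val + 4) 36 37 38]) skip]

/-- Write all constraints of a side. -/
def links (r : Bool) (i : Fin 3) : Prog :=
  block [const 36 (if r then i + 2 else i + 1).val, add 36 36 7,
    const 37 (if r then i + 1 else i + 2).val, add 37 37 7, emit (6 * i.val) 36 37 21,
    const 35 (-eps i), emit (6 * i.val + 1) 37 36 21, ite 32 (gluing r i) skip]

/-- Process the side `i` of a left or right triangle. -/
def side (r : Bool) (i : Fin 3) : Prog := block [lookup r i, weight i, links r i]

/-- Process one triangle. -/
def buildStep : Prog :=
  block [block [load 16 0 7, add 17 7 2, add 13 17 2, load 13 0 13, load 17 0 17, sub 16 16 5,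
      sub 17 17 6],
    ite 13 (block [side true 0, side true 1, side true 2])
      (block [side false 0, side false 1, side false 2]),
    add 44 21 3, push 18]

/-! ### What the constraint-writing programs write. -/

/-- The constraint number `k`. -/
def constraint (s : Store) (k : ℤ) : ℤ × ℤ × ℤ × ℤ :=
  (s.arr 5 k, s.arr 6 k, s.arr 7 k, s.arr 8 k)

theorem constraint_set (s : Store) (x : ℕ) (v : ℤ) : constraint (s.set x v) = constraint s := rfl

theorem emit_constraint (s : Store) (c : ℤ) {a d b : ℕ} (ha : a ≠ 39) (hd : d ≠ 39) (hb : b ≠ 39) :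
    constraint ((emit c a d b).eval s) = Function.update (constraint s) (c + s.var 21)
      (s.var a, s.var d, s.var 35, s.var b) := by
  funext k
  simp only [constraint, emit, block, eval, Store.set, Store.write]
  simp [ha, hd, hb, Function.update_apply]
  split_ifs <;> rfl

theorem emit_var (s : Store) (c : ℤ) (a d b : ℕ) {x : ℕ} (hx : x ≠ 39) :
    ((emit c a d b).eval s).var x = s.var x :=
  eval_var rfl s (by simp [emit, block, writes, hx])

theorem set_var (s : Store) (x y : ℕ) (v : ℤ) :
    (s.set x v).var y = if y = x then v else s.var y := by
  simp [Store.set, Function.update_apply]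

theorem lookup_eval {a : ℤ → ℤ} {n : ℕ} {x₀ y₀ : ℤ} {s : Store} (h : Context a n x₀ y₀ s)
    {r : Bool} {i : Fin 3} {v : Vertex} (hx : s.var 16 + (offset r i).1 = v.1 - x₀)
    (hy : s.var 17 + (offset r i).2 = v.2 - y₀) (hv : |v.1 - x₀| ≤ 9 * n) :
    ((lookup r i).eval s).var 32 = (if 0 < a (s.var 7 + (6 + (i.val : ℤ))) then 0 else
      s.arr (indexArray !r) (key n x₀ y₀ v)) ∧
    ((lookup r i).eval s).var 34 = a (s.var 7 + (3 + (i.val : ℤ))) := by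
  have ht := h.table _ hv
  obtain ⟨s₁, hs₁⟩ : ∃ s₁, s₁ = (lookupNeighbour r i).eval s := ⟨_, rfl⟩
  have he : (lookup r i).eval s = (lookupMarks i).eval s₁ := by rw [hs₁]; rfl
  have e32 : s₁.var 32 = s.arr (indexArray !r) (key n x₀ y₀ v) := by
    simp [hs₁, lookupNeighbour, block, eval, Store.set, hx, hy, ht, key]
  have e7 : s₁.var 7 = s.var 7 := by simp [hs₁, lookupNeighbour, block, eval, Store.set]
  have ea : s₁.arr 0 = a := by rw [← h.input, hs₁]; rfl
  rw [he, ← e32, ← e7]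
  clear he hs₁
  simp only [lookupMarks, block, eval]
  by_cases h1 : 0 < a (s₁.var 7 + (6 + (i.val : ℤ))) <;> simp [Store.set, ea, h1]

theorem weight_eval (i : Fin 3) (s : Store) (h2 : s.var 2 = 1) :
    ((weight i).eval s).var 35 =
      (if 0 < s.var 32 ∧ ¬ 0 < s.var 34 then eps i - 1 else eps i) ∧
    ((weight i).eval s).var 20 = (if 0 < s.var 32 then s.var 20 else s.var 20 + 1) := by
  simp only [weight, block, eval, Store.set]
  simp only [Function.update_apply]
  by_cases h : 0 < s.var 32 <;> by_cases h' : 0 < s.var 34 <;> simp [h, h', h2]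

theorem gluing_eval (r : Bool) (i : Fin 3) {s : Store} (h2 : s.var 2 = 1) (k : ℤ) :
    constraint ((gluing r i).eval s) k =
      if k = 6 * i.val + 4 + s.var 21 ∧ 0 < s.var 34 then
        (i.val + s.var 7, i.val + (s.var 32 - 1), salience r i,
          (s.var 32 - 1) + (s.var 32 - 1))
      else if k = 6 * i.val + 3 + s.var 21 then
        ((i + 2).val + s.var 7, (i + 1).val + (s.var 32 - 1), 0, (s.var 32 - 1) + (s.var 32 - 1))
      else if k = 6 * i.val + 2 + s.var 21 then
        ((i + 1).val + s.var 7, (i + 2).val + (s.var 32 - 1), 0, (s.var 32 - 1) + (s.var 32 - 1))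
      else constraint s k := by
  simp only [gluing, block, eval]
  by_cases h' : 0 < s.var 34 <;>
    simp [emit_constraint, emit_var, set_var, constraint_set, h2, Function.update_apply, h']

theorem links_eval (r : Bool) (i : Fin 3) {s : Store} (h2 : s.var 2 = 1) (k : ℤ) :
    constraint ((links r i).eval s) k =
      if k = 6 * i.val + 4 + s.var 21 ∧ 0 < s.var 32 ∧ 0 < s.var 34 then
        (i.val + s.var 7, i.val + (s.var 32 - 1), salience r i, (s.var 32 - 1) + (s.var 32 - 1))
      else if k = 6 * i.val + 3 + s.var 21 ∧ 0 < s.var 32 then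
        ((i + 2).val + s.var 7, (i + 1).val + (s.var 32 - 1), 0, (s.var 32 - 1) + (s.var 32 - 1))
      else if k = 6 * i.val + 2 + s.var 21 ∧ 0 < s.var 32 then
        ((i + 1).val + s.var 7, (i + 2).val + (s.var 32 - 1), 0, (s.var 32 - 1) + (s.var 32 - 1))
      else if k = 6 * i.val + 1 + s.var 21 then
        ((if r then i + 1 else i + 2).val + s.var 7, (if r then i + 2 else i + 1).val + s.var 7,
          -eps i, s.var 21)
      else if k = 6 * i.val + s.var 21 then
        ((if r then i + 2 else i + 1).val + s.var 7, (if r then i + 1 else i + 2).val + s.var 7,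
          s.var 35, s.var 21)
      else constraint s k := by
  simp only [links, block, eval]
  by_cases h : 0 < s.var 32 <;>
    simp [emit_constraint, emit_var, set_var, constraint_set, Function.update_apply, h,
      gluing_eval, h2]

/-! ### Correctness of the constraint table. -/

section Build

variable {R : Region} {X : Set Edge} {n : ℕ} {T : ℕ → Tri} {idx : Tri → ℕ} {a : ℤ → ℤ}

open Classical in
/-- The constraints of the side `i` of the triangle `T j`. -/
noncomputable def slot (R : Region) (X : Set Edge) (T : ℕ → Tri) (idx : Tri → ℕ) (j : ℕ)
    (i : Fin 3) : ℕ → ℤ × ℤ × ℤ × ℤ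
  | 0 => (((T j).bot i).val + 9 * j, ((T j).top i).val + 9 * j,
      if R.Inner ((T j).side i) ∧ (T j).side i ∉ X then eps i - 1 else eps i, 18 * j)
  | 1 => (((T j).top i).val + 9 * j, ((T j).bot i).val + 9 * j, -eps i, 18 * j)
  | 2 => if R.Inner ((T j).side i) then
      ((i + 1).val + 9 * j, (i + 2).val + 9 * idx ((T j).nb i), 0, 18 * idx ((T j).nb i)) else 0
  | 3 => if R.Inner ((T j).side i) then
      ((i + 2).val + 9 * j, (i + 1).val + 9 * idx ((T j).nb i), 0, 18 * idx ((T j).nb i)) else 0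
  | 4 => if R.Inner ((T j).side i) ∧ (T j).side i ∈ X then
      (i.val + 9 * j, i.val + 9 * idx ((T j).nb i), salience (T j).right i,
        18 * idx ((T j).nb i)) else 0
  | _ => 0

open Classical in
/-- The constraints of the first `m` sides have been written. -/
structure SideInv (R : Region) (X : Set Edge) (T : ℕ → Tri) (idx : Tri → ℕ) (m : ℕ) (s : Store) :
    Prop where
  slots : ∀ (j : ℕ) (i : Fin 3) (c : ℕ), 3 * j + i.val < m → c < 6 →
    constraint s (18 * j + 6 * i.val + c) = slot R X T idx j i c
  zero : ∀ k : ℤ, 6 * m ≤ k → constraint s k = 0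
  count : s.var 20 = ((Finset.range m).filter fun d =>
    ¬ R.Inner ((T (d / 3)).side (Fin.ofNat 3 d))).card

/-- What is known while the sides of the triangle `T j` are processed. -/
structure TriInv (n : ℕ) (T : ℕ → Tri) (a : ℤ → ℤ) (j : ℕ) (s : Store) : Prop where
  context : Context a n (T 0).base.1 (T 0).base.2 s
  index : IndexInv n T n s
  position : s.var 7 = 9 * j
  block : s.var 21 = 18 * j
  fst : s.var 16 = (T j).base.1 - (T 0).base.1
  snd : s.var 17 = (T j).base.2 - (T 0).base.2

theorem IndexInv.frame {j : ℕ} {s s' : Store} (h : IndexInv n T j s) (h3 : s'.arr 3 = s.arr 3)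
    (h4 : s'.arr 4 = s.arr 4) : IndexInv n T j s' := by
  have : ∀ r, s'.arr (indexArray r) = s.arr (indexArray r) := by
    intro r; cases r
    · exact h3
    · exact h4
  exact ⟨fun i hi => by rw [this, h.found i hi], fun t ht hne => by rw [this, h.absent t ht hne]⟩

theorem TriInv.eval {j : ℕ} {s : Store} (h : TriInv n T a j s) {P : Prog}
    (hP : P.loopFree = true) (hv : ∀ x ∈ [0, 2, 3, 5, 6, 7, 21, 16, 17], x ∉ P.writes)
    (ha : ∀ A ∈ [0, 2, 3, 4], A ∉ P.stores) : TriInv n T a j (P.eval s) := by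
  have hv' : ∀ x ∈ [0, 2, 3, 5, 6, 7, 21, 16, 17], (P.eval s).var x = s.var x :=
    fun x hx => eval_var hP s (hv x hx)
  have ha' : ∀ A ∈ [0, 2, 3, 4], (P.eval s).arr A = s.arr A :=
    fun A hA => eval_arr hP s (ha A hA)
  refine ⟨h.context.frame (fun x hx => hv' x ?_) (fun A hA => ha' A ?_),
    h.index.frame (ha' 3 (by decide)) (ha' 4 (by decide)), ?_, ?_, ?_, ?_⟩
  · revert x; decide
  · revert A; decide
  · rw [hv' 7 (by decide), h.position]
  · rw [hv' 21 (by decide), h.block]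
  · rw [hv' 16 (by decide), h.fst]
  · rw [hv' 17 (by decide), h.snd]

theorem lookup_spec (h : Input R X n T idx a) {j : ℕ} (hj : j < n) {s : Store}
    (hs : TriInv n T a j s) (i : Fin 3) :
    ((lookup (T j).right i).eval s).var 32 =
      (open Classical in if R.Inner ((T j).side i) then 9 * (idx ((T j).nb i) : ℤ) + 1 else 0) ∧
    (0 < ((lookup (T j).right i).eval s).var 34 ↔ (T j).side i ∈ X) := by
  have hmem := h.T_mem j hj
  have hoff : |(offset (T j).right i).1| ≤ 1 ∧ |(offset (T j).right i).2| ≤ 1 := by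
    generalize (T j).right = r
    revert r i; decide
  have hext := h.extent _ hmem
  have hpos := h.pos
  -- The neighbour may lie outside the region, but it is still in the box where absence is recorded
  -- faithfully.
  have hbox : InBox n (T 0).base.1 (T 0).base.2 ((T j).nb i).base := by
    rw [nb_base]
    simp only [InBox, abs_le] at *
    omega
  obtain ⟨h1, h2⟩ := lookup_eval hs.context (r := (T j).right) (i := i) (v := ((T j).nb i).base)
    (by rw [hs.fst, nb_base]; ring) (by rw [hs.snd, nb_base]; ring)
    (by have := hbox.1; omega)
  rw [hs.position] at h1 h2
  simp only [h.slit j hj, bit_pos, ← Tri.nb_right _ i] at h1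
  rw [h.imposed j hj] at h2
  rw [h1, h2, bit_pos]
  refine ⟨?_, Iff.rfl⟩
  simp only [Region.inner_side]
  by_cases hsl : (T j).side i ∈ R.slits
  · simp [hsl]
  · by_cases hnb : (T j).nb i ∈ R.tris
    · have := hs.index.found _ (h.idx_lt _ hnb)
      rw [h.T_idx _ hnb] at this
      simp [hsl, hnb, hmem, this]
    · have := hs.index.absent _ hbox (fun i' hi' heq => hnb (heq ▸ h.T_mem i' hi'))
      simp [hsl, hnb, this]

theorem side_spec (h : Input R X n T idx a) {j : ℕ} (hj : j < n) {s : Store}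
    (hs : TriInv n T a j s) (i : Fin 3) (hI : SideInv R X T idx (3 * j + i.val) s) :
    TriInv n T a j ((side (T j).right i).eval s) ∧
      SideInv R X T idx (3 * j + i.val + 1) ((side (T j).right i).eval s) := by
  classical
  have hT : ∀ r i, (side r i).loopFree = true ∧
      (∀ x ∈ [0, 2, 3, 5, 6, 7, 21, 16, 17], x ∉ (side r i).writes) ∧
      (∀ A ∈ [0, 2, 3, 4], A ∉ (side r i).stores) := by decide
  obtain ⟨hT1, hT2, hT3⟩ := hT (T j).right i
  refine ⟨hs.eval hT1 hT2 hT3, ?_⟩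
  obtain ⟨s₁, hs₁⟩ : ∃ s₁, s₁ = (lookup (T j).right i).eval s := ⟨_, rfl⟩
  obtain ⟨s₂, hs₂⟩ : ∃ s₂, s₂ = (weight i).eval s₁ := ⟨_, rfl⟩
  have he : (side (T j).right i).eval s = (links (T j).right i).eval s₂ := by
    rw [hs₂, hs₁]; rfl
  obtain ⟨l32, l34⟩ := lookup_spec h hj hs i
  rw [← hs₁] at l32 l34
  have hl : ∀ r i, (lookup r i).loopFree = true ∧
      (∀ x ∈ [2, 7, 20, 21], x ∉ (lookup r i).writes) ∧
      (∀ A ∈ [5, 6, 7, 8], A ∉ (lookup r i).stores) := by decide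
  obtain ⟨hl1, hl2, hl3⟩ := hl (T j).right i
  have v₁ : ∀ x ∈ [2, 7, 20, 21], s₁.var x = s.var x :=
    fun x hx => hs₁ ▸ eval_var hl1 s (hl2 x hx)
  have a₁ : ∀ A ∈ [5, 6, 7, 8], s₁.arr A = s.arr A :=
    fun A hA => hs₁ ▸ eval_arr hl1 s (hl3 A hA)
  have hw : ∀ i, (weight i).loopFree = true ∧
      (∀ x ∈ [2, 7, 21, 32, 34], x ∉ (weight i).writes) ∧
      (∀ A ∈ [5, 6, 7, 8], A ∉ (weight i).stores) := by decide
  obtain ⟨hw1, hw2, hw3⟩ := hw i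
  have v₂ : ∀ x ∈ [2, 7, 21, 32, 34], s₂.var x = s₁.var x :=
    fun x hx => hs₂ ▸ eval_var hw1 s₁ (hw2 x hx)
  have a₂ : ∀ A ∈ [5, 6, 7, 8], s₂.arr A = s₁.arr A :=
    fun A hA => hs₂ ▸ eval_arr hw1 s₁ (hw3 A hA)
  have e2 : s₁.var 2 = 1 := by rw [v₁ 2 (by decide), hs.context.one]
  have f2 : s₂.var 2 = 1 := by rw [v₂ 2 (by decide), e2]
  obtain ⟨w35, w20⟩ := weight_eval i s₁ e2
  rw [← hs₂] at w35 w20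
  rw [v₁ 20 (by decide)] at w20
  have hpos : 0 < s₁.var 32 ↔ R.Inner ((T j).side i) := by
    rw [l32]
    split_ifs with hi <;> simp [hi]
  simp only [hpos, l34] at w35 w20
  have hc : constraint s₂ = constraint s := by
    funext k
    simp only [constraint]
    rw [a₂ 5 (by decide), a₂ 6 (by decide), a₂ 7 (by decide), a₂ 8 (by decide),
      a₁ 5 (by decide), a₁ 6 (by decide), a₁ 7 (by decide), a₁ 8 (by decide)]
  have key := links_eval (T j).right i f2
  simp only [v₂ 32 (by decide), v₂ 34 (by decide), v₂ 7 (by decide), v₂ 21 (by decide), hpos, l34,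
    v₁ 7 (by decide), v₁ 21 (by decide), hs.position, hs.block, hc, w35, ← he] at key
  have e20 : ((side (T j).right i).eval s).var 20 = s₂.var 20 := by
    rw [he]
    have hk : ∀ r i, (links r i).loopFree = true ∧ 20 ∉ (links r i).writes := by decide
    exact eval_var (hk _ _).1 _ (hk _ _).2
  rw [w20] at e20
  clear w35 w20 hc he v₁ v₂ a₁ a₂ hs₁ hs₂ hT1 hT2 hT3 hl hl1 hl2 hl3 hw hw1 hw2 hw3
  generalize (side (T j).right i).eval s = s' at *
  have hi3 := i.isLt
  refine ⟨?_, ?_, ?_⟩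
  · intro j' i' c hlt hc
    have hi3' := i'.isLt
    rw [key]
    by_cases heq : 3 * j' + i'.val = 3 * j + i.val
    · have hj' : j' = j := by omega
      have hi' : i' = i := Fin.ext (by omega)
      subst hj' hi'
      have h0 := hI.zero (18 * j' + 6 * i'.val + c) (by push_cast; omega)
      have q : ∀ d : ℤ, (18 * (j' : ℤ) + 6 * (i'.val : ℤ) + c = 6 * i'.val + d + 18 * j') ↔
          (c : ℤ) = d := fun d => by constructor <;> intro h <;> linarith
      have q0 : (18 * (j' : ℤ) + 6 * (i'.val : ℤ) + c = 6 * i'.val + 18 * j') ↔ (c : ℤ) = 0 := by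
        constructor <;> intro h <;> linarith
      simp only [q, q0, l32, h0]
      by_cases hin : R.Inner ((T j').side i') <;> by_cases hX : (T j').side i' ∈ X <;>
        interval_cases c <;> simp [slot, Tri.bot, Tri.top, hin, hX] <;> omega
    · have h1 := hI.slots j' i' c (by omega) hc
      split_ifs <;> omega
  · intro k hk
    have h1 := hI.zero k (by push_cast at hk ⊢; omega)
    rw [key]
    push_cast at hk
    split_ifs <;> omega
  · have hd : (3 * j + i.val) / 3 = j := by omega
    have hm : Fin.ofNat 3 (3 * j + i.val) = i := Fin.ext (by simp [Fin.ofNat])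
    rw [e20, Finset.range_add_one, Finset.filter_insert, hI.count, hd, hm]
    by_cases hin : R.Inner ((T j).side i)
    · simp [hin]
    · simp [hin]

end Build
end Prog
namespace Prog

variable {R : Region} {X : Set Edge} {n : ℕ} {T : ℕ → Tri} {idx : Tri → ℕ} {a : ℤ → ℤ}

theorem SideInv.frame {m : ℕ} {s s' : Store} (h : SideInv R X T idx m s)
    (hc : constraint s' = constraint s) (h20 : s'.var 20 = s.var 20) :
    SideInv R X T idx m s' :=
  ⟨fun j i c => by rw [hc]; exact h.slots j i c, by rw [hc]; exact h.zero, by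
    rw [h20]; exact h.count⟩

/-- The constraints of the first `j` triangles have been written and pushed on the stack. -/
structure BuildInv (R : Region) (X : Set Edge) (n : ℕ) (T : ℕ → Tri) (idx : Tri → ℕ) (a : ℤ → ℤ)
    (j : ℕ) (s : Store) : Prop where
  context : Context a n (T 0).base.1 (T 0).base.2 s
  index : IndexInv n T n s
  sides : SideInv R X T idx (3 * j) s
  height : s.var 21 = 18 * j
  stack : ∀ i : ℤ, 0 ≤ i → i < 18 * j → s.arr 10 i = i

theorem sides_spec (h : Input R X n T idx a) {j : ℕ} (hj : j < n) {s : Store}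
    (hs : TriInv n T a j s) (hI : SideInv R X T idx (3 * j) s) {r : Bool} (hr : r = (T j).right) :
    TriInv n T a j ((block [side r 0, side r 1, side r 2]).eval s) ∧
      SideInv R X T idx (3 * (j + 1)) ((block [side r 0, side r 1, side r 2]).eval s) := by
  subst hr
  obtain ⟨h1, k1⟩ := side_spec h hj hs 0 hI
  obtain ⟨h2, k2⟩ := side_spec h hj h1 1 k1
  exact side_spec h hj h2 2 k2

theorem buildStep_loopFree : buildStep.loopFree = true := by
  simp [buildStep, loopFree, push_loopFree, block]
  decide

theorem buildStep_spec (h : Input R X n T idx a) {j : ℕ} (hj : j < n) {s : Store}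
    (hI : BuildInv R X n T idx a j s) (h7 : s.var 7 = 9 * j) :
    BuildInv R X n T idx a (j + 1) (buildStep.eval s) ∧
      (buildStep.eval s).var 7 = s.var 7 ∧ (buildStep.eval s).var 9 = s.var 9 := by
  obtain ⟨P₁, hP₁⟩ : ∃ P₁, P₁ = block [load 16 0 7, add 17 7 2, add 13 17 2, load 13 0 13,
    load 17 0 17, sub 16 16 5, sub 17 17 6] := ⟨_, rfl⟩
  obtain ⟨s₁, hs₁⟩ : ∃ s₁, s₁ = P₁.eval s := ⟨_, rfl⟩
  have hc := hI.context
  have hr₁ : P₁.Reaches s P₁.size s₁ := hs₁ ▸ reaches_eval _ (by rw [hP₁]; rfl) s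
  have t1 : TriInv n T a j s₁ := by
    refine ⟨hc.reaches hr₁ (by rw [hP₁]; decide) (by rw [hP₁]; decide),
      hI.index.frame (hr₁.arr_eq (by rw [hP₁]; decide)) (hr₁.arr_eq (by rw [hP₁]; decide)), ?_, ?_,
      ?_, ?_⟩
    · rw [hr₁.var_eq (by rw [hP₁]; decide), h7]
    · rw [hr₁.var_eq (by rw [hP₁]; decide), hI.height]
    · simp [hs₁, hP₁, block, eval, Store.set, hc.one, hc.fst, hc.input, h7, h.fst j hj]
    · simp [hs₁, hP₁, block, eval, Store.set, hc.one, hc.snd, hc.input, h7, h.snd j hj]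
  have c1 : SideInv R X T idx (3 * j) s₁ := by
    refine hI.sides.frame ?_ (hr₁.var_eq (by rw [hP₁]; decide))
    funext k
    simp only [constraint]
    rw [hr₁.arr_eq (by rw [hP₁]; decide), hr₁.arr_eq (by rw [hP₁]; decide),
      hr₁.arr_eq (by rw [hP₁]; decide), hr₁.arr_eq (by rw [hP₁]; decide)]
  have e13 : 0 < s₁.var 13 ↔ (T j).right = true := by
    have h2 : (9 * j + 1 + 1 : ℤ) = 9 * j + 2 := by ring
    simp [hs₁, hP₁, block, eval, Store.set, hc.one, hc.input, h7, h2, h.right j hj, bit_pos]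
  have e10 : s₁.arr 10 = s.arr 10 := hr₁.arr_eq (by rw [hP₁]; decide)
  have e9 : s₁.var 9 = s.var 9 := hr₁.var_eq (by rw [hP₁]; decide)
  obtain ⟨P₂, hP₂⟩ : ∃ P₂, P₂ = ite 13 (block [side true 0, side true 1, side true 2])
    (block [side false 0, side false 1, side false 2]) := ⟨_, rfl⟩
  obtain ⟨s₂, hs₂⟩ : ∃ s₂, s₂ = P₂.eval s₁ := ⟨_, rfl⟩
  have hr₂ : P₂.Reaches s₁ P₂.size s₂ := hs₂ ▸ reaches_eval _ (by rw [hP₂]; decide) s₁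
  obtain ⟨t2, c2⟩ : TriInv n T a j s₂ ∧ SideInv R X T idx (3 * (j + 1)) s₂ := by
    rw [hs₂, hP₂]
    by_cases hr : (T j).right = true
    · rw [eval, if_pos (e13.2 hr)]
      exact sides_spec h hj t1 c1 hr.symm
    · rw [eval, if_neg (fun h => hr (e13.1 h))]
      exact sides_spec h hj t1 c1 (by simpa using hr)
  have f10 : s₂.arr 10 = s₁.arr 10 := hr₂.arr_eq (by rw [hP₂]; decide)
  have f9 : s₂.var 9 = s₁.var 9 := hr₂.var_eq (by rw [hP₂]; decide)
  obtain ⟨s₃, hs₃⟩ : ∃ s₃, s₃ = s₂.set 44 (s₂.var 21 + s₂.var 3) := ⟨_, rfl⟩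
  have he : buildStep.eval s = (push 18).eval s₃ := by
    rw [hs₃, hs₂, hs₁, hP₂, hP₁]; rfl
  have g44 : s₃.var 44 = 18 * j := by
    simp [hs₃, Store.set, t2.block, t2.context.zero]
  have gv : ∀ x, x ≠ 44 → s₃.var x = s₂.var x := fun x hx => by simp [hs₃, Store.set, hx]
  have ga : s₃.arr = s₂.arr := by rw [hs₃]; rfl
  obtain ⟨p1, -, p3⟩ := push_eval 18 s₃ (by rw [gv 2 (by decide), t2.context.one])
  have pv : ∀ x, x ≠ 21 → x ≠ 44 → ((push 18).eval s₃).var x = s₂.var x := fun x h1 h2 => by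
    rw [push_var _ _ h1 h2, gv x h2]
  have pa : ∀ A, A ≠ 10 → ((push 18).eval s₃).arr A = s₂.arr A := fun A h1 => by
    rw [push_arr _ _ h1, ga]
  rw [gv 21 (by decide), t2.block] at p1 p3
  rw [he]
  refine ⟨⟨t2.context.frame (fun x hx => pv x ?_ ?_) (fun A hA => pa A ?_),
    t2.index.frame (pa 3 (by decide)) (pa 4 (by decide)),
    c2.frame ?_ (pv 20 (by decide) (by decide)), ?_, ?_⟩, ?_, ?_⟩
  · rintro rfl; revert hx; decide
  · rintro rfl; revert hx; decide
  · rintro rfl; revert hA; decide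
  · funext k
    simp only [constraint]
    rw [pa 5 (by decide), pa 6 (by decide), pa 7 (by decide), pa 8 (by decide)]
  · rw [p1]; push_cast; ring
  · intro i h0 h1
    rw [p3, g44, ga, f10, e10]
    split_ifs with hi
    · ring
    · exact hI.stack i h0 (by push_cast at h1 hi; omega)
  · rw [pv 7 (by decide) (by decide), t2.position, h7]
  · rw [pv 9 (by decide) (by decide), f9, e9]

theorem reaches_build (h : Input R X n T idx a) {s : Store}
    (hs : Context a n (T 0).base.1 (T 0).base.2 s) (hi : IndexInv n T n s)
    (h20 : s.var 20 = 0) (h21 : s.var 21 = 0) (hc : ∀ A ∈ [5, 6, 7, 8], ∀ k, s.arr A k = 0) :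
    ∃ s', (forEach buildStep).Reaches s ((buildStep.size + 5) * n + 4) s' ∧
      BuildInv R X n T idx a n s' := by
  refine reaches_forEach (P := buildStep) (c := buildStep.size) (n := n)
    (BuildInv R X n T idx a)
    (fun j s _ _ _ hI => ⟨⟨hI.context.len, hI.context.one, hI.context.zero, hI.context.fst,
      hI.context.snd, hI.context.input, hI.context.table⟩, hI.index.frame rfl rfl,
      hI.sides.frame rfl rfl, hI.height, hI.stack⟩)
    (fun j hj s hI h7 _ => ⟨_, reaches_eval _ buildStep_loopFree s, buildStep_spec h hj hI h7⟩)
    s hs.len hs.zero (fun _ _ => ⟨⟨hs.len, hs.one, hs.zero, hs.fst, hs.snd, hs.input,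
      hs.table⟩, hi.frame rfl rfl, ⟨fun j i c hlt => by omega, fun k _ => ?_, ?_⟩, ?_, ?_⟩)
  · simp only [constraint, Store.set]
    rw [hc 5 (by decide), hc 6 (by decide), hc 7 (by decide), hc 8 (by decide)]
    rfl
  · simpa [Store.set] using h20
  · simpa [Store.set] using h21
  · intro i h0 h1
    simp at h1
    omega

/-! ### The constraints describe the heights -/

/-- Corner `c` of triangle `j` is stored in cell `9 * j + c`, after its place in the input, so
doubling the position gives the start `18 * j` of its constraints. An unused slot is 0: the trivial
constraint from cell 0 to itself. -/
theorem slot_cases (h : Input R X n T idx a) {j : ℕ} (hj : j < n) (i : Fin 3) {c : ℕ} (hc : c < 6) :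
    (slot R X T idx j i c = 0 ∨
      (9 * (j : ℤ) ≤ (slot R X T idx j i c).1 ∧ (slot R X T idx j i c).1 < 9 * j + 3)) ∧
    ∃ j' < n, (slot R X T idx j i c).2.2.2 = 18 * (j' : ℤ) ∧
      9 * (j' : ℤ) ≤ (slot R X T idx j i c).2.1 ∧ (slot R X T idx j i c).2.1 < 9 * j' + 3 := by
  have hb : ∀ i : Fin 3, ((i.val : ℕ) : ℤ) < 3 := fun i => by exact_mod_cast i.isLt
  have hnb : R.Inner ((T j).side i) → idx ((T j).nb i) < n :=
    fun hi => h.idx_lt _ ((Region.inner_side _ _).1 hi).2.2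
  have own : ∀ i : Fin 3, 9 * (j : ℤ) ≤ i.val + 9 * j ∧ (i.val : ℤ) + 9 * j < 9 * j + 3 :=
    fun i => by have := hb i; omega
  have other : ∀ (i : Fin 3) (k : ℕ), 9 * (k : ℤ) ≤ i.val + 9 * k ∧ (i.val : ℤ) + 9 * k < 9 * k + 3 :=
    fun i k => by have := hb i; omega
  have hpos := h.pos
  have zero : ∃ j' < n, (0 : ℤ) = 18 * (j' : ℤ) ∧ 9 * (j' : ℤ) ≤ 0 ∧ (0 : ℤ) < 9 * j' + 3 :=
    ⟨0, hpos, by simp⟩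
  interval_cases c
  · exact ⟨Or.inr (own _), j, hj, rfl, own _⟩
  · exact ⟨Or.inr (own _), j, hj, rfl, own _⟩
  · simp only [slot]
    split_ifs with hi
    · exact ⟨Or.inr (own _), _, hnb hi, rfl, other _ _⟩
    · exact ⟨Or.inl rfl, zero⟩
  · simp only [slot]
    split_ifs with hi
    · exact ⟨Or.inr (own _), _, hnb hi, rfl, other _ _⟩
    · exact ⟨Or.inl rfl, zero⟩
  · simp only [slot]
    split_ifs with hi
    · exact ⟨Or.inr (own _), _, hnb hi.1, rfl, other _ _⟩
    · exact ⟨Or.inl rfl, zero⟩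
  · exact ⟨Or.inl rfl, zero⟩

theorem SideInv.exists_slot {s : Store} (hI : SideInv R X T idx (3 * n) s) {k : ℤ} (h0 : 0 ≤ k)
    (h1 : k < (18 * n : ℕ)) : ∃ (j : ℕ) (i : Fin 3) (c : ℕ), j < n ∧ c < 6 ∧
      k = 18 * j + 6 * i.val + c ∧ constraint s k = slot R X T idx j i c := by
  push_cast at h1
  have hk : k = 18 * ((k / 18).toNat : ℕ) + 6 * ((k % 18 / 6).toNat : ℕ) +
      ((k % 6).toNat : ℕ) := by omega
  have hj : (k / 18).toNat < n := by omega
  have hi : (k % 18 / 6).toNat < 3 := by omega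
  have hc : (k % 6).toNat < 6 := by omega
  refine ⟨(k / 18).toNat, ⟨(k % 18 / 6).toNat, hi⟩, (k % 6).toNat, hj, hc, hk, ?_⟩
  rw [← hI.slots _ _ _ (by simp only; omega) hc]
  congr 1

/-- The nontrivial constraints whose source is a corner of a given triangle all lie in the block of
that triangle, and the fourth component records the block of the target. -/
theorem SideInv.isSystem (h : Input R X n T idx a) {s : Store}
    (hI : SideInv R X T idx (3 * n) s) :
    IsSystem (9 * n) (18 * n) (s.arr 5) (s.arr 6) (s.arr 7) (s.arr 8) := by
  have e5 : ∀ k, s.arr 5 k = (constraint s k).1 := fun _ => rfl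
  have e6 : ∀ k, s.arr 6 k = (constraint s k).2.1 := fun _ => rfl
  have e7 : ∀ k, s.arr 7 k = (constraint s k).2.2.1 := fun _ => rfl
  have e8 : ∀ k, s.arr 8 k = (constraint s k).2.2.2 := fun _ => rfl
  have hpos := h.pos
  refine ⟨?_, ?_, ?_, ?_⟩
  · intro k h0 h1
    obtain ⟨j, i, c, hj, hc, -, hs⟩ := hI.exists_slot h0 h1
    obtain ⟨-, j', hj', -, h2, h3⟩ := slot_cases h hj i hc
    rw [e6, hs]
    omega
  · intro k h0 h1
    obtain ⟨j, i, c, hj, hc, -, hs⟩ := hI.exists_slot h0 h1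
    obtain ⟨h2 | h2, -⟩ := slot_cases h hj i hc
    · rw [e5, hs, h2]
      simpa using hpos
    · rw [e5, hs]
      omega
  · intro k h0 h1
    obtain ⟨j, i, c, hj, hc, -, hs⟩ := hI.exists_slot h0 h1
    obtain ⟨-, j', hj', h2, -⟩ := slot_cases h hj i hc
    rw [e8, hs]
    omega
  · intro k h0 h1 k' h0' h1' heq
    obtain ⟨j, i, c, hj, hc, -, hs⟩ := hI.exists_slot h0 h1
    obtain ⟨-, j₁, hj₁, h2, h3, h4⟩ := slot_cases h hj i hc
    obtain ⟨j', i', c', hj', hc', hk', hs'⟩ := hI.exists_slot h0' h1'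
    have hi' := i'.isLt
    rw [e5, e6, hs, hs'] at heq
    rw [e8, e5, e6, e7, hs, hs']
    obtain ⟨h5 | h5, -⟩ := slot_cases h hj' i' hc'
    · right
      rw [h5]
      exact ⟨rfl, rfl⟩
    · left
      omega

/-- Values that satisfy the constraints are heights. -/
theorem SideInv.isHeight (h : Input R X n T idx a) {s : Store}
    (hI : SideInv R X T idx (3 * n) s) {G : ℤ → ℤ}
    (hG : Satisfies (18 * n) (s.arr 5) (s.arr 6) (s.arr 7) G) :
    IsHeight R X fun t j => G (j.val + 9 * idx t) := by
  have key : ∀ t ∈ R.tris, ∀ (i : Fin 3) (c : ℕ), c < 6 →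
      G (slot R X T idx (idx t) i c).1 + (slot R X T idx (idx t) i c).2.2.1 ≤
        G (slot R X T idx (idx t) i c).2.1 := by
    intro t ht i c hc
    have hlt := h.idx_lt t ht
    have hi := i.isLt
    have := hG (18 * idx t + 6 * i.val + c) (by omega) (by push_cast; omega)
    rw [← hI.slots (idx t) i c (by omega) hc]
    exact this
  refine ⟨?_, ?_, ?_, ?_, ?_⟩
  · intro t ht i
    have := key t ht i 0 (by decide)
    simp only [slot, h.T_idx t ht] at this
    split_ifs at this <;> linarith
  · intro t ht i
    have := key t ht i 1 (by decide)
    simp only [slot, h.T_idx t ht] at this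
    linarith
  · intro t ht i hi
    have := key t ht i 0 (by decide)
    simp only [slot, h.T_idx t ht] at this
    rw [if_neg (by rw [h.T_idx t ht]; tauto)] at this
    linarith
  · intro t i hi
    have hm := (Region.inner_side t i).1 hi
    -- Slot 2 here and slot 3 of the neighbour are opposite inequalities, which together give
    -- equality. The two slots 4 do the same for salience below.
    have h1 := key t hm.2.1 i 2 (by decide)
    have h2 := key _ hm.2.2 i 3 (by decide)
    simp only [slot, h.T_idx _ hm.2.1, h.T_idx _ hm.2.2, Tri.nb_side, Tri.nb_nb, hi,
      if_true, add_zero] at h1 h2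
    linarith
  · intro t i hr hi hX
    have hm := (Region.inner_side t i).1 hi
    have h1 := key t hm.2.1 i 4 (by decide)
    have h2 := key _ hm.2.2 i 4 (by decide)
    simp only [slot, h.T_idx _ hm.2.1, h.T_idx _ hm.2.2, Tri.nb_side, Tri.nb_nb, hi, hX, and_self,
      if_true, salience, Tri.nb_right, hr, Bool.not_false, Bool.false_eq_true, if_false] at h1 h2
    linarith

/-- Heights of a solution give bounded values that satisfy the constraints. -/
theorem SideInv.exists_boundedSolution (h : Input R X n T idx a) (hR : R.SimplyConnected)
    {s : Store} (hI : SideInv R X T idx (3 * n) s) {g : Tri → Fin 3 → ℤ} (hg : IsHeight R X g) :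
    ∃ G, BoundedSolution (9 * n) (18 * n) (s.arr 5) (s.arr 6) (s.arr 7)
      ((8 * R.boundarySize : ℕ) : ℤ) G := by
  -- The heights are shifted so that their minimum is 0.
  obtain ⟨⟨t₀, j₀⟩, h₀, hmin⟩ := (R.tris ×ˢ (Finset.univ : Finset (Fin 3))).exists_min_image
    (fun p => g p.1 p.2) (hR.nonempty.product Finset.univ_nonempty)
  simp only [Finset.mem_product, Finset.mem_univ, and_true, Prod.forall] at h₀ hmin
  -- Only three cells in nine are used. The remainder modulo 3 fills the others with heights of the
  -- same triangle, so the bounds hold on all cells.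
  obtain ⟨G, hGdef⟩ : ∃ G : ℤ → ℤ, G = fun u => g (T (u / 9).toNat) (Fin.ofNat 3 (u % 9).toNat) - g t₀ j₀ :=
    ⟨_, rfl⟩
  have hG : ∀ (j : ℕ) (c : Fin 3), G (c.val + 9 * j) = g (T j) c - g t₀ j₀ := by
    intro j c
    have hc := c.isLt
    have h1 : ((c.val + 9 * j : ℤ) / 9).toNat = j := by omega
    have h2 : ((c.val + 9 * j : ℤ) % 9).toNat = c.val := by omega
    rw [hGdef]
    simp only [h1, h2, Fin.ofNat_eq_cast, Fin.cast_val_eq_self]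
  refine ⟨G, ?_, ?_⟩
  · intro k h0 h1
    obtain ⟨j, i, c, hj, hc, -, hs⟩ := hI.exists_slot h0 h1
    change G (constraint s k).1 + (constraint s k).2.2.1 ≤ G (constraint s k).2.1
    rw [hs]
    have hm := h.T_mem j hj
    have hnb : R.Inner ((T j).side i) → T (idx ((T j).nb i)) = (T j).nb i :=
      fun hi => h.T_idx _ ((Region.inner_side _ _).1 hi).2.2
    interval_cases c
    · simp only [slot, hG]
      have h2 := hg.lower _ hm i
      have h3 := hg.tight _ hm i
      split_ifs with hi
      · linarith
      · have := h3 (by tauto)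
        linarith
    · simp only [slot, hG]
      linarith [hg.upper _ hm i]
    · simp only [slot]
      split_ifs with hi
      · simp only [hG, hnb hi, hg.glue _ i hi, add_zero, le_refl]
      · simp
    · simp only [slot]
      split_ifs with hi
      · simp only [hG, hnb hi, hg.glue' _ i hi, add_zero, le_refl]
      · simp
    · simp only [slot]
      split_ifs with hi
      · simp only [hG, hnb hi.1, salience]
        cases hr : (T j).right
        · have := hg.salient _ i hr hi.1 hi.2
          simp
          linarith
        · have := hg.salient ((T j).nb i) i (by simp [Tri.nb_right, hr])
            (by rw [Tri.nb_side]; exact hi.1) (by rw [Tri.nb_side]; exact hi.2)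
          rw [Tri.nb_nb] at this
          simp
          linarith
      · simp
    · simp [slot]
  · intro u h0 h1
    rw [hGdef]
    have hm := h.T_mem (u / 9).toNat (by push_cast at h1; omega)
    have h2 := hmin _ (Fin.ofNat 3 (u % 9).toNat) hm
    have h3 := hg.range_le hR h₀ hm (Fin.ofNat 3 (u % 9).toNat) j₀
    push_cast
    constructor <;> linarith

/-- The number `d = 3 * j + i` stands for side `i` of triangle `j`, so the counter in variable 20 is
`|∂R|`, which is not part of the input. -/
theorem card_filter_boundary (h : Input R X n T idx a) : (open Classical in
    ((Finset.range (3 * n)).filter fun d =>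
      ¬ R.Inner ((T (d / 3)).side (Fin.ofNat 3 d))).card) = R.boundarySize := by
  classical
  rw [← Region.card_boundarySides]
  refine Finset.card_nbij' (fun d => (T (d / 3), Fin.ofNat 3 d))
    (fun p => 3 * idx p.1 + p.2.val) ?_ ?_ ?_ ?_
  · intro d hd
    simp only [Finset.coe_filter, Finset.mem_range, Set.mem_ofPred_eq] at hd
    exact Finset.mem_coe.2 (Region.mem_boundarySides.2 ⟨h.T_mem _ (by omega), hd.2⟩)
  · rintro ⟨t, i⟩ hp
    obtain ⟨ht, hi⟩ := Region.mem_boundarySides.1 (Finset.mem_coe.1 hp)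
    have h1 := h.idx_lt t ht
    have h2 := i.isLt
    have h3 : (3 * idx t + i.val) / 3 = idx t := by omega
    have h4 : Fin.ofNat 3 (3 * idx t + i.val) = i := Fin.ext (by simp [Fin.ofNat])
    simp only [Finset.coe_filter, Finset.mem_range, Set.mem_ofPred_eq, h3, h4, h.T_idx t ht]
    exact ⟨by omega, hi⟩
  · intro d hd
    simp only [Finset.coe_filter, Finset.mem_range, Set.mem_ofPred_eq] at hd
    simp only [h.idx_T _ (show d / 3 < n by omega), Fin.ofNat]
    omega
  · rintro ⟨t, i⟩ hp
    obtain ⟨ht, hi⟩ := Region.mem_boundarySides.1 (Finset.mem_coe.1 hp)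
    have h2 := i.isLt
    have h3 : (3 * idx t + i.val) / 3 = idx t := by omega
    have h4 : Fin.ofNat 3 (3 * idx t + i.val) = i := Fin.ext (by simp [Fin.ofNat])
    simp only [h3, h4, h.T_idx t ht]

end Prog
namespace Prog

/-! ### The output -/

/-- Append variable `x` to the output. -/
def put (x : ℕ) : Prog := block [store 1 1 x, add 1 1 2]

/-- The output written so far is `L`. -/
def Holds (s : Store) (L : List ℤ) : Prop :=
  s.var 1 = L.length ∧ ∀ i < L.length, s.arr 1 i = L.getD i 0

theorem Holds.output {s : Store} {L : List ℤ} (h : Holds s L) : s.output = L := by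
  obtain ⟨h1, h2⟩ := h
  have ho : s.output = (List.range L.length).map fun j : ℕ => s.arr 1 (j : ℤ) := by
    simp [Store.output, h1, ← List.map_eq_flatMap, Function.comp_def]
  rw [ho]
  refine List.ext_getElem (by simp) ?_
  intro i hi hi'
  simp [h2 i hi', hi']

theorem Holds.put {s : Store} {L : List ℤ} (h : Holds s L) (h2 : s.var 2 = 1) (x : ℕ) :
    Holds ((put x).eval s) (L ++ [s.var x]) := by
  obtain ⟨h1, h3⟩ := h
  constructor
  · simp [Prog.put, block, eval, Store.set, Store.write, h1, h2]
  · intro i hi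
    rw [List.length_append, List.length_singleton] at hi
    simp [Prog.put, block, eval, Store.set, Store.write, Function.update_apply, h1]
    split_ifs with hi'
    · subst hi'
      simp
    · have hlt : i < L.length := by omega
      rw [h3 i hlt]
      simp [hlt, List.getElem?_append_left]

theorem put_var (s : Store) (x : ℕ) {y : ℕ} (hy : y ≠ 1) : ((put x).eval s).var y = s.var y :=
  eval_var rfl s (by simp [put, block, writes, hy])

/-- Find the calisson on a left triangle with base point `(54, 55)`, whose heights are in the
variables `50`, `51` and `52`. -/
def chooseColor : Prog :=
  block [sub 53 51 52, sub 57 52 50,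
    ite 53 (block [const 56 0, add 54 54 2])
      (ite 57 (block [const 56 1, add 54 54 2, add 55 55 2]) (const 56 2))]

/-- Read the data of a triangle. -/
def readTriangle : Prog :=
  block [add 11 7 2, load 55 0 11, add 11 11 2, load 13 0 11, load 54 0 7, load 50 9 7,
    add 12 7 2, load 51 9 12, add 12 12 2, load 52 9 12]

/-- Output the calisson on a left triangle. -/
def outStep : Prog :=
  block [readTriangle, ite 13 skip (block [chooseColor, put 54, put 55, put 56])]

/-! ### Correctness of the output and of the whole program. -/

section Output

variable {R : Region} {X : Set Edge} {n : ℕ} {T : ℕ → Tri} {idx : Tri → ℕ} {a G : ℤ → ℤ}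

/-- For directions 0 and 1, `eps` is 0, so a side is overlapped when the height drops along it. The
base point of the calisson is the end of the overlapped side. -/
theorem chooseColor_eval {s : Store} {t : Tri} {g : Tri → Fin 3 → ℤ} (ht : t.right = false)
    (h2 : s.var 2 = 1) (h54 : s.var 54 = t.base.1) (h55 : s.var 55 = t.base.2)
    (h50 : s.var 50 = g t 0) (h51 : s.var 51 = g t 1) (h52 : s.var 52 = g t 2) :
    [(chooseColor.eval s).var 54, (chooseColor.eval s).var 55, (chooseColor.eval s).var 56] =
      calissonCode (t.side (overlap g t)).calisson := by
  obtain ⟨⟨x, y⟩, r⟩ := t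
  obtain rfl : r = false := ht
  simp only at h54 h55
  by_cases c1 : g ⟨(x, y), false⟩ 2 < g ⟨(x, y), false⟩ 1
  · simp [chooseColor, block, eval, Store.set, overlap, Tri.top, Tri.bot, eps, h2, h54, h55, h50,
      h51, h52, c1, calissonCode, Edge.calisson, Tri.side, dir, phi]
  · by_cases c2 : g ⟨(x, y), false⟩ 0 < g ⟨(x, y), false⟩ 2
    · simp [chooseColor, block, eval, Store.set, overlap, Tri.top, Tri.bot, eps, h2, h54, h55, h50,
        h51, h52, c1, c2, calissonCode, Edge.calisson, Tri.side, dir, phi]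
    · simp [chooseColor, block, eval, Store.set, overlap, Tri.top, Tri.bot, eps, h54, h55, h50,
        h51, h52, c1, c2, calissonCode, Edge.calisson, Tri.side, dir, phi]

theorem readTriangle_eval {x₀ y₀ : ℤ} {s : Store} (h : Context a n x₀ y₀ s) :
    (readTriangle.eval s).var 54 = a (s.var 7) ∧ (readTriangle.eval s).var 55 = a (s.var 7 + 1) ∧
    (readTriangle.eval s).var 13 = a (s.var 7 + 2) ∧
    (readTriangle.eval s).var 50 = s.arr 9 (s.var 7) ∧
    (readTriangle.eval s).var 51 = s.arr 9 (s.var 7 + 1) ∧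
    (readTriangle.eval s).var 52 = s.arr 9 (s.var 7 + 2) := by
  have h2 : s.var 7 + 1 + 1 = s.var 7 + 2 := by ring
  simp [readTriangle, block, eval, Store.set, h.one, h.input, h2]

/-- The answer after the first `j` triangles. -/
def answer (T : ℕ → Tri) (g : Tri → Fin 3 → ℤ) (j : ℕ) : List ℤ :=
  1 :: (calissonList g ((List.range j).map T)).flatMap calissonCode

theorem answer_succ (T : ℕ → Tri) (g : Tri → Fin 3 → ℤ) (j : ℕ) :
    answer T g (j + 1) = answer T g j ++
      if (T j).right then [] else calissonCode ((T j).side (overlap g (T j))).calisson := by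
  cases hr : (T j).right <;>
    simp [answer, calissonList, List.range_succ, List.filter_append, hr]

/-- The invariant of the output loop. -/
structure OutInv (n : ℕ) (T : ℕ → Tri) (a G : ℤ → ℤ) (g : Tri → Fin 3 → ℤ) (j : ℕ) (s : Store) :
    Prop where
  context : Context a n (T 0).base.1 (T 0).base.2 s
  values : s.arr 9 = G
  holds : Holds s (answer T g j)

theorem outStep_spec (h : Input R X n T idx a) {g : Tri → Fin 3 → ℤ}
    (hg : ∀ j < n, ∀ c : Fin 3, g (T j) c = G (9 * j + c.val)) {j : ℕ} (hj : j < n) {s : Store}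
    (hI : OutInv n T a G g j s) (h7 : s.var 7 = 9 * j) :
    OutInv n T a G g (j + 1) (outStep.eval s) := by
  have hr := reaches_eval outStep rfl s
  refine ⟨hI.context.reaches hr (by decide) (by decide),
    (hr.arr_eq (by decide)).trans hI.values, ?_⟩
  obtain ⟨r54, r55, r13, r50, r51, r52⟩ := readTriangle_eval hI.context
  have r2 : (readTriangle.eval s).var 2 = 1 := by
    rw [eval_var rfl s (by decide), hI.context.one]
  have r1 : Holds (readTriangle.eval s) (answer T g j) := by
    constructor
    · rw [eval_var rfl s (by decide)]; exact hI.holds.1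
    · rw [eval_arr rfl s (by decide)]; exact hI.holds.2
  rw [h7] at r54 r55 r13 r50 r51 r52
  rw [h.fst j hj] at r54
  rw [h.snd j hj] at r55
  rw [h.right j hj] at r13
  rw [hI.values] at r50 r51 r52
  change Holds (eval (seq (ite 13 skip (block [chooseColor, put 54, put 55, put 56])) skip)
    (readTriangle.eval s)) _
  generalize readTriangle.eval s = s₁ at *
  rw [answer_succ, eval, eval, eval]
  by_cases hr : (T j).right = true
  · rw [if_pos (by rw [r13, bit_pos]; exact hr), if_pos hr, List.append_nil]
    exact r1
  · rw [if_neg (by rw [r13, bit_pos]; exact hr), if_neg hr]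
    have hc := chooseColor_eval (t := T j) (g := g) (s := s₁) (by simpa using hr) r2 r54 r55
      (by rw [r50, hg j hj]; simp) (by rw [r51, hg j hj]; simp) (by rw [r52, hg j hj]; simp)
    have k2 : (chooseColor.eval s₁).var 2 = 1 := by rw [eval_var rfl s₁ (by decide), r2]
    have k1 : Holds (chooseColor.eval s₁) (answer T g j) := by
      constructor
      · rw [eval_var rfl s₁ (by decide)]; exact r1.1
      · rw [eval_arr rfl s₁ (by decide)]; exact r1.2
    rw [← hc]
    change Holds ((put 56).eval ((put 55).eval ((put 54).eval (chooseColor.eval s₁)))) _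
    have p1 := k1.put k2 54
    have p2 := p1.put (by rw [put_var _ _ (by decide), k2]) 55
    have p3 := p2.put (by rw [put_var _ _ (by decide), put_var _ _ (by decide), k2]) 56
    rw [put_var _ _ (by decide)] at p2
    rw [put_var _ _ (by decide), put_var _ _ (by decide), put_var _ _ (by decide)] at p3
    simpa using p3

/-! ### The whole program -/

/-- Compute the bound for the heights. -/
def cap : Prog := block [add 22 20 20, add 22 22 22, add 22 22 22]

/-- Report that there is no solution. -/
def reject : Prog := block [const 1 0, put 3]

/-- Output the solution. -/
def accept : Prog := seq (block [const 1 0, put 2]) (forEach outStep)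

/-- The program that solves calisson puzzles. -/
def solve : Prog :=
  seq table (seq (forEach indexStep) (seq (forEach buildStep) (seq cap (seq relax
    (ite 23 reject accept)))))

theorem holds_put_nil {s : Store} (h2 : s.var 2 = 1) {x : ℕ} (hx : x ≠ 1) :
    Holds ((block [const 1 0, put x]).eval s) [s.var x] := by
  have h : Holds (s.set 1 0) [] := ⟨by simp [Store.set], fun i hi => by simp at hi⟩
  have := h.put (by simpa [Store.set] using h2) x
  rw [set_var, if_neg hx] at this
  exact this

theorem reaches_accept (h : Input R X n T idx a) {g : Tri → Fin 3 → ℤ}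
    (hg : ∀ j < n, ∀ c : Fin 3, g (T j) c = G (9 * j + c.val)) {s : Store}
    (hs : Context a n (T 0).base.1 (T 0).base.2 s) (h9 : s.arr 9 = G) :
    ∃ s', accept.Reaches s (5 + ((outStep.size + 5) * n + 4)) s' ∧
      s'.output = answer T g n := by
  have hr := reaches_eval (block [const 1 0, put 2]) rfl s
  have hc := hs.reaches hr (by decide) (by decide)
  have hh := holds_put_nil hs.one (x := 2) (by decide)
  rw [hs.one] at hh
  have hv : ((block [const 1 0, put 2]).eval s).arr 9 = G :=
    (hr.arr_eq (by decide)).trans h9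
  generalize (block [const 1 0, put 2]).eval s = s₁ at *
  obtain ⟨s', hr', hI⟩ := reaches_forEach (P := outStep) (c := outStep.size) (n := n)
    (OutInv n T a G g)
    (fun j s _ _ _ hI => ⟨⟨hI.context.len, hI.context.one, hI.context.zero, hI.context.fst,
      hI.context.snd, hI.context.input, hI.context.table⟩, hI.values, hI.holds⟩)
    (fun j hj s hI h7 _ => ⟨_, reaches_eval outStep rfl s, outStep_spec h hg hj hI h7,
      eval_var rfl s (by decide), eval_var rfl s (by decide)⟩) s₁ hc.len hc.zero
    (fun _ _ => ⟨⟨hc.len, hc.one, hc.zero, hc.fst, hc.snd, hc.input, hc.table⟩, hv, hh⟩)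
  exact ⟨s', hr.seq hr', hI.holds.output⟩

theorem reaches_solve (h : Input R X n T idx a) (hR : R.SimplyConnected) {s : Store}
    (h0 : s.var 0 = 9 * n) (hv : ∀ x, x ≠ 0 → s.var x = 0) (ha : s.arr 0 = a)
    (hz : ∀ A, A ≠ 0 → ∀ i, s.arr A i = 0) :
    ∃ s', solve.Reaches s ((9 * (9 * n + 1) + 9) + (((indexStep.size + 5) * n + 4) +
      (((buildStep.size + 5) * n + 4) + (4 + (((relaxStep.size + 1) *
        (19 * (9 * n * (8 * R.boundarySize)) + 18 * n) + 1) +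
        ((5 + ((outStep.size + 5) * n + 4)) + 1)))))) s' ∧
      CorrectAnswer R X s'.output := by
  have hx : a 0 = (T 0).base.1 := by simpa using h.fst 0 h.pos
  have hy : a 1 = (T 0).base.2 := by simpa using h.snd 0 h.pos
  obtain ⟨s₁, r₁, c₁⟩ := reaches_table h0 ha
  rw [hx, hy] at c₁
  have z₁ : ∀ A, A ≠ 0 → A ≠ 2 → ∀ i, s₁.arr A i = 0 := fun A h1 h2 i => by
    rw [r₁.arr_eq (by simp [table, tableStep, block, stores, h2]), hz A h1]
  obtain ⟨s₂, r₂, c₂, i₂⟩ := reaches_index h c₁ (z₁ 3 (by decide) (by decide))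
    (z₁ 4 (by decide) (by decide))
  have z₂ : ∀ A ∈ [5, 6, 7, 8, 9], ∀ i, s₂.arr A i = 0 := fun A hA i => by
    rw [r₂.arr_eq (by revert A; decide)]
    exact z₁ A (by rintro rfl; revert hA; decide) (by rintro rfl; revert hA; decide) i
  have v₂ : ∀ x ∈ [20, 21, 23], s₂.var x = 0 := fun x hx => by
    rw [r₂.var_eq (by revert x; decide), r₁.var_eq (by revert x; decide)]
    exact hv x (by rintro rfl; revert hx; decide)
  obtain ⟨s₃, r₃, b₃⟩ := reaches_build h c₂ i₂ (v₂ 20 (by decide)) (v₂ 21 (by decide))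
    (fun A hA => z₂ A (by revert A; decide))
  have z₃ : ∀ i, s₃.arr 9 i = 0 := fun i => by
    rw [r₃.arr_eq (by decide), z₂ 9 (by decide)]
  have v₃ : s₃.var 23 = 0 := by rw [r₃.var_eq (by decide), v₂ 23 (by decide)]
  have m₃ : s₃.var 20 = R.boundarySize := by
    rw [b₃.sides.count]
    exact_mod_cast card_filter_boundary h
  have r₄ := reaches_eval cap rfl s₃
  have e22 : (cap.eval s₃).var 22 = ((8 * R.boundarySize : ℕ) : ℤ) := by
    simp [cap, block, eval, Store.set, m₃]
    ring
  have c₄ := b₃.context.reaches r₄ (by decide) (by decide)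
  have a₄ : ∀ A, (cap.eval s₃).arr A = s₃.arr A := fun A => rfl
  have v₄ : ∀ x, x ≠ 22 → (cap.eval s₃).var x = s₃.var x := fun x hx =>
    eval_var rfl s₃ (by simp [cap, block, writes, hx])
  generalize cap.eval s₃ = s₄ at *
  obtain ⟨s₅, r₅, k₅, f₅⟩ := reaches_relax (s := s₄) (b₃.sides.isSystem h) c₄.one e22
    (a₄ 5) (a₄ 6) (a₄ 7) (a₄ 8) (fun u => by rw [a₄, z₃])
    (by rw [v₄ 21 (by decide), b₃.height]; push_cast; ring)
    (fun i h1 h2 => by rw [a₄]; exact b₃.stack i h1 (by push_cast at h2; exact h2))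
    (by rw [v₄ 23 (by decide), v₃])
  have c₅ := c₄.reaches r₅ (by decide) (by decide)
  suffices hfin : ∃ s', (ite 23 reject accept).Reaches s₅
      ((5 + ((outStep.size + 5) * n + 4)) + 1) s' ∧ CorrectAnswer R X s'.output by
    obtain ⟨s', r', hc⟩ := hfin
    exact ⟨s', r₁.seq (r₂.seq (r₃.seq (r₄.seq (r₅.seq r')))), hc⟩
  by_cases hfail : 0 < s₅.var 23
  · obtain ⟨j, hj, hr⟩ := reaches_eval reject rfl s₅
    refine ⟨_, ⟨j + 1, ?_, .ite_pos hfail hr⟩, Or.inr ⟨?_, ?_⟩⟩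
    · have : reject.size = 5 := rfl
      omega
    · have := (holds_put_nil c₅.one (x := 3) (by decide)).output
      rw [c₅.zero] at this
      exact this
    -- A solution would have heights of range at most `8 * |∂R|`, hence bounded values satisfying
    -- the constraints.
    · rintro ⟨S, hS⟩
      obtain ⟨g, hg⟩ := hR.exists_height hS
      exact f₅ hfail (b₃.sides.exists_boundedSolution h hR hg)
  · have hG := b₃.sides.isHeight h (k₅ hfail)
    obtain ⟨s', ⟨j, hj, hr⟩, ho⟩ := reaches_accept h
      (g := fun t j => s₅.arr 9 (j.val + 9 * idx t)) (G := s₅.arr 9)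
      (fun j hj c => by simp only [h.idx_T j hj]; rw [add_comm]) c₅ rfl
    refine ⟨s', ⟨j + 1, by omega, .ite_neg hfail hr⟩, Or.inl ⟨_, ?_, ?_, ho⟩⟩
    · refine IsHeight.nodup_calissonList (List.Nodup.map_on ?_ List.nodup_range)
      intro i hi j hj hij
      rw [List.mem_range] at hi hj
      rw [← h.idx_T i hi, hij, h.idx_T j hj]
    · refine hG.isSolution ?_
      ext t
      simp only [List.mem_toFinset, List.mem_map, List.mem_range]
      constructor
      · rintro ⟨j, hj, rfl⟩
        exact h.T_mem j hj
      · intro ht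
        exact ⟨idx t, h.idx_lt t ht, h.T_idx t ht⟩

end Output
end Prog

/-! ### The encoding of the input -/

theorem getD_flatMap {α : Type*} (f : α → List ℤ) (m : ℕ) (hf : ∀ x, (f x).length = m) (l : List α)
    (d : α) {j c : ℕ} (hj : j < l.length) (hc : c < m) :
    (l.flatMap f).getD (m * j + c) 0 = (f (l.getD j d)).getD c 0 := by
  induction l generalizing j with
  | nil => simp at hj
  | cons x l ih =>
    cases j with
    | zero =>
      rw [List.flatMap_cons, Nat.mul_zero, Nat.zero_add,
        List.getD_append _ _ _ _ (by rw [hf]; exact hc)]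
      rfl
    | succ j =>
      rw [List.flatMap_cons, List.getD_append_right _ _ _ _ (by rw [hf, Nat.mul_add]; omega), hf,
        List.getD_cons_succ, ← ih (by simpa using hj)]
      congr 1
      rw [Nat.mul_add]
      omega

theorem triCode_length (R : Region) (X : Set Edge) (t : Tri) : (triCode R X t).length = 9 := rfl

theorem puzzleCode_length (R : Region) (X : Set Edge) (l : List Tri) :
    (puzzleCode R X l).length = 9 * l.length := by
  simp [puzzleCode, List.length_flatMap, triCode_length, mul_comm]

theorem input_puzzleCode {R : Region} (X : Set Edge) {l : List Tri} (hR : R.SimplyConnected)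
    (hnd : l.Nodup) (hl : l.toFinset = R.tris) :
    Input R X l.length (fun j => l.getD j ⟨0, false⟩) (fun t => l.idxOf t)
      ((Store.init (puzzleCode R X l)).arr 0) := by
  have hcard : l.length = R.tris.card := by rw [← hl, List.toFinset_card_of_nodup hnd]
  have hmem : ∀ t, t ∈ l ↔ t ∈ R.tris := fun t => by rw [← hl, List.mem_toFinset]
  have hpos : 0 < l.length := by
    rw [hcard]
    exact Finset.card_pos.2 hR.nonempty
  have hT : ∀ j < l.length, l.getD j ⟨0, false⟩ ∈ R.tris := fun j hj => by
    rw [List.getD_eq_getElem _ _ hj, ← hmem]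
    exact List.getElem_mem hj
  have hcode : ∀ j < l.length, ∀ c < 9, (Store.init (puzzleCode R X l)).arr 0 (9 * j + (c : ℕ)) =
      (triCode R X (l.getD j ⟨0, false⟩)).getD c 0 := by
    intro j hj c hc
    have : (9 * (j : ℤ) + c).toNat = 9 * j + c := by omega
    rw [← getD_flatMap (triCode R X) 9 (triCode_length R X) l _ hj hc]
    simp only [Store.init, true_and]
    rw [if_pos (by omega), this]
    rfl
  refine ⟨hpos, ?_, hT, ?_, ?_, ?_, ?_, ?_, ?_, ?_, ?_⟩
  · intro j hj
    rw [List.getD_eq_getElem _ _ hj, hnd.idxOf_getElem]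
  · intro t ht
    exact List.idxOf_lt_length_iff.2 ((hmem t).2 ht)
  · intro t ht
    have := List.idxOf_lt_length_iff.2 ((hmem t).2 ht)
    rw [List.getD_eq_getElem _ _ this, List.getElem_idxOf]
  · intro j hj
    simpa [triCode] using hcode j hj 0 (by decide)
  · intro j hj
    simpa [triCode] using hcode j hj 1 (by decide)
  · intro j hj
    simpa [triCode] using hcode j hj 2 (by decide)
  · intro j hj i
    have := hcode j hj (3 + i.val) (by omega)
    push_cast at this
    rw [this]
    fin_cases i <;> rfl
  · intro j hj i
    have := hcode j hj (6 + i.val) (by omega)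
    push_cast at this
    rw [this]
    fin_cases i <;> rfl
  · intro t ht
    rw [hcard]
    exact hR.extent (hT 0 hpos) ht

/-! ### The running time and the theorem. -/

/-- Relaxation dominates: its term `19 * 9 * 8 * n * m = 1368 * n * m`, together with `18 * n`, is
at most `2772 * m ^ 3`, since `n * m` and `n` are both at most `2 * m ^ 3`. -/
theorem time_le {n m A B Z O : ℕ} (hm : 1 ≤ m) (hn : n ≤ 2 * m ^ 2) :
    (9 * (9 * n + 1) + 9) + (((A + 5) * n + 4) + (((B + 5) * n + 4) + (4 + (((Z + 1) *
      (19 * (9 * n * (8 * m)) + 18 * n) + 1) + ((5 + ((O + 5) * n + 4)) + 1))))) ≤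
      (41 + 2 * (96 + A + B + O) + (Z + 1) * 2772) * m ^ 3 := by
  have h1 : 1 ≤ m ^ 3 := Nat.one_le_pow _ _ hm
  have h2 : n * m ≤ 2 * m ^ 3 := by
    calc n * m ≤ 2 * m ^ 2 * m := Nat.mul_le_mul_right _ hn
      _ = 2 * m ^ 3 := by ring
  have h3 : n ≤ 2 * m ^ 3 := le_trans (Nat.le_mul_of_pos_right _ hm) h2
  have h4 : (96 + A + B + O) * n ≤ (96 + A + B + O) * (2 * m ^ 3) := Nat.mul_le_mul_left _ h3
  have h5 : (Z + 1) * (1368 * (n * m) + 18 * n) ≤ (Z + 1) * (2772 * m ^ 3) :=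
    Nat.mul_le_mul_left _ (by omega)
  nlinarith

end Calissons

theorem theorem2 :
    ∃ (P : Calissons.Prog) (C : ℕ),
      ∀ (R : Calissons.Region) (X : Set Calissons.Edge) (l : List Calissons.Tri),
        R.SimplyConnected → l.Nodup → l.toFinset = R.tris →
          ∃ (k : ℕ) (out : List ℤ),
            P.Computes (Calissons.puzzleCode R X l) k out ∧
              k ≤ C * R.boundarySize ^ 3 ∧
              Calissons.CorrectAnswer R X out := by
  refine ⟨Calissons.Prog.solve, 41 + 2 * (96 + Calissons.Prog.indexStep.size +
    Calissons.Prog.buildStep.size + Calissons.Prog.outStep.size) +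
    (Calissons.Prog.relaxStep.size + 1) * 2772, fun R X l hR hnd hl => ?_⟩
  obtain ⟨s, ⟨k, hk, hs⟩, hc⟩ := Calissons.Prog.reaches_solve
    (Calissons.input_puzzleCode X hR hnd hl) hR (s := Calissons.Store.init _)
    (by simp [Calissons.Store.init, Calissons.puzzleCode_length])
    (fun x hx => by simp [Calissons.Store.init, hx]) rfl
    (fun A hA i => by simp [Calissons.Store.init, hA])
  refine ⟨k, s.output, ⟨s, hs, rfl⟩, hk.trans (Calissons.time_le ?_ ?_), hc⟩
  · exact Calissons.Region.one_le_boundarySize hR.nonempty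
  · rw [← List.toFinset_card_of_nodup hnd, hl]
    exact R.card_tris_le
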